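/- \textbf{Conventions.} Work over $\mathbb{Q}(q,t)$. Partitions are identified with Young diagrams (English notation); the content of a box is $c(\square)=\text{column}-\text{row}$. For a partition $\lambda$ and $n\ge n_\lambda:=|\lambda|+\lambda_1$ put $\lambda^{(n)}:=(n-|\lambda|,\lambda_1,\lambda_2,\dots)$; $\lambda^{(n+1)}$ is obtained from $\lambda^{(n)}$ by adding one box $\square_0$ at the end of the first row. \textbf{Tableaux.} Let $\mu$ be a diagram with $n$ boxes. $\mathrm{RYT}(\mu)$ is the set of labellings $T:\mu\to\mathbb{Z}_{\ge0}$ weakly decreasing along rows and columns; $\mathrm{SYT}(\mu)$ is the set of standard Young tableaux. $\mathrm{PSYT}(\mu)$ is the set of labellings $\tau$ of $\mu$ by formal products $jq^b$ ($1\le j\le n$, $b\ge0$), each $j$ occurring in exactly one box, strictly increasing along rows and columns for the order $jq^m<kq^\ell\iff m>\ell$, or $m=\ell$ and $j<k$; $\mathrm{SYT}(\mu)\subset\mathrm{PSYT}(\mu)$ is the part with all exponents $0$. If $\tau(\square)=iq^b$, write $c_\tau(i)=c(\square)$, $w_\tau(i)=b$. Let $s_i(\tau)$ be obtained by exchanging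 the labels $i,i+1$ and leaving the exponents in place (defined when the result is in $\mathrm{PSYT}(\mu)$), and let $\Psi(\tau)$ be obtained by replacing $kq^a$ by $(k-1)q^a$ for $k\ge2$ and $1q^a$ by $nq^{a+1}$. $\mathrm{PSYT}(\mu)$ is partially ordered by the cover relations $\Psi(\tau)>\tau$, and $s_i(\tau)>\tau$ if $w_\tau(i)<w_\tau(i+1)$ or if $w_\tau(i)=w_\tau(i+1)$ and $c_\tau(i)-c_\tau(i+1)>1$. For $T\in\mathrm{RYT}(\mu)$, $\mathrm{Top}(T)$ is the greatest element of the set of those $\tau\in\mathrm{PSYT}(\mu)$ whose exponents are the values of $T$. \textbf{Algebras and modules.} $\mathcal{H}_n$ is the finite Hecke algebra generated by $T_1,\dots,T_{n-1}$ with $(T_i-1)(T_i+t)=0$ and the braid relations; $\bar\theta_1=1$, $\bar\theta_{i+1}=tT_i^{-1}\bar\theta_iT_i^{-1}$, $\bar\varphi_i=(tT_i^{-1})\bar\theta_i-\bar\theta_i(tT_i^{-1})$. The $\mathcal{H}_n$-module $\mu$ is generated by $\mathrm{SYT}(\mu)$ with relations $\bar\theta_i\tau=t^{c_\tau(i)}\tau$;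 $\bar\varphi_i\tau=(t^{c_\tau(i)}-t^{c_\tau(i+1)})s_i(\tau)$ if $s_i(\tau)>\tau$; $T_i\tau=\tau$ (resp. $T_i\tau=-t\tau$) if $i,i+1$ are in the same row (resp. column) of $\tau$. The positive double affine Hecke algebra $\mathcal{D}_n$ is generated by $T_1,\dots,T_{n-1}$, $\theta_1,\dots,\theta_n$, $X_1,\dots,X_n$, where the $T_i$ satisfy the relations of $\mathcal{H}_n$, the $\theta_i$ commute, $\theta_{i+1}=tT_i^{-1}\theta_iT_i^{-1}$, $T_i\theta_j=\theta_jT_i$ for $j\ne i,i+1$, the $X_i$ commute, $X_{i+1}=tT_i^{-1}X_iT_i^{-1}$, $T_iX_j=X_jT_i$ for $j\neq i,i+1$, and $\pi_nX_i=X_{i+1}\pi_n$ ($i<n$), $\pi_nX_n=qX_1\pi_n$ with $\pi_n:=t^{n-1}\theta_1T_1^{-1}\cdots T_{n-1}^{-1}$. The $T_i,\theta_i$ with the relations among them form the positive affine Hecke algebra $\mathcal{A}_n$, and $V_\mu:=\mathcal{D}_n\otimes_{\mathcal{A}_n}\mu$, where $T_i\in\mathcal{A}_n$ acts on $\mu$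 as $T_i$ and $\theta_i$ as $\bar\theta_i$. \textbf{Macdonald polynomials.} $\{F_\tau:\tau\in\mathrm{PSYT}(\mu)\}\subset V_\mu$ is the unique family such that $\theta_iF_\tau=q^{w_\tau(i)}t^{c_\tau(i)}F_\tau$ for all $i$; $F_\tau=1\otimes\tau$ for $\tau\in\mathrm{SYT}(\mu)$; $$\Bigl(tT_i^{-1}+\tfrac{(t-1)q^{w_\tau(i+1)}t^{c_\tau(i+1)}}{q^{w_\tau(i)}t^{c_\tau(i)}-q^{w_\tau(i+1)}t^{c_\tau(i+1)}}\Bigr)F_\tau=F_{s_i(\tau)}\quad\text{if } s_i(\tau)>\tau;$$ and $F_{\Psi(\tau)}=q^{w_\tau(1)}X_n\pi_n^{-1}F_\tau$. \textbf{Connecting map.} Let $\mathfrak{q}:\lambda^{(n+1)}\to\lambda^{(n)}$ be the linear map of modules of the Hecke algebras that sends a standard tableau $\tau$ to $\tau|_{\lambda^{(n)}}$ if $\tau(\square_0)=n+1$ and to $0$ otherwise. $\Phi^{(n)}_\lambda:V_{\lambda^{(n+1)}}\to V_{\lambda^{(n)}}$ is the $\mathbb{Q}(q,t)$-linear map with $\Phi^{(n)}_\lambda(X^\alpha\otimes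 v)=X_1^{\alpha_1}\cdots X_n^{\alpha_n}\otimes\mathfrak{q}(v)$ if $\alpha_{n+1}=0$, and $\Phi^{(n)}_\lambda(X^\alpha\otimes v)=0$ otherwise. \textbf{Proposition.} Let $\lambda$ be a partition, $n\ge n_\lambda$, and let $T\in\mathrm{RYT}(\lambda^{(n)})$ and $T'\in\mathrm{RYT}(\lambda^{(n+1)})$ be such that $T'(\square)=T(\square)$ for all $\square\in\lambda^{(n)}$ and $T'(\square_0)=0$. Then $\mathrm{Top}(T)$, $\mathrm{Top}(T')$, the families $(F_\tau)$ in $V_{\lambda^{(n)}}$ and $V_{\lambda^{(n+1)}}$ and the map $\Phi^{(n)}_\lambda$ exist and are uniquely determined by the above descriptions, and $$\Phi^{(n)}_\lambda\bigl(F_{\mathrm{Top}(T')}\bigr)=F_{\mathrm{Top}(T)}.$$ -/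

import Mathlib

open scoped TensorProduct

noncomputable section

namespace VVMac

/-! ### The base field `ℚ(q,t)` -/

/-- The field `ℚ(q,t)` of rational functions in two variables. -/
abbrev K : Type := FractionRing (MvPolynomial (Fin 2) ℚ)

/-- The parameter `q`. -/
def q : K := algebraMap (MvPolynomial (Fin 2) ℚ) K (MvPolynomial.X 0)

/-- The parameter `t`. -/
def t : K := algebraMap (MvPolynomial (Fin 2) ℚ) K (MvPolynomial.X 1)

/-! ### Diagrams

Boxes are pairs `(row, column)`, numbered from `0`.  Labels `1, …, n` of the text are the elements
`0, …, n - 1` of `Fin n`, and the simple transposition `s_{i+1}` is indexed by `i : Fin (n - 1)`: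
it exchanges the labels `lo i` and `hi i`. -/

/-- The boxes of a Young diagram. -/
abbrev Box (μ : YoungDiagram) : Type := {x : ℕ × ℕ // x ∈ μ}

/-- The content of a box: column minus row. -/
def content {μ : YoungDiagram} (x : Box μ) : ℤ := (x.1.2 : ℤ) - (x.1.1 : ℤ)

/-- `n_λ = |λ| + λ₁`. -/
def nMin (lam : YoungDiagram) : ℕ := lam.card + lam.rowLen 0

/-- `λ^{(n)} = (n - |λ|, λ₁, λ₂, …)` for `n ≥ n_λ`. -/
def pad (lam : YoungDiagram) (n : ℕ) (hn : nMin lam ≤ n) : YoungDiagram :=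
  YoungDiagram.ofRowLens ((n - lam.card) :: lam.rowLens) (by
    rw [List.sortedGE_iff_pairwise, List.pairwise_cons]
    refine ⟨fun a ha => ?_, lam.rowLens_sorted.pairwise⟩
    obtain ⟨i, -, rfl⟩ := List.mem_map.1 ha
    have h0 : lam.rowLen i ≤ lam.rowLen 0 := lam.rowLen_anti 0 i (Nat.zero_le i)
    unfold nMin at hn
    omega)

/-- The smaller label exchanged by the `i`-th simple transposition. -/
def lo {n : ℕ} (i : Fin (n - 1)) : Fin n := ⟨i.1, by have := i.2; omega⟩

/-- The larger label exchanged by the `i`-th simple transposition. -/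
def hi {n : ℕ} (i : Fin (n - 1)) : Fin n := ⟨i.1 + 1, by have := i.2; omega⟩

/-! ### Tableaux -/

/-- Non-negative reverse Young tableaux: weakly decreasing along rows and columns. -/
structure RYT (μ : YoungDiagram) where
  val : Box μ → ℕ
  row_le : ∀ x y : Box μ, x.1.1 = y.1.1 → x.1.2 < y.1.2 → val y ≤ val x
  col_le : ∀ x y : Box μ, x.1.2 = y.1.2 → x.1.1 < y.1.1 → val y ≤ val x

/-- Standard Young tableaux with label set `Fin n` (there are none unless `|μ| = n`). -/
structure SYT (n : ℕ) (μ : YoungDiagram) where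
  label : Box μ ≃ Fin n
  row_lt : ∀ x y : Box μ, x.1.1 = y.1.1 → x.1.2 < y.1.2 → label x < label y
  col_lt : ∀ x y : Box μ, x.1.2 = y.1.2 → x.1.1 < y.1.1 → label x < label y

/-- The order on formal products `j q^m`: `j q^m < k q^l` if `m > l`, or `m = l` and `j < k`. -/
def EntryLT {n : ℕ} (a b : Fin n × ℕ) : Prop := b.2 < a.2 ∨ (a.2 = b.2 ∧ a.1 < b.1)

/-- Non-negative periodic standard Young tableaux: the box `x` carries the formal product
`(label x) q^(wt x)`. -/
structure PSYT (n : ℕ) (μ : YoungDiagram) where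
  label : Box μ ≃ Fin n
  wt : Box μ → ℕ
  row_lt : ∀ x y : Box μ, x.1.1 = y.1.1 → x.1.2 < y.1.2 →
    EntryLT (label x, wt x) (label y, wt y)
  col_lt : ∀ x y : Box μ, x.1.2 = y.1.2 → x.1.1 < y.1.1 →
    EntryLT (label x, wt x) (label y, wt y)

/-- The inclusion of standard tableaux in periodic ones (all exponents of `q` are `0`). -/
def SYT.toPSYT {n : ℕ} {μ : YoungDiagram} (S : SYT n μ) : PSYT n μ where
  label := S.label
  wt := fun _ => 0
  row_lt := fun x y h h' => Or.inr ⟨rfl, S.row_lt x y h h'⟩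
  col_lt := fun x y h h' => Or.inr ⟨rfl, S.col_lt x y h h'⟩

/-- `c_τ(i)`. -/
def PSYT.c {n : ℕ} {μ : YoungDiagram} (τ : PSYT n μ) (i : Fin n) : ℤ :=
  content (τ.label.symm i)

/-- `w_τ(i)`. -/
def PSYT.w {n : ℕ} {μ : YoungDiagram} (τ : PSYT n μ) (i : Fin n) : ℕ :=
  τ.wt (τ.label.symm i)

/-- `σ = s_i(τ)`: the labels `i`, `i + 1` are exchanged, the exponents of `q` stay in place. -/
def IsSwap {n : ℕ} {μ : YoungDiagram} (i : Fin (n - 1)) (τ σ : PSYT n μ) : Prop :=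
  (∀ x, σ.label x = Equiv.swap (lo i) (hi i) (τ.label x)) ∧ ∀ x, σ.wt x = τ.wt x

/-- `s_i(τ)` exists, equals `σ`, and lies above `τ`. -/
def SwapUp {n : ℕ} {μ : YoungDiagram} (i : Fin (n - 1)) (τ σ : PSYT n μ) : Prop :=
  IsSwap i τ σ ∧ (τ.w (lo i) < τ.w (hi i) ∨
    (τ.w (lo i) = τ.w (hi i) ∧ 1 < τ.c (lo i) - τ.c (hi i)))

/-- `σ = Ψ(τ)`: `k q^a` becomes `(k - 1) q^a` for `k ≥ 2`, and `1 q^a` becomes `n q^(a+1)`. -/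
def IsPsi {n : ℕ} {μ : YoungDiagram} (τ σ : PSYT n μ) : Prop :=
  ∀ x, ((τ.label x).1 ≠ 0 → (σ.label x).1 + 1 = (τ.label x).1 ∧ σ.wt x = τ.wt x) ∧
    ((τ.label x).1 = 0 → (σ.label x).1 + 1 = n ∧ σ.wt x = τ.wt x + 1)

/-- The cover relations `σ > τ` that generate the order on periodic tableaux. -/
def Cover {n : ℕ} {μ : YoungDiagram} (τ σ : PSYT n μ) : Prop :=
  IsPsi τ σ ∨ ∃ i, SwapUp i τ σ

/-- The partial order `τ ≤ σ` generated by the cover relations. -/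
def PSYT.Le {n : ℕ} {μ : YoungDiagram} (τ σ : PSYT n μ) : Prop :=
  Relation.ReflTransGen Cover τ σ

/-- `τ` belongs to `PSYT(μ;T)`: its exponents of `q` are the values of `T`. -/
def PSYT.Over {n : ℕ} {μ : YoungDiagram} (τ : PSYT n μ) (T : RYT μ) : Prop :=
  ∀ x, τ.wt x = T.val x

/-- `τ = Top(T)`: the greatest element of `PSYT(μ;T)`. -/
def IsTop {n : ℕ} {μ : YoungDiagram} (T : RYT μ) (τ : PSYT n μ) : Prop :=
  τ.Over T ∧ ∀ σ : PSYT n μ, σ.Over T → σ.Le τ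

/-! ### The finite Hecke algebra and its modules -/

/-- For an element `x` with `(x - 1)(x + t) = 0` this is its inverse `x⁻¹ = t⁻¹ (x + t - 1)`. -/
def heckeInv {A : Type} [Ring A] [Algebra K A] (x : A) : A :=
  t⁻¹ • (x + algebraMap K A (t - 1))

theorem t_ne_zero : t ≠ 0 := by
  unfold t
  rw [Ne, IsFractionRing.to_map_eq_zero_iff]
  exact MvPolynomial.X_ne_zero 1

theorem heckeInv_spec {A : Type} [Ring A] [Algebra K A] (x : A)
    (hx : (x - 1) * (x + algebraMap K A t) = 0) :
    x * heckeInv x = 1 ∧ heckeInv x * x = 1 := by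
  have hc : algebraMap K A t * x = x * algebraMap K A t := Algebra.commutes t x
  have key : x * (x + algebraMap K A (t - 1)) = algebraMap K A t := by
    rw [map_sub, map_one]
    have h2 : x * (x + (algebraMap K A t - 1)) - algebraMap K A t
        = (x - 1) * (x + algebraMap K A t) := by noncomm_ring
    rw [hx] at h2
    exact sub_eq_zero.1 h2
  have hcomm : (x + algebraMap K A (t - 1)) * x = x * (x + algebraMap K A (t - 1)) := by
    rw [add_mul, mul_add, Algebra.commutes]
  have hone : t⁻¹ • algebraMap K A t = (1 : A) := by
    rw [Algebra.algebraMap_eq_smul_one, smul_smul, inv_mul_cancel₀ t_ne_zero, one_smul]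
  constructor
  · rw [heckeInv, mul_smul_comm, key, hone]
  · rw [heckeInv, smul_mul_assoc, hcomm, key, hone]

/-- The defining relations of the finite Hecke algebra. -/
inductive HeckeRel (n : ℕ) :
    FreeAlgebra K (Fin (n - 1)) → FreeAlgebra K (Fin (n - 1)) → Prop
  | quad (i : Fin (n - 1)) :
      HeckeRel n ((FreeAlgebra.ι K i - 1) * (FreeAlgebra.ι K i + algebraMap K _ t)) 0
  | braid (i j : Fin (n - 1)) (h : i.1 + 1 = j.1) :
      HeckeRel n (FreeAlgebra.ι K i * FreeAlgebra.ι K j * FreeAlgebra.ι K i)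
        (FreeAlgebra.ι K j * FreeAlgebra.ι K i * FreeAlgebra.ι K j)
  | comm (i j : Fin (n - 1)) (h : i.1 + 1 < j.1) :
      HeckeRel n (FreeAlgebra.ι K i * FreeAlgebra.ι K j)
        (FreeAlgebra.ι K j * FreeAlgebra.ι K i)

/-- The finite Hecke algebra `H_n`. -/
def Hecke (n : ℕ) : Type := RingQuot (HeckeRel n)

instance (n : ℕ) : Ring (Hecke n) := inferInstanceAs (Ring (RingQuot (HeckeRel n)))

instance (n : ℕ) : Algebra K (Hecke n) := inferInstanceAs (Algebra K (RingQuot (HeckeRel n)))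

/-- The quotient map from the free algebra. -/
def Hecke.mk (n : ℕ) : FreeAlgebra K (Fin (n - 1)) →ₐ[K] Hecke n :=
  RingQuot.mkAlgHom K (HeckeRel n)

/-- The generator `T_i` of `H_n`. -/
def Hecke.T {n : ℕ} (i : Fin (n - 1)) : Hecke n :=
  Hecke.mk n (FreeAlgebra.ι K i)

/-- The elements `θ̄_i` of `H_n`: `θ̄_1 = 1` and `θ̄_{i+1} = t T_i⁻¹ θ̄_i T_i⁻¹`. -/
def Hecke.thetaAux (n : ℕ) : (i : ℕ) → i < n → Hecke n
  | 0, _ => 1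
  | i + 1, h =>
      t • (heckeInv (Hecke.T ⟨i, by omega⟩) * Hecke.thetaAux n i (by omega) *
        heckeInv (Hecke.T ⟨i, by omega⟩))

/-- The elements `θ̄_i` of `H_n`. -/
def Hecke.theta {n : ℕ} (i : Fin n) : Hecke n := Hecke.thetaAux n i.1 i.2

/-- `φ̄_i = (t T_i⁻¹) θ̄_i - θ̄_i (t T_i⁻¹)`. -/
def Hecke.phi {n : ℕ} (i : Fin (n - 1)) : Hecke n :=
  (t • heckeInv (Hecke.T i)) * Hecke.theta (lo i) -
    Hecke.theta (lo i) * (t • heckeInv (Hecke.T i))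

/-- The generator attached to a standard tableau in the free `H_n`-module on standard tableaux. -/
def gen {n : ℕ} {μ : YoungDiagram} (S : SYT n μ) : SYT n μ →₀ Hecke n :=
  Finsupp.single S (1 : Hecke n)

/-- The defining relations of the `H_n`-module attached to `μ`, as elements of the free
`H_n`-module on the standard tableaux. -/
inductive SpechtRel (n : ℕ) (μ : YoungDiagram) : (SYT n μ →₀ Hecke n) → Prop
  | weight (S : SYT n μ) (i : Fin n) :
      SpechtRel n μ (Hecke.theta i • gen S -
        (t ^ S.toPSYT.c i) • gen S)
  | inter (S R : SYT n μ) (i : Fin (n - 1)) (h : SwapUp i S.toPSYT R.toPSYT) :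
      SpechtRel n μ (Hecke.phi i • gen S -
        (t ^ S.toPSYT.c (lo i) - t ^ S.toPSYT.c (hi i)) • gen R)
  | row (S : SYT n μ) (i : Fin (n - 1))
      (h : (S.label.symm (lo i)).1.1 = (S.label.symm (hi i)).1.1) :
      SpechtRel n μ (Hecke.T i • gen S - gen S)
  | col (S : SYT n μ) (i : Fin (n - 1))
      (h : (S.label.symm (lo i)).1.2 = (S.label.symm (hi i)).1.2) :
      SpechtRel n μ (Hecke.T i • gen S + t • gen S)

/-- The `H_n`-module attached to `μ`, generated by the standard tableaux of shape `μ`. -/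
abbrev Specht (n : ℕ) (μ : YoungDiagram) : Type :=
  (SYT n μ →₀ Hecke n) ⧸ Submodule.span (Hecke n) {v | SpechtRel n μ v}

/-- The vector of the `H_n`-module attached to a standard tableau. -/
def Specht.of {n : ℕ} {μ : YoungDiagram} (S : SYT n μ) : Specht n μ :=
  Submodule.Quotient.mk (gen S)

/-! ### The positive double affine Hecke algebra -/

/-- Generators of the positive double affine Hecke algebra. -/
inductive DGen (n : ℕ) : Type
  | T (i : Fin (n - 1))
  | theta (i : Fin n)
  | X (i : Fin n)

/-- The generator `T_i` as a word. -/
def wT {n : ℕ} (i : Fin (n - 1)) : FreeAlgebra K (DGen n) := FreeAlgebra.ι K (DGen.T i)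

/-- The generator `θ_i` as a word. -/
def wTheta {n : ℕ} (i : Fin n) : FreeAlgebra K (DGen n) := FreeAlgebra.ι K (DGen.theta i)

/-- The generator `X_i` as a word. -/
def wX {n : ℕ} (i : Fin n) : FreeAlgebra K (DGen n) := FreeAlgebra.ι K (DGen.X i)

/-- `π_n = t^{n-1} θ_1 T_1⁻¹ ⋯ T_{n-1}⁻¹`, as a word (`n ≥ 1`). -/
def wPi {n : ℕ} (h : 0 < n) : FreeAlgebra K (DGen n) :=
  t ^ (n - 1) • (wTheta ⟨0, h⟩ * (List.ofFn fun i : Fin (n - 1) => heckeInv (wT i)).prod)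

/-- The defining relations of the positive double affine Hecke algebra.  The relations from `quad`
to `T_theta` are those of the positive affine Hecke algebra. -/
inductive DahaRel (n : ℕ) : FreeAlgebra K (DGen n) → FreeAlgebra K (DGen n) → Prop
  | quad (i : Fin (n - 1)) : DahaRel n ((wT i - 1) * (wT i + algebraMap K _ t)) 0
  | braid (i j : Fin (n - 1)) (h : i.1 + 1 = j.1) :
      DahaRel n (wT i * wT j * wT i) (wT j * wT i * wT j)
  | comm (i j : Fin (n - 1)) (h : i.1 + 1 < j.1) : DahaRel n (wT i * wT j) (wT j * wT i)
  | theta_comm (i j : Fin n) : DahaRel n (wTheta i * wTheta j) (wTheta j * wTheta i)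
  | theta_succ (i : Fin (n - 1)) :
      DahaRel n (wTheta (hi i)) (t • (heckeInv (wT i) * wTheta (lo i) * heckeInv (wT i)))
  | T_theta (i : Fin (n - 1)) (j : Fin n) (h : j ≠ lo i) (h' : j ≠ hi i) :
      DahaRel n (wT i * wTheta j) (wTheta j * wT i)
  | X_comm (i j : Fin n) : DahaRel n (wX i * wX j) (wX j * wX i)
  | X_succ (i : Fin (n - 1)) :
      DahaRel n (wX (hi i)) (t • (heckeInv (wT i) * wX (lo i) * heckeInv (wT i)))
  | T_X (i : Fin (n - 1)) (j : Fin n) (h : j ≠ lo i) (h' : j ≠ hi i) :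
      DahaRel n (wT i * wX j) (wX j * wT i)
  | pi_X (hn : 0 < n) (i : Fin (n - 1)) :
      DahaRel n (wPi hn * wX (lo i)) (wX (hi i) * wPi hn)
  | pi_X_last (hn : 0 < n) :
      DahaRel n (wPi hn * wX ⟨n - 1, Nat.sub_lt hn Nat.one_pos⟩) (q • (wX ⟨0, hn⟩ * wPi hn))

/-- The positive double affine Hecke algebra `D_n`. -/
def Daha (n : ℕ) : Type := RingQuot (DahaRel n)

instance (n : ℕ) : Ring (Daha n) := inferInstanceAs (Ring (RingQuot (DahaRel n)))

instance (n : ℕ) : Algebra K (Daha n) := inferInstanceAs (Algebra K (RingQuot (DahaRel n)))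

/-- The quotient map from the free algebra. -/
def Daha.mk (n : ℕ) : FreeAlgebra K (DGen n) →ₐ[K] Daha n :=
  RingQuot.mkAlgHom K (DahaRel n)

/-- The generator `T_i` of `D_n`. -/
def Daha.T {n : ℕ} (i : Fin (n - 1)) : Daha n := Daha.mk n (wT i)

/-- The generator `θ_i` of `D_n`. -/
def Daha.theta {n : ℕ} (i : Fin n) : Daha n := Daha.mk n (wTheta i)

/-- The generator `X_i` of `D_n`. -/
def Daha.X {n : ℕ} (i : Fin n) : Daha n := Daha.mk n (wX i)

/-- The element `π_n` of `D_n` (`n ≥ 1`). -/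
def Daha.pi {n : ℕ} (h : 0 < n) : Daha n := Daha.mk n (wPi h)

/-- The monomial `X^α`. -/
def Daha.Xpow {n : ℕ} (α : Fin n → ℕ) : Daha n := (List.ofFn fun i => Daha.X i ^ α i).prod

/-! ### The induced module -/

/-- The relations `a ⊗ v = 1 ⊗ ρ(a) v`, for the generators `a` of the positive affine Hecke
algebra, where `ρ(T_i) = T_i` and `ρ(θ_i) = θ̄_i`. -/
inductive IndRel (n : ℕ) (μ : YoungDiagram) : Daha n ⊗[K] Specht n μ → Prop
  | T (i : Fin (n - 1)) (v : Specht n μ) :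
      IndRel n μ (Daha.T i ⊗ₜ[K] v - 1 ⊗ₜ[K] (Hecke.T i • v))
  | theta (i : Fin n) (v : Specht n μ) :
      IndRel n μ (Daha.theta i ⊗ₜ[K] v - 1 ⊗ₜ[K] (Hecke.theta i • v))

/-- The induced `D_n`-module `V_μ = D_n ⊗_{A_n} ρ^*(μ)`: the quotient of `D_n ⊗_K μ` by the
`D_n`-submodule that makes the tensor product balanced over the generators of `A_n`. -/
abbrev V (n : ℕ) (μ : YoungDiagram) : Type :=
  (Daha n ⊗[K] Specht n μ) ⧸ Submodule.span (Daha n) {x | IndRel n μ x}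

/-- The vector `d ⊗ v` of the induced module. -/
def V.tmul {n : ℕ} {μ : YoungDiagram} (d : Daha n) (v : Specht n μ) : V n μ :=
  Submodule.Quotient.mk (d ⊗ₜ[K] v)

/-! ### Non-symmetric vector-valued Macdonald polynomials -/

/-- The weight `q^{w_τ(i)} t^{c_τ(i)}`. -/
def PSYT.weight {n : ℕ} {μ : YoungDiagram} (τ : PSYT n μ) (i : Fin n) : K :=
  q ^ τ.w i * t ^ τ.c i

/-- `F` is the family `(F_τ)` of non-symmetric vector-valued Macdonald polynomials: weight vectors
for the `θ_i`, normalized on standard tableaux and related by the Knop–Sahi relations.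
In `psi`, the vector `u` is `π_n⁻¹ F_τ`. -/
structure IsMacdonald {n : ℕ} {μ : YoungDiagram} (F : PSYT n μ → V n μ) : Prop where
  weight : ∀ (τ : PSYT n μ) (i : Fin n), Daha.theta i • F τ = τ.weight i • F τ
  std : ∀ S : SYT n μ, F S.toPSYT = V.tmul 1 (Specht.of S)
  swap : ∀ (i : Fin (n - 1)) (τ σ : PSYT n μ), SwapUp i τ σ →
    (t • heckeInv (Daha.T i) + algebraMap K (Daha n)
      ((t - 1) * τ.weight (hi i) / (τ.weight (lo i) - τ.weight (hi i)))) • F τ = F σ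
  psi : ∀ (hn : 0 < n) (τ σ : PSYT n μ), IsPsi τ σ →
    ∃ u : V n μ, Daha.pi hn • u = F τ ∧
      F σ = q ^ τ.w ⟨0, hn⟩ • Daha.X ⟨n - 1, Nat.sub_lt hn Nat.one_pos⟩ • u

/-! ### Connecting maps -/

/-- `g` is the map `𝔮_λ^{(n)}` from the `H_{n+1}`-module of `λ^{(n+1)}` to the `H_n`-module of
`λ^{(n)}`: it sends a standard tableau with label `n + 1` in the added box to its restriction, and
every other standard tableau to `0`. -/
def IsRestriction (lam : YoungDiagram) (n : ℕ) (hn : nMin lam ≤ n)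
    (g : Specht (n + 1) (pad lam (n + 1) (Nat.le_succ_of_le hn)) →ₗ[K]
      Specht n (pad lam n hn)) : Prop :=
  (∀ (S' : SYT (n + 1) (pad lam (n + 1) (Nat.le_succ_of_le hn))) (S : SYT n (pad lam n hn)),
    (∀ x h', x ∉ pad lam n hn → S'.label ⟨x, h'⟩ = Fin.last n) →
    (∀ x h h', S'.label ⟨x, h'⟩ = (S.label ⟨x, h⟩).castSucc) →
      g (Specht.of S') = Specht.of S) ∧
  (∀ S' : SYT (n + 1) (pad lam (n + 1) (Nat.le_succ_of_le hn)),
    (∃ x h', x ∉ pad lam n hn ∧ S'.label ⟨x, h'⟩ ≠ Fin.last n) → g (Specht.of S') = 0)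

/-- `Φ` is the connecting map `Φ_λ^{(n)} : V_{λ^{(n+1)}} → V_{λ^{(n)}}`:
`Φ(X^α ⊗ v) = X_1^{α_1} ⋯ X_n^{α_n} ⊗ 𝔮(v)` if `α_{n+1} = 0`, and `Φ(X^α ⊗ v) = 0` otherwise. -/
def IsConnecting (lam : YoungDiagram) (n : ℕ) (hn : nMin lam ≤ n)
    (Φ : V (n + 1) (pad lam (n + 1) (Nat.le_succ_of_le hn)) →ₗ[K] V n (pad lam n hn)) : Prop :=
  ∃ g : Specht (n + 1) (pad lam (n + 1) (Nat.le_succ_of_le hn)) →ₗ[K] Specht n (pad lam n hn),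
    IsRestriction lam n hn g ∧
    ∀ (α : Fin (n + 1) → ℕ) (v : Specht (n + 1) (pad lam (n + 1) (Nat.le_succ_of_le hn))),
      Φ (V.tmul (Daha.Xpow α) v) =
        if α (Fin.last n) = 0 then V.tmul (Daha.Xpow fun i : Fin n => α i.castSucc) (g v) else 0

end VVMac

end

noncomputable section
namespace VVMac

/-! ### Weights and the coefficients of the seminormal form -/

/-! The identity holds for every periodic tableau, not only for greatest ones. For τ of shape
λ^{(n)} let τ⁺ be its extension by the label n+1 with exponent 0 in the added box; then Φ(F_{τ⁺}) =
F_τ (`connects_macdonald`). The proposition follows once Top(T') is identified with Top(T)⁺.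

All existence statements rest on an explicit model of V_μ, the seminormal module `Semi` with basis
PSYT(μ). There θ_i is diagonal with the prescribed weights, T_i acts on τ and s_i(τ) by Young's
seminormal 2×2 blocks, and S sends τ to q^{-w_τ(1)} Ψ(τ). Put X_n = Sπ and X_i = t⁻¹ T_i X_{i+1}
T_i. The double affine relations then follow formally from four relations of S with the T_i and θ_i
(`RaiseRel`). On the span of the standard tableaux θ_i agrees with θ̄_i, so the Specht module maps
to the model and induces `vMap` from V_μ. This map is onto, because covers lead from standard
tableaux to every periodic tableau (`PSYT.induction_cover`). It is injective by counting: the X^α ⊗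
S span V_μ, and in each bounded degree they are at most as many as the periodic tableaux
(`destandardize_injective`). Hence V_μ is the model and F_τ is the basis vector of τ. Moreover the
X^α ⊗ S form a basis of V_μ, so Φ exists, and π is invertible on V_μ, so the relations determine the
F_τ.

The map Φ commutes with T_i for i < n and with X_j for j ≤ n, kills the image of X_{n+1}, and
satisfies Φ π_{n+1} T_n = t π_n Φ (`connects_map_pi_T`). On tableaux, extension commutes with s_i,
while Ψ(τ)⁺ = s_n(Ψ(τ⁺)). The formula for F under Ψ followed by s_n is therefore carried by Φ to the
formula for F under Ψ alone, and induction along covers gives Φ(F_{τ⁺}) = F_τ.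

Greatest tableaux are recognised locally: a tableau from which no swap goes up (`Saturated`) is
determined by its exponents, since within one exponent its labels run through the columns in order.
Every tableau lies below such a one with the same exponents. Extension preserves this property
because the added box has exponent 0 and the largest content (`AddBox.saturated_extend`). -/

theorem q_ne_zero : q ≠ 0 := by
  unfold q
  rw [Ne, IsFractionRing.to_map_eq_zero_iff]
  exact MvPolynomial.X_ne_zero 0

theorem q_pow_mul_t_pow_injective {a b a' b' : ℕ} (h : q ^ a * t ^ b = q ^ a' * t ^ b') :
    a = a' ∧ b = b' := by
  have hm : ∀ m k : ℕ, q ^ m * t ^ k = algebraMap (MvPolynomial (Fin 2) ℚ) K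
      (MvPolynomial.monomial (Finsupp.single 0 m + Finsupp.single 1 k) 1) := by
    intro m k
    have : (MvPolynomial.monomial (Finsupp.single 0 m + Finsupp.single 1 k) (1 : ℚ) :
        MvPolynomial (Fin 2) ℚ) = MvPolynomial.X 0 ^ m * MvPolynomial.X 1 ^ k := by
      rw [MvPolynomial.X_pow_eq_monomial, MvPolynomial.X_pow_eq_monomial,
        MvPolynomial.monomial_mul, one_mul]
    rw [this, map_mul, map_pow, map_pow, q, t]
  rw [hm, hm] at h
  have h1 := IsFractionRing.injective (MvPolynomial (Fin 2) ℚ) K h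
  have h2 := MvPolynomial.monomial_left_injective (one_ne_zero (α := ℚ)) h1
  constructor
  · simpa using DFunLike.congr_fun h2 0
  · simpa using DFunLike.congr_fun h2 1

/-- The weight `q^a t^c` attached to an exponent `a` and a content `c`. -/
def keyWeight (p : ℕ × ℤ) : K := q ^ p.1 * t ^ p.2

theorem keyWeight_ne_zero (p : ℕ × ℤ) : keyWeight p ≠ 0 :=
  mul_ne_zero (pow_ne_zero _ q_ne_zero) (zpow_ne_zero _ t_ne_zero)

theorem keyWeight_injective : Function.Injective keyWeight := by
  rintro ⟨a, c⟩ ⟨a', c'⟩ h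
  simp only [keyWeight] at h
  -- The factor t^(|c| + |c'|) makes both exponents of t non-negative, which reduces the claim to
  -- monomials of the polynomial ring.
  have e : ∀ d : ℤ, d = c ∨ d = c' →
      t ^ d * t ^ ((c.natAbs + c'.natAbs : ℕ) : ℤ) = t ^ (d + c.natAbs + c'.natAbs).toNat := by
    intro d hd
    rw [← zpow_natCast t (d + c.natAbs + c'.natAbs).toNat, ← zpow_add₀ t_ne_zero]
    congr 1
    rw [Int.toNat_of_nonneg (by omega)]
    push_cast
    ring
  have h2 : q ^ a * t ^ (c + c.natAbs + c'.natAbs).toNat =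
      q ^ a' * t ^ (c' + c.natAbs + c'.natAbs).toNat := by
    rw [← e c (Or.inl rfl), ← e c' (Or.inr rfl), ← mul_assoc, ← mul_assoc, h]
  obtain ⟨h3, h4⟩ := q_pow_mul_t_pow_injective h2
  ext
  · exact h3
  · simp only; omega

theorem keyWeight_sub_ne_zero {p r : ℕ × ℤ} (h : p ≠ r) : keyWeight p - keyWeight r ≠ 0 :=
  sub_ne_zero.2 fun he => h (keyWeight_injective he)

/-- The diagonal coefficient of `T_i` in the seminormal form. -/
def diagCoeff (p r : ℕ × ℤ) : K := (1 - t) * keyWeight p / (keyWeight p - keyWeight r)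

/-- Two boxes with these exponents and contents cannot exchange consecutive labels. -/
def Linked (p r : ℕ × ℤ) : Prop := p.1 = r.1 ∧ (p.2 - r.2 = 1 ∨ r.2 - p.2 = 1)

/-- Exchanging consecutive labels of boxes with these exponents and contents goes up. -/
def Ascends (p r : ℕ × ℤ) : Prop := p.1 < r.1 ∨ (p.1 = r.1 ∧ 1 < p.2 - r.2)

theorem Ascends.not_linked {p r : ℕ × ℤ} (h : Ascends p r) : ¬ Linked p r := by
  unfold Ascends at h; unfold Linked; omega

theorem Ascends.not_symm {p r : ℕ × ℤ} (h : Ascends p r) : ¬ Ascends r p := by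
  unfold Ascends at *; omega

theorem Linked.symm {p r : ℕ × ℤ} (h : Linked p r) : Linked r p := by
  unfold Linked at *; omega

theorem linked_or_ascends {p r : ℕ × ℤ} (h : p ≠ r) :
    Linked p r ∨ Ascends p r ∨ Ascends r p := by
  have : ¬ (p.1 = r.1 ∧ p.2 = r.2) := fun h' => h (Prod.ext h'.1 h'.2)
  unfold Linked Ascends; omega

open scoped Classical in
/-- The off-diagonal coefficient of `T_i` in the seminormal form. -/
def swapCoeff (p r : ℕ × ℤ) : K :=
  if Linked p r then 0
  else if Ascends p r then 1 else (1 - diagCoeff p r) * (diagCoeff p r + t)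

theorem swapCoeff_of_linked {p r : ℕ × ℤ} (h : Linked p r) : swapCoeff p r = 0 := if_pos h

theorem swapCoeff_of_ascends {p r : ℕ × ℤ} (h : Ascends p r) : swapCoeff p r = 1 := by
  rw [swapCoeff, if_neg h.not_linked, if_pos h]

theorem diagCoeff_mul_sub {p r : ℕ × ℤ} (h : p ≠ r) :
    diagCoeff p r * (keyWeight p - keyWeight r) = (1 - t) * keyWeight p :=
  div_mul_cancel₀ _ (keyWeight_sub_ne_zero h)

/-- Trace of a seminormal block: T_i has eigenvalues 1 and -t there. -/
theorem diagCoeff_add_symm {p r : ℕ × ℤ} (h : p ≠ r) : diagCoeff p r + diagCoeff r p = 1 - t := by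
  have h1 := keyWeight_sub_ne_zero h
  have h2 := keyWeight_sub_ne_zero h.symm
  unfold diagCoeff
  field_simp
  ring

/-- In the braid relation this compares the coefficients of the tableau with the first two of three
consecutive labels exchanged. -/
theorem diagCoeff_exchange {x y z : ℕ × ℤ} (hxy : x ≠ y) (hyz : y ≠ z) (hxz : x ≠ z) :
    diagCoeff x z * diagCoeff y x + diagCoeff x y * diagCoeff y z =
      diagCoeff y z * diagCoeff x z := by
  have h1 := keyWeight_sub_ne_zero hxy
  have h1' := keyWeight_sub_ne_zero hxy.symm
  have h2 := keyWeight_sub_ne_zero hyz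
  have h3 := keyWeight_sub_ne_zero hxz
  unfold diagCoeff
  field_simp
  ring

/-- In the braid relation this compares the coefficients of the original tableau, with products of
off-diagonal entries replaced by `swapCoeff_mul_symm`. -/
theorem diagCoeff_cubic {x y z : ℕ × ℤ} (hxy : x ≠ y) (hyz : y ≠ z) (hxz : x ≠ z) :
    diagCoeff x y * diagCoeff y z * diagCoeff x y +
        diagCoeff x z * ((1 - diagCoeff x y) * (diagCoeff x y + t)) =
      diagCoeff y z * diagCoeff x y * diagCoeff y z +
        diagCoeff x z * ((1 - diagCoeff y z) * (diagCoeff y z + t)) := by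
  have h1 := keyWeight_sub_ne_zero hxy
  have h2 := keyWeight_sub_ne_zero hyz
  have h3 := keyWeight_sub_ne_zero hxz
  unfold diagCoeff
  field_simp
  ring

/-- Neighbours in a row: the weights differ by a factor t and the block degenerates to the
eigenvalue 1. Column neighbours give -t in the same way. -/
theorem diagCoeff_of_succ {p r : ℕ × ℤ} (h : p.1 = r.1) (h' : r.2 - p.2 = 1) :
    diagCoeff p r = 1 := by
  have hne : p ≠ r := by rintro rfl; omega
  have h1 := keyWeight_sub_ne_zero hne
  have h2 : keyWeight r = t * keyWeight p := by
    have : r.2 = 1 + p.2 := by omega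
    rw [keyWeight, keyWeight, h, this, zpow_add₀ t_ne_zero, zpow_one]; ring
  rw [diagCoeff, div_eq_one_iff_eq h1, h2]; ring

theorem diagCoeff_of_pred {p r : ℕ × ℤ} (h : p.1 = r.1) (h' : p.2 - r.2 = 1) :
    diagCoeff p r = -t := by
  have hne : p ≠ r := by rintro rfl; omega
  have := diagCoeff_add_symm hne
  rw [diagCoeff_of_succ h.symm h'] at this
  linear_combination this

/-- Determinant of a seminormal block: together with the trace 1 - t, this gives it determinant -t.
If the swap does not exist, both sides vanish because the diagonal entry is already an eigenvalue.
-/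
theorem swapCoeff_mul_symm {p r : ℕ × ℤ} (h : p ≠ r) :
    swapCoeff p r * swapCoeff r p = (1 - diagCoeff p r) * (diagCoeff p r + t) := by
  have hs := diagCoeff_add_symm h
  rcases linked_or_ascends h with hl | ha | ha
  · rw [swapCoeff_of_linked hl, zero_mul]
    rcases hl with ⟨h1, h2 | h2⟩
    · rw [diagCoeff_of_pred h1 h2]; ring
    · rw [diagCoeff_of_succ h1 h2]; ring
  · rw [swapCoeff_of_ascends ha, swapCoeff, if_neg fun h => ha.not_linked h.symm,
      if_neg ha.not_symm, show diagCoeff r p = 1 - t - diagCoeff p r by linear_combination hs]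
    ring
  · rw [swapCoeff_of_ascends ha, swapCoeff, if_neg fun h => ha.not_linked h.symm,
      if_neg ha.not_symm]
    ring

end VVMac
end

noncomputable section
namespace VVMac

/-! ### Periodic tableaux -/

variable {n : ℕ} {μ : YoungDiagram}

instance : Fintype (Box μ) := Fintype.subtype μ.cells fun _ => Iff.rfl

theorem EntryLT.trans {a b c : Fin n × ℕ} (h : EntryLT a b) (h' : EntryLT b c) :
    EntryLT a c := by
  unfold EntryLT at *
  rcases h with h | ⟨h, h1⟩ <;> rcases h' with h' | ⟨h', h2⟩
  · left; omega
  · left; omega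
  · left; omega
  · right; exact ⟨h.trans h', h1.trans h2⟩

/-- The labelling by `L` and `w` increases along rows and columns. -/
def Increasing (L : Box μ ≃ Fin n) (w : Box μ → ℕ) : Prop :=
  ∀ x y : Box μ, (x.1.1 = y.1.1 ∧ x.1.2 < y.1.2) ∨ (x.1.2 = y.1.2 ∧ x.1.1 < y.1.1) →
    EntryLT (L x, w x) (L y, w y)

theorem PSYT.increasing (τ : PSYT n μ) : Increasing τ.label τ.wt := fun x y h =>
  h.elim (fun h => τ.row_lt x y h.1 h.2) (fun h => τ.col_lt x y h.1 h.2)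

/-- The periodic tableau with given labels and exponents. -/
def Increasing.toPSYT {L : Box μ ≃ Fin n} {w : Box μ → ℕ} (h : Increasing L w) : PSYT n μ where
  label := L
  wt := w
  row_lt := fun x y h1 h2 => h x y (Or.inl ⟨h1, h2⟩)
  col_lt := fun x y h1 h2 => h x y (Or.inr ⟨h1, h2⟩)

theorem PSYT.ext' {τ σ : PSYT n μ} (h : τ.label = σ.label) (h' : τ.wt = σ.wt) : τ = σ := by
  cases τ; cases σ; simp only at h h'; subst h h'; rfl

theorem SYT.ext' {S R : SYT n μ} (h : S.label = R.label) : S = R := by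
  cases S; cases R; simp only at h; subst h; rfl

theorem Increasing.entryLT {L : Box μ ≃ Fin n} {w : Box μ → ℕ} (h : Increasing L w)
    {x y : Box μ} (h1 : x.1.1 ≤ y.1.1) (h2 : x.1.2 ≤ y.1.2) (hne : x ≠ y) :
    EntryLT (L x, w x) (L y, w y) := by
  rcases h1.eq_or_lt with hrow | hrow
  · rcases h2.eq_or_lt with hcol | hcol
    · exact absurd (Subtype.ext (Prod.ext hrow hcol)) hne
    · exact h x y (Or.inl ⟨hrow, hcol⟩)
  · rcases h2.eq_or_lt with hcol | hcol
    · exact h x y (Or.inr ⟨hcol, hrow⟩)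
    · let z : Box μ := ⟨(x.1.1, y.1.2), μ.up_left_mem h1 le_rfl y.2⟩
      exact (h x z (Or.inl ⟨rfl, hcol⟩)).trans (h z y (Or.inr ⟨rfl, hrow⟩))

/-- Exponent and content of a box. -/
def boxKey (w : Box μ → ℕ) (x : Box μ) : ℕ × ℤ := (w x, content x)

/-- Exponent and content of the box that carries the label `j`. -/
def key (L : Box μ ≃ Fin n) (w : Box μ → ℕ) (j : Fin n) : ℕ × ℤ := boxKey w (L.symm j)

theorem PSYT.weight_eq (τ : PSYT n μ) (j : Fin n) :
    τ.weight j = keyWeight (key τ.label τ.wt j) := rfl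

/-- Equal contents put both boxes on one diagonal. The boxes to the right of x and below x lie
between x and y in the order; since the exponents of x and y agree, they carry two distinct labels
strictly between those of x and y. A gap of 3 is needed because the braid relation divides by the
weight difference of the labels i and i + 2. -/
theorem Increasing.key_ne_of_lt {L : Box μ ≃ Fin n} {w : Box μ → ℕ} (h : Increasing L w)
    {x y : Box μ} (hxy : x.1.1 < y.1.1) (hk : boxKey w x = boxKey w y) :
    (L x).1 + 3 ≤ (L y).1 := by
  obtain ⟨⟨r, c⟩, hx⟩ := x
  obtain ⟨⟨r', c'⟩, hy⟩ := y
  simp only [boxKey, content, Prod.mk.injEq] at hk hxy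
  obtain ⟨hw, hc⟩ := hk
  have hcc : c < c' := by omega
  let z₁ : Box μ := ⟨(r, c + 1), μ.up_left_mem hxy.le hcc hy⟩
  let z₂ : Box μ := ⟨(r + 1, c), μ.up_left_mem hxy hcc.le hy⟩
  have e1 := h.entryLT (x := ⟨(r, c), hx⟩) (y := z₁) le_rfl (Nat.le_succ c) (by
    intro h; have := congrArg (fun z : Box μ => z.1.2) h; simp [z₁] at this)
  have e2 := h.entryLT (x := ⟨(r, c), hx⟩) (y := z₂) (Nat.le_succ r) le_rfl (by
    intro h; have := congrArg (fun z : Box μ => z.1.1) h; simp [z₂] at this)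
  have e3 := h.entryLT (x := z₁) (y := ⟨(r', c'), hy⟩) hxy.le hcc (by
    intro h; have := congrArg (fun z : Box μ => z.1.1) h; simp [z₁] at this; omega)
  have e4 := h.entryLT (x := z₂) (y := ⟨(r', c'), hy⟩) hxy hcc.le (by
    intro h; have := congrArg (fun z : Box μ => z.1.2) h; simp [z₂] at this; omega)
  have e5 : L z₁ ≠ L z₂ := by
    intro h; have := congrArg (fun z : Box μ => z.1.1) (L.injective h); simp [z₁, z₂] at this
  rw [Ne, Fin.ext_iff] at e5
  simp only [EntryLT, Fin.lt_def] at e1 e2 e3 e4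
  omega

theorem Increasing.key_ne {L : Box μ ≃ Fin n} {w : Box μ → ℕ} (h : Increasing L w)
    {i j : Fin n} (hij : i.1 < j.1) (hij' : j.1 < i.1 + 3) : key L w i ≠ key L w j := by
  intro hk
  unfold key at hk
  have hne : L.symm i ≠ L.symm j := fun h => by
    have := L.symm.injective h; subst this; omega
  have hk2 := congrArg Prod.snd hk
  simp only [boxKey, content] at hk2
  rcases lt_trichotomy (L.symm i).1.1 (L.symm j).1.1 with h1 | h1 | h1
  · have := h.key_ne_of_lt h1 hk
    simp at this; omega
  · exact hne (Subtype.ext (Prod.ext h1 (by omega)))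
  · have := h.key_ne_of_lt h1 hk.symm
    simp at this; omega

theorem Increasing.key_lo_ne {L : Box μ ≃ Fin n} {w : Box μ → ℕ} (h : Increasing L w)
    (i : Fin (n - 1)) : key L w (lo i) ≠ key L w (hi i) :=
  h.key_ne (by simp [lo, hi]) (by simp [lo, hi])

theorem lo_ne_hi (i : Fin (n - 1)) : lo i ≠ hi i := by
  simp [lo, hi, Fin.ext_iff]

/-- The transposition of the labels `i`, `i + 1`. -/
abbrev adj (i : Fin (n - 1)) : Equiv.Perm (Fin n) := Equiv.swap (lo i) (hi i)

theorem key_trans_adj (L : Box μ ≃ Fin n) (w : Box μ → ℕ) (i : Fin (n - 1)) (j : Fin n) :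
    key (L.trans (adj i)) w j = key L w (adj i j) := by
  simp [key]

theorem adj_val (i : Fin (n - 1)) (a : Fin n) :
    (adj i a).1 = if a.1 = i.1 then i.1 + 1 else if a.1 = i.1 + 1 then i.1 else a.1 := by
  simp only [adj, Equiv.swap_apply_def, lo, hi, Fin.ext_iff]
  split_ifs <;> rfl

theorem adj_lt {i : Fin (n - 1)} {a b : Fin n} (h : a < b) (h' : ¬ (a = lo i ∧ b = hi i)) :
    adj i a < adj i b := by
  rw [Fin.lt_def, adj_val, adj_val]
  simp only [lo, hi, Fin.ext_iff, Fin.lt_def] at *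
  split_ifs <;> omega

/-- Consecutive labels with equal exponents leave no room in the order for a box between them. -/
theorem Increasing.linked_of_row {L : Box μ ≃ Fin n} {w : Box μ → ℕ} (h : Increasing L w)
    {x y : Box μ} (hr : x.1.1 = y.1.1) (hl : (L y).1 = (L x).1 + 1) (hw : w x = w y) :
    y.1.2 = x.1.2 + 1 := by
  obtain ⟨⟨r, c⟩, hx⟩ := x
  obtain ⟨⟨r', c'⟩, hy⟩ := y
  simp only at hr hl hw ⊢
  subst hr
  have hlt : c < c' := by
    by_contra hcon
    rcases (not_lt.1 hcon).eq_or_lt with h1 | h1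
    · subst h1; omega
    · have := h ⟨(r, c'), hy⟩ ⟨(r, c), hx⟩ (Or.inl ⟨rfl, h1⟩)
      simp only [EntryLT, Fin.lt_def] at this; omega
  by_contra hcon
  let z : Box μ := ⟨(r, c + 1), μ.up_left_mem le_rfl hlt hy⟩
  have e1 := h ⟨(r, c), hx⟩ z (Or.inl ⟨rfl, Nat.lt_succ_self c⟩)
  have e2 := h z ⟨(r, c'), hy⟩ (Or.inl ⟨rfl, by simp [z]; omega⟩)
  simp only [EntryLT, Fin.lt_def] at e1 e2
  omega

theorem Increasing.linked_of_col {L : Box μ ≃ Fin n} {w : Box μ → ℕ} (h : Increasing L w)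
    {x y : Box μ} (hr : x.1.2 = y.1.2) (hl : (L y).1 = (L x).1 + 1) (hw : w x = w y) :
    y.1.1 = x.1.1 + 1 := by
  obtain ⟨⟨c, r⟩, hx⟩ := x
  obtain ⟨⟨c', r'⟩, hy⟩ := y
  simp only at hr hl hw ⊢
  subst hr
  have hlt : c < c' := by
    by_contra hcon
    rcases (not_lt.1 hcon).eq_or_lt with h1 | h1
    · subst h1; omega
    · have := h ⟨(c', r), hy⟩ ⟨(c, r), hx⟩ (Or.inr ⟨rfl, h1⟩)
      simp only [EntryLT, Fin.lt_def] at this; omega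
  by_contra hcon
  let z : Box μ := ⟨(c + 1, r), μ.up_left_mem hlt le_rfl hy⟩
  have e1 := h ⟨(c, r), hx⟩ z (Or.inr ⟨rfl, Nat.lt_succ_self c⟩)
  have e2 := h z ⟨(c', r), hy⟩ (Or.inr ⟨rfl, by simp [z]; omega⟩)
  simp only [EntryLT, Fin.lt_def] at e1 e2
  omega

/-- Exchanging consecutive labels can reverse only the comparison of the two boxes concerned. That
comparison matters only if they have equal exponents and share a row or column, and then they are
adjacent. -/
theorem Increasing.trans_adj {L : Box μ ≃ Fin n} {w : Box μ → ℕ} (h : Increasing L w)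
    {i : Fin (n - 1)} (hl : ¬ Linked (key L w (lo i)) (key L w (hi i))) :
    Increasing (L.trans (adj i)) w := by
  intro x y hxy
  rcases h x y hxy with h1 | ⟨h1, h2⟩
  · exact Or.inl h1
  · refine Or.inr ⟨h1, adj_lt h2 ?_⟩
    rintro ⟨h3, h4⟩
    simp only at h1
    have h5 : (L y).1 = (L x).1 + 1 := by rw [h3, h4]; rfl
    apply hl
    rw [key, key, ← h3, ← h4, L.symm_apply_apply, L.symm_apply_apply]
    refine ⟨h1, ?_⟩
    simp only [boxKey, content]
    rcases hxy with hxy | hxy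
    · have := h.linked_of_row hxy.1 h5 h1
      omega
    · have := h.linked_of_col hxy.1 h5 h1
      omega

/-- On neighbouring diagonals, boxes sharing neither row nor column are comparable: either a third
box lies between them, or the larger label precedes the smaller. Both contradict consecutive labels
with equal exponents. This matches degenerate blocks with the row and column relations of the Specht
module. -/
theorem Increasing.of_linked {L : Box μ ≃ Fin n} {w : Box μ → ℕ} (h : Increasing L w)
    {i : Fin (n - 1)} (hl : Linked (key L w (lo i)) (key L w (hi i))) :
    (L.symm (lo i)).1.1 = (L.symm (hi i)).1.1 ∨ (L.symm (lo i)).1.2 = (L.symm (hi i)).1.2 := by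
  set x := L.symm (lo i) with hx
  set y := L.symm (hi i) with hy
  have hLx : L x = lo i := by simp [hx]
  have hLy : L y = hi i := by simp [hy]
  obtain ⟨hw, hc⟩ := hl
  simp only [key, boxKey, ← hx, ← hy, content] at hw hc
  by_contra hcon
  push Not at hcon
  have hlab : (L x).1 < (L y).1 := by rw [hLx, hLy]; simp [lo, hi]
  have hlab' : (L y).1 = (L x).1 + 1 := by rw [hLx, hLy]; simp [lo, hi]
  rcases lt_or_gt_of_ne hcon.1 with h1 | h1
  · have h2 : x.1.2 < y.1.2 := by omega
    let z : Box μ := ⟨(x.1.1, y.1.2), μ.up_left_mem h1.le le_rfl y.2⟩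
    have e1 := h x z (Or.inl ⟨rfl, h2⟩)
    have e2 := h z y (Or.inr ⟨rfl, h1⟩)
    simp only [EntryLT, Fin.lt_def] at e1 e2
    omega
  · have := h.entryLT (x := y) (y := x) h1.le (by omega) (by
      intro h; rw [h] at hcon; exact hcon.1 rfl)
    simp only [EntryLT, Fin.lt_def] at this
    omega

theorem swapUp_of_ascends (τ : PSYT n μ) {i : Fin (n - 1)}
    (h : Ascends (key τ.label τ.wt (lo i)) (key τ.label τ.wt (hi i))) :
    SwapUp i τ (τ.increasing.trans_adj h.not_linked).toPSYT :=
  ⟨⟨fun _ => rfl, fun _ => rfl⟩, h⟩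

theorem SwapUp.ascends {τ σ : PSYT n μ} {i : Fin (n - 1)} (h : SwapUp i τ σ) :
    Ascends (key τ.label τ.wt (lo i)) (key τ.label τ.wt (hi i)) := h.2

theorem SwapUp.eq {τ σ : PSYT n μ} {i : Fin (n - 1)} (h : SwapUp i τ σ) :
    σ = (τ.increasing.trans_adj h.ascends.not_linked).toPSYT :=
  PSYT.ext' (Equiv.ext h.1.1) (funext h.1.2)

/-- The position `j - n b` of the formal product `j q^b`; positions order formal products, and
`Ψ` lowers every position by one. -/
def position (a : Fin n × ℕ) : ℤ := a.1.1 - n * a.2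

/-- Labels lie in an interval of length n, so a difference of exponents outweighs every difference
of labels. -/
theorem entryLT_iff {a b : Fin n × ℕ} : EntryLT a b ↔ position a < position b := by
  obtain ⟨⟨j, hj⟩, m⟩ := a
  obtain ⟨⟨k, hk⟩, l⟩ := b
  simp only [EntryLT, position, Fin.lt_def]
  have hn : (0 : ℤ) ≤ n := by omega
  rcases lt_trichotomy m l with h | h | h
  · refine iff_of_false (by omega) ?_
    have : (n : ℤ) * (m + 1) ≤ n * l := mul_le_mul_of_nonneg_left (by omega) hn
    rw [mul_add, mul_one] at this
    omega
  · subst h; omega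
  · refine iff_of_true (Or.inl h) ?_
    have : (n : ℤ) * (l + 1) ≤ n * m := mul_le_mul_of_nonneg_left (by omega) hn
    rw [mul_add, mul_one] at this
    omega

open scoped Classical in
/-- The exponents of `Ψ(τ)`. -/
def psiWt (L : Box μ ≃ Fin n) (w : Box μ → ℕ) (x : Box μ) : ℕ :=
  if (L x).1 = 0 then w x + 1 else w x

/-- The labels of `Ψ(τ)`. -/
def psiLabel (L : Box μ ≃ Fin n) : Box μ ≃ Fin n := L.trans (finRotate n).symm

theorem finRotate_symm_val (j : Fin n) :
    ((finRotate n).symm j).1 = if j.1 = 0 then n - 1 else j.1 - 1 := by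
  obtain ⟨m, rfl⟩ : ∃ m, n = m + 1 := ⟨n - 1, by have := j.2; omega⟩
  obtain ⟨k, rfl⟩ := (finRotate (m + 1)).surjective j
  rw [Equiv.symm_apply_apply]
  rcases eq_or_ne k (Fin.last m) with h | h
  · subst h; simp
  · rw [coe_finRotate_of_ne_last h]; simp

theorem psiLabel_val (L : Box μ ≃ Fin n) (x : Box μ) :
    (psiLabel L x).1 = if (L x).1 = 0 then n - 1 else (L x).1 - 1 := finRotate_symm_val _

theorem position_psi (L : Box μ ≃ Fin n) (w : Box μ → ℕ) (x : Box μ) :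
    position (psiLabel L x, psiWt L w x) = position (L x, w x) - 1 := by
  simp only [position, psiLabel_val, psiWt]
  have := (L x).2
  split_ifs with h
  · push_cast [h]; rw [Nat.cast_sub (by omega)]; push_cast; ring
  · rw [Nat.cast_sub (by omega)]; push_cast; ring

theorem increasing_psi_iff {L : Box μ ≃ Fin n} {w : Box μ → ℕ} :
    Increasing (psiLabel L) (psiWt L w) ↔ Increasing L w := by
  simp only [Increasing, entryLT_iff, position_psi, sub_lt_sub_iff_right]

/-- The tableau `Ψ(τ)`. -/
def PSYT.psi (τ : PSYT n μ) : PSYT n μ := (increasing_psi_iff.2 τ.increasing).toPSYT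

theorem PSYT.isPsi_psi (τ : PSYT n μ) : IsPsi τ τ.psi := by
  intro x
  have h1 : (τ.psi.label x).1 = _ := psiLabel_val τ.label x
  have h2 : τ.psi.wt x = if (τ.label x).1 = 0 then τ.wt x + 1 else τ.wt x := rfl
  rw [h1, h2]
  have := (τ.label x).2
  constructor <;> intro h
  · rw [if_neg h, if_neg h]; exact ⟨by omega, rfl⟩
  · rw [if_pos h, if_pos h]; exact ⟨by omega, rfl⟩

theorem IsPsi.unique {τ σ σ' : PSYT n μ} (h : IsPsi τ σ) (h' : IsPsi τ σ') : σ = σ' := by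
  apply PSYT.ext'
  · ext x
    by_cases h0 : (τ.label x).1 = 0
    · have := ((h x).2 h0).1; have := ((h' x).2 h0).1; omega
    · have := ((h x).1 h0).1; have := ((h' x).1 h0).1; omega
  · ext x
    by_cases h0 : (τ.label x).1 = 0
    · rw [((h x).2 h0).2, ((h' x).2 h0).2]
    · rw [((h x).1 h0).2, ((h' x).1 h0).2]

theorem IsPsi.eq {τ σ : PSYT n μ} (h : IsPsi τ σ) : σ = τ.psi := h.unique τ.isPsi_psi

/-- The total exponent of a tableau. -/
def PSYT.deg (τ : PSYT n μ) : ℕ := ∑ x, τ.wt x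

/-- A tableau without exponents is standard. -/
def PSYT.toSYT (τ : PSYT n μ) (h : ∀ x, τ.wt x = 0) : SYT n μ where
  label := τ.label
  row_lt := fun x y h1 h2 => by simpa [EntryLT, h] using τ.row_lt x y h1 h2
  col_lt := fun x y h1 h2 => by simpa [EntryLT, h] using τ.col_lt x y h1 h2

theorem PSYT.toSYT_toPSYT (τ : PSYT n μ) (h : ∀ x, τ.wt x = 0) : (τ.toSYT h).toPSYT = τ :=
  PSYT.ext' rfl (funext fun x => (h x).symm)

/-- The inverse of Ψ shifts labels cyclically and lowers the exponent at the last label; positivity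
of that exponent is the only obstruction. -/
theorem PSYT.exists_psi_eq (τ : PSYT n μ) (x : Box μ) (hx : (τ.label x).1 + 1 = n)
    (hw : τ.wt x ≠ 0) : ∃ σ : PSYT n μ, IsPsi σ τ := by
  classical
  let L : Box μ ≃ Fin n := τ.label.trans (finRotate n)
  let w : Box μ → ℕ := fun y => if y = x then τ.wt y - 1 else τ.wt y
  have hL : psiLabel L = τ.label := by
    ext y; simp only [psiLabel, L, Equiv.trans_apply, Equiv.symm_apply_apply]
  have h0 : ∀ y, (L y).1 = 0 ↔ y = x := by
    intro y
    have h1 := psiLabel_val L y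
    rw [hL] at h1
    have h2 := (L y).2
    have h3 := (τ.label y).2
    constructor
    · intro h4
      rw [if_pos h4] at h1
      exact τ.label.injective (Fin.ext (by omega))
    · rintro rfl
      by_contra h4
      rw [if_neg h4] at h1
      omega
  have hw' : psiWt L w = τ.wt := by
    ext y
    simp only [psiWt, h0, w]
    split_ifs with h
    · subst h; omega
    · rfl
  have hinc : Increasing L w := by
    rw [← increasing_psi_iff, hL, hw']; exact τ.increasing
  refine ⟨hinc.toPSYT, ?_⟩
  have : τ = hinc.toPSYT.psi := PSYT.ext' hL.symm hw'.symm
  rw [this]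
  exact PSYT.isPsi_psi _

theorem IsPsi.deg {τ σ : PSYT n μ} (h : IsPsi τ σ) (hn : 0 < n) : σ.deg = τ.deg + 1 := by
  classical
  have hx : ∀ x, σ.wt x = τ.wt x + if x = τ.label.symm ⟨0, hn⟩ then 1 else 0 := by
    intro x
    have e : x = τ.label.symm ⟨0, hn⟩ ↔ (τ.label x).1 = 0 := by
      rw [Equiv.eq_symm_apply, Fin.ext_iff]
    simp only [e]
    split_ifs with h0
    · rw [((h x).2 h0).2]
    · rw [((h x).1 h0).2]; rfl
  simp only [PSYT.deg, hx, Finset.sum_add_distrib, Finset.sum_ite_eq', Finset.mem_univ, if_true]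

theorem IsSwap.deg {τ σ : PSYT n μ} {i : Fin (n - 1)} (h : IsSwap i τ σ) : σ.deg = τ.deg := by
  simp only [PSYT.deg, h.2]

/-- Every periodic tableau is reached from a standard one by the covers. -/
theorem PSYT.induction_cover {P : PSYT n μ → Prop} (std : ∀ S : SYT n μ, P S.toPSYT)
    (swap : ∀ i τ σ, SwapUp i τ σ → P τ → P σ)
    (psi : ∀ τ σ, 0 < n → IsPsi τ σ → P τ → P σ) (τ : PSYT n μ) : P τ := by
  classical
  obtain ⟨d, hd⟩ : ∃ d, τ.deg = d := ⟨_, rfl⟩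
  induction d using Nat.strong_induction_on generalizing τ with
  | _ d ihd =>
  -- Within a fixed degree this measure drops when an upward swap is undone, since the larger
  -- exponent then receives the larger label.
  obtain ⟨m, hm⟩ : ∃ m, ∑ x, (n - (τ.label x).1) * τ.wt x = m := ⟨_, rfl⟩
  induction m using Nat.strong_induction_on generalizing τ with
  | _ m ihm =>
  by_cases h0 : ∀ x, τ.wt x = 0
  · rw [← τ.toSYT_toPSYT h0]; exact std _
  push Not at h0
  obtain ⟨x₀, hx₀⟩ := h0
  have hn : 0 < n := lt_of_le_of_lt (Nat.zero_le _) (τ.label x₀).2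
  -- If the last label has exponent 0, some swap can be undone: otherwise the exponents would
  -- increase weakly with the labels and all vanish. If it has positive exponent, Ψ can be undone.
  by_cases hlast : τ.wt (τ.label.symm ⟨n - 1, by omega⟩) = 0
  · have : ∃ i : Fin (n - 1), τ.w (hi i) < τ.w (lo i) := by
      by_contra hcon
      push Not at hcon
      have hz : ∀ k (hk : k < n), τ.w ⟨n - 1 - k, by omega⟩ = 0 := by
        intro k
        induction k with
        | zero => intro _; exact hlast
        | succ k ih =>
          intro hk
          have h1 := hcon ⟨n - 1 - (k + 1), by omega⟩
          have h2 := ih (by omega)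
          have h3 : hi ⟨n - 1 - (k + 1), by omega⟩ = (⟨n - 1 - k, by omega⟩ : Fin n) := by
            simp only [hi, Fin.ext_iff]; omega
          rw [h3, h2] at h1
          exact Nat.le_zero.1 h1
      have h1 := hz (n - 1 - (τ.label x₀).1) (by omega)
      have h2 : (⟨n - 1 - (n - 1 - (τ.label x₀).1), by omega⟩ : Fin n) = τ.label x₀ :=
        Fin.ext (by have := (τ.label x₀).2; simp only; omega)
      rw [h2, PSYT.w, Equiv.symm_apply_apply] at h1
      exact hx₀ h1
    obtain ⟨i, hi'⟩ := this
    have hl : ¬ Linked (key τ.label τ.wt (lo i)) (key τ.label τ.wt (hi i)) := by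
      intro h; exact hi'.ne' h.1
    let σ := (τ.increasing.trans_adj hl).toPSYT
    have hσ : SwapUp i σ τ := by
      refine ⟨⟨fun x => ?_, fun x => rfl⟩, Or.inl ?_⟩
      · simp [σ, Increasing.toPSYT]
      · simpa [PSYT.w, σ, Increasing.toPSYT] using hi'
    refine swap i σ τ hσ (ihm _ ?_ σ (hσ.1.deg.symm.trans hd) rfl)
    rw [← hm]
    set A := τ.label.symm (lo i)
    set B := τ.label.symm (hi i)
    have hAB : A ≠ B := fun h => lo_ne_hi i (τ.label.symm.injective h)
    have hrest : ∀ x, x ≠ A → x ≠ B → σ.label x = τ.label x := by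
      intro x h1 h2
      exact Equiv.swap_apply_of_ne_of_ne (fun h => h1 (by simp [A, ← h]))
        (fun h => h2 (by simp [B, ← h]))
    have hA : σ.label A = hi i := by simp [σ, A, Increasing.toPSYT]
    have hB : σ.label B = lo i := by simp [σ, B, Increasing.toPSYT]
    -- Only the two terms of the exchanged boxes change, so they are split off from both sums.
    rw [← Finset.sum_erase_add _ _ (Finset.mem_univ A),
      ← Finset.sum_erase_add _ _ (Finset.mem_erase.2 ⟨hAB.symm, Finset.mem_univ B⟩),
      ← Finset.sum_erase_add (a := A) _ _ (Finset.mem_univ A),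
      ← Finset.sum_erase_add (a := B) _ _ (Finset.mem_erase.2 ⟨hAB.symm, Finset.mem_univ B⟩)]
    have hs : ∑ x ∈ (Finset.univ.erase A).erase B, (n - (σ.label x).1) * σ.wt x =
        ∑ x ∈ (Finset.univ.erase A).erase B, (n - (τ.label x).1) * τ.wt x := by
      refine Finset.sum_congr rfl fun x hx => ?_
      simp only [Finset.mem_erase] at hx
      rw [hrest x hx.2.1 hx.1]; rfl
    rw [hs, hA, hB]
    have hA' : τ.label A = lo i := by simp [A]
    have hB' : τ.label B = hi i := by simp [B]
    rw [hA', hB']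
    have hlt : τ.wt B < τ.wt A := hi'
    have e1 : σ.wt A = τ.wt A := rfl
    have e2 : σ.wt B = τ.wt B := rfl
    have e3 : n - (lo i).1 = (n - (hi i).1) + 1 := by have := i.2; simp [lo, hi]; omega
    rw [e1, e2, e3]
    nlinarith
  · obtain ⟨σ, hσ⟩ := τ.exists_psi_eq _ (by simp; omega) hlast
    exact psi σ τ hn hσ (ihd σ.deg (by have := hσ.deg hn; omega) σ rfl)

end VVMac
end

noncomputable section
namespace VVMac

variable {n : ℕ} {μ : YoungDiagram}

/-! ### Identities in modules over a commutative ring -/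

section Generic

variable {R M : Type*} [CommRing R] [AddCommGroup M] [Module R M]

/-- The formula at the neighbouring vector e₁ is assumed only after multiplication by b: if the
swapped tableau does not exist, then b = 0 and the hypothesis is empty. The same device serves the
commutation and braid relations. -/
theorem quad_aux {f : Module.End R M} {e e₁ : M} {t a a' b b' : R}
    (h : f e = a • e + b • e₁) (h₁ : b • f e₁ = b • (a' • e₁ + b' • e))
    (hs : a + a' = 1 - t) (hm : b * b' = (1 - a) * (a + t)) :
    f (f e + t • e) - (f e + t • e) = 0 := by
  have : f (f e + t • e) = (a + t) • f e + b • f e₁ := by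
    conv_lhs => rw [h]
    simp only [map_add, map_smul]
    module
  rw [this, h₁, h]
  linear_combination (norm := module) hs • b • e₁ + hm • e

theorem comm_aux {f g : Module.End R M} {e e₁ e₂ e₁₂ : M} {a b c d : R}
    (hf : f e = a • e + b • e₁) (hg : g e = c • e + d • e₂)
    (hf₂ : d • f e₂ = d • (a • e₂ + b • e₁₂)) (hg₁ : b • g e₁ = b • (c • e₁ + d • e₁₂)) :
    f (g e) = g (f e) := by
  rw [hf, hg, map_add, map_add, map_smul, map_smul, map_smul, map_smul, hf₂, hg₁, hf, hg]
  module

theorem theta_aux {e e₁ : M} {t a b x y : R} (h : a * (x - y) = (1 - t) * x) :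
    y • (a • e + b • e₁) = (a • x • e + b • y • e₁) + (t - 1) • x • e := by
  linear_combination (norm := module) (-h) • e

/-- Both sides are expanded over the six labellings obtained by permuting three consecutive labels.
The coefficients of e₁₂, e₂₁ and e₁₂₁ agree outright; those of e, e₁ and e₂ agree by h₀, h₁ and h₂.
-/
theorem braid_aux {f g : Module.End R M}
    {e e₁ e₂ e₁₂ e₂₁ e₁₂₁ : M} {axy ayz axz ayx azy bxy byz bxz byx bzy : R}
    (hf : f e = axy • e + bxy • e₁) (hg : g e = ayz • e + byz • e₂)
    (hg₁ : bxy • g e₁ = bxy • (axz • e₁ + bxz • e₂₁))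
    (hf₁ : bxy • f e₁ = bxy • (ayx • e₁ + byx • e))
    (hf₂ : byz • f e₂ = byz • (axz • e₂ + bxz • e₁₂))
    (hg₂ : byz • g e₂ = byz • (azy • e₂ + bzy • e))
    (hf₂₁ : (bxy * bxz) • f e₂₁ = (bxy * bxz) • (ayz • e₂₁ + byz • e₁₂₁))
    (hg₁₂ : (byz * bxz) • g e₁₂ = (byz * bxz) • (axy • e₁₂ + bxy • e₁₂₁))
    (h₀ : axy * ayz * axy + axz * (bxy * byx) = ayz * axy * ayz + axz * (byz * bzy))
    (h₁ : axz * ayx + axy * ayz = ayz * axz) (h₂ : axz * azy + axy * ayz = axy * axz) :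
    f (g (f e)) = g (f (g e)) := by
  have hl : f (g (f e)) = (axy * ayz) • f e + axy • (byz • f e₂) + axz • (bxy • f e₁) +
      (bxy * bxz) • f e₂₁ := by
    conv_lhs => rw [hf, map_add, map_smul, map_smul, hg₁, hg]
    simp only [map_add, map_smul]
    module
  have hr : g (f (g e)) = (axy * ayz) • g e + ayz • (bxy • g e₁) + axz • (byz • g e₂) +
      (byz * bxz) • g e₁₂ := by
    conv_lhs => rw [hg, map_add, map_smul, map_smul, hf₂, hf]
    simp only [map_add, map_smul]
    module
  rw [hl, hr, hf, hg, hf₁, hf₂, hg₁, hg₂, hf₂₁, hg₁₂]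
  linear_combination (norm := module) h₀ • e + h₁ • bxy • e₁ - h₂ • byz • e₂

end Generic

/-! ### The seminormal module -/

/-- The vector space with basis the periodic tableaux. -/
def Semi (n : ℕ) (μ : YoungDiagram) : Type := PSYT n μ →₀ K

instance : AddCommGroup (Semi n μ) := inferInstanceAs (AddCommGroup (PSYT n μ →₀ K))

instance : Module K (Semi n μ) := inferInstanceAs (Module K (PSYT n μ →₀ K))

/-- The basis of the seminormal module. -/
def semiBasis (n : ℕ) (μ : YoungDiagram) : Module.Basis (PSYT n μ) K (Semi n μ) :=
  Module.Basis.ofRepr (LinearEquiv.refl K (PSYT n μ →₀ K))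

/-- The basis vector of a labelling, zero if the labelling is not increasing. -/
def vec (L : Box μ ≃ Fin n) (w : Box μ → ℕ) : Semi n μ :=
  open scoped Classical in
  if h : Increasing L w then semiBasis n μ h.toPSYT else 0

theorem vec_label (τ : PSYT n μ) : vec τ.label τ.wt = semiBasis n μ τ := dif_pos τ.increasing

theorem vec_of_increasing {L : Box μ ≃ Fin n} {w : Box μ → ℕ} (h : Increasing L w) :
    vec L w = semiBasis n μ h.toPSYT := dif_pos h

/-- The operator `T_i`. -/
def opT (i : Fin (n - 1)) : Module.End K (Semi n μ) :=
  (semiBasis n μ).constr K fun τ =>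
    diagCoeff (key τ.label τ.wt (lo i)) (key τ.label τ.wt (hi i)) • vec τ.label τ.wt +
    swapCoeff (key τ.label τ.wt (lo i)) (key τ.label τ.wt (hi i)) •
      vec (τ.label.trans (adj i)) τ.wt

theorem opT_vec {L : Box μ ≃ Fin n} {w : Box μ → ℕ} (h : Increasing L w) (i : Fin (n - 1)) :
    opT i (vec L w) = diagCoeff (key L w (lo i)) (key L w (hi i)) • vec L w +
      swapCoeff (key L w (lo i)) (key L w (hi i)) • vec (L.trans (adj i)) w := by
  conv_lhs => rw [vec_of_increasing h, opT, Module.Basis.constr_basis]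
  rfl

theorem swapCoeff_eq_zero_or {L : Box μ ≃ Fin n} {w : Box μ → ℕ} (h : Increasing L w)
    (i : Fin (n - 1)) : swapCoeff (key L w (lo i)) (key L w (hi i)) = 0 ∨
      Increasing (L.trans (adj i)) w := by
  by_cases hl : Linked (key L w (lo i)) (key L w (hi i))
  · exact Or.inl (swapCoeff_of_linked hl)
  · exact Or.inr (h.trans_adj hl)

/-- The operator `T_j` on the swap of a tableau, up to a factor that vanishes if the swap does not
exist. -/
theorem smul_opT_vec {L : Box μ ≃ Fin n} {w : Box μ → ℕ} (h : Increasing L w)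
    (i j : Fin (n - 1)) :
    swapCoeff (key L w (lo i)) (key L w (hi i)) • opT j (vec (L.trans (adj i)) w) =
      swapCoeff (key L w (lo i)) (key L w (hi i)) •
        (diagCoeff (key L w (adj i (lo j))) (key L w (adj i (hi j))) • vec (L.trans (adj i)) w +
          swapCoeff (key L w (adj i (lo j))) (key L w (adj i (hi j))) •
            vec ((L.trans (adj i)).trans (adj j)) w) := by
  rcases swapCoeff_eq_zero_or h i with h0 | h0
  · rw [h0, zero_smul, zero_smul]
  · rw [opT_vec h0]; simp only [key_trans_adj]

theorem smul_smul_opT_vec {L : Box μ ≃ Fin n} {w : Box μ → ℕ} (h : Increasing L w)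
    (i j k : Fin (n - 1)) :
    (swapCoeff (key L w (lo i)) (key L w (hi i)) *
        swapCoeff (key L w (adj i (lo j))) (key L w (adj i (hi j)))) •
          opT k (vec ((L.trans (adj i)).trans (adj j)) w) =
      (swapCoeff (key L w (lo i)) (key L w (hi i)) *
        swapCoeff (key L w (adj i (lo j))) (key L w (adj i (hi j)))) •
        (diagCoeff (key L w (adj i (adj j (lo k)))) (key L w (adj i (adj j (hi k)))) •
            vec ((L.trans (adj i)).trans (adj j)) w +
          swapCoeff (key L w (adj i (adj j (lo k)))) (key L w (adj i (adj j (hi k)))) •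
            vec (((L.trans (adj i)).trans (adj j)).trans (adj k)) w) := by
  rcases swapCoeff_eq_zero_or h i with h0 | h0
  · rw [h0, zero_mul, zero_smul, zero_smul]
  · have := smul_opT_vec h0 j k
    simp only [key_trans_adj] at this
    rw [mul_smul, this, ← mul_smul]

theorem end_ext {f g : Module.End K (Semi n μ)}
    (h : ∀ (L : Box μ ≃ Fin n) (w : Box μ → ℕ), Increasing L w → f (vec L w) = g (vec L w)) :
    f = g :=
  (semiBasis n μ).ext fun τ => by
    rw [← vec_label]; exact h _ _ τ.increasing

theorem opT_quad (i : Fin (n - 1)) :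
    (opT i - 1) * (opT i + algebraMap K (Module.End K (Semi n μ)) t) = 0 := by
  refine end_ext fun L w h => ?_
  have h1 := opT_vec h i
  have h2 := smul_opT_vec h i i
  have hs := diagCoeff_add_symm (h.key_lo_ne i)
  have hm := swapCoeff_mul_symm (h.key_lo_ne i)
  have e : (L.trans (adj i)).trans (adj i) = L := by ext; simp
  simp only [adj, Equiv.swap_apply_left, Equiv.swap_apply_right] at h2
  rw [e] at h2
  exact quad_aux h1 h2 hs hm

theorem opT_braid (i j : Fin (n - 1)) (hij : i.1 + 1 = j.1) :
    (opT i : Module.End K (Semi n μ)) * opT j * opT i = opT j * opT i * opT j := by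
  refine end_ext fun L w h => ?_
  simp only [Module.End.mul_apply]
  have hlj : lo j = hi i := Fin.ext hij.symm
  have hx : adj i (lo i) = hi i := Equiv.swap_apply_left _ _
  have hy : adj i (hi i) = lo i := Equiv.swap_apply_right _ _
  have hz : adj i (hi j) = hi j := Equiv.swap_apply_of_ne_of_ne
    (by simp [lo, hi, Fin.ext_iff]; omega) (by simp [hi, Fin.ext_iff]; omega)
  have jx : adj j (lo i) = lo i := Equiv.swap_apply_of_ne_of_ne
    (by simp [lo, Fin.ext_iff]; omega) (by simp [lo, hi, Fin.ext_iff]; omega)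
  have jy : adj j (hi i) = hi j := by rw [← hlj]; exact Equiv.swap_apply_left _ _
  have jz : adj j (hi j) = hi i := by rw [← hlj]; exact Equiv.swap_apply_right _ _
  have hxy : key L w (lo i) ≠ key L w (hi i) := h.key_lo_ne i
  have hyz : key L w (hi i) ≠ key L w (hi j) := hlj ▸ h.key_lo_ne j
  have hxz : key L w (lo i) ≠ key L w (hi j) :=
    h.key_ne (by simp [lo, hi]; omega) (by simp [lo, hi]; omega)
  -- The two reduced words of the longest permutation of three labels lead to the same labelling.
  have hb : ((L.trans (adj j)).trans (adj i)).trans (adj j) =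
      ((L.trans (adj i)).trans (adj j)).trans (adj i) := by
    apply Equiv.ext
    intro x
    simp only [Equiv.trans_apply]
    generalize L x = y
    by_cases h1 : y = lo i
    · subst h1; rw [jx, hx, jy, hz]
    by_cases h2 : y = hi i
    · subst h2; rw [jy, hz, jz, hy, jx, hx]
    by_cases h3 : y = hi j
    · subst h3; rw [jz, hy, jx, hz, jz, hy]
    have hi' : adj i y = y := Equiv.swap_apply_of_ne_of_ne h1 h2
    have hj' : adj j y = y := Equiv.swap_apply_of_ne_of_ne (by rw [hlj]; exact h2) h3
    rw [hj', hi', hj', hi']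
  have f1 := opT_vec h i
  have g1 := opT_vec h j
  have g2 := smul_opT_vec h i j
  have f2 := smul_opT_vec h i i
  have f3 := smul_opT_vec h j i
  have g3 := smul_opT_vec h j j
  have f4 := smul_smul_opT_vec h i j i
  have g4 := smul_smul_opT_vec h j i j
  have ei : (L.trans (adj i)).trans (adj i) = L := by ext; simp
  have ej : (L.trans (adj j)).trans (adj j) = L := by ext; simp
  rw [ei] at f2
  rw [ej] at g3
  rw [hb] at g4
  simp only [hlj, hx, hy, hz, jx, jy, jz] at g1 g2 f2 f3 g3 f4 g4
  refine braid_aux f1 g1 g2 f2 f3 g3 f4 g4 ?_ (diagCoeff_exchange hxy hyz hxz) ?_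
  · rw [swapCoeff_mul_symm hxy, swapCoeff_mul_symm hyz]
    exact diagCoeff_cubic hxy hyz hxz
  -- The mirror image of the exchange identity; the two differ by the trace relations of the blocks
  -- (x, y) and (y, z).
  · have e1 := diagCoeff_exchange hxy hyz hxz
    have e2 := diagCoeff_add_symm hxy
    have e3 := diagCoeff_add_symm hyz
    linear_combination e1 + diagCoeff (key L w (lo i)) (key L w (hi j)) * (e3 - e2)

theorem opT_comm (i j : Fin (n - 1)) (hij : i.1 + 1 < j.1) :
    (opT i : Module.End K (Semi n μ)) * opT j = opT j * opT i := by
  refine end_ext fun L w h => ?_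
  simp only [Module.End.mul_apply]
  have e1 : adj i (lo j) = lo j := Equiv.swap_apply_of_ne_of_ne
    (by simp [lo, Fin.ext_iff]; omega) (by simp [lo, hi, Fin.ext_iff]; omega)
  have e2 : adj i (hi j) = hi j := Equiv.swap_apply_of_ne_of_ne
    (by simp [lo, hi, Fin.ext_iff]; omega) (by simp [hi, Fin.ext_iff]; omega)
  have e3 : adj j (lo i) = lo i := Equiv.swap_apply_of_ne_of_ne
    (by simp [lo, Fin.ext_iff]; omega) (by simp [lo, hi, Fin.ext_iff]; omega)
  have e4 : adj j (hi i) = hi i := Equiv.swap_apply_of_ne_of_ne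
    (by simp [lo, hi, Fin.ext_iff]; omega) (by simp [hi, Fin.ext_iff]; omega)
  have hb : (L.trans (adj j)).trans (adj i) = (L.trans (adj i)).trans (adj j) := by
    apply Equiv.ext
    intro x
    simp only [Equiv.trans_apply]
    generalize L x = y
    by_cases h1 : y = lo i
    · subst h1; rw [e3, adj, Equiv.swap_apply_left, e4]
    by_cases h2 : y = hi i
    · subst h2; rw [e4, adj, Equiv.swap_apply_right, e3]
    have h3 : adj i y = y := Equiv.swap_apply_of_ne_of_ne h1 h2
    rw [h3]
    by_cases h4 : y = lo j
    · subst h4; rw [adj, adj, Equiv.swap_apply_left, e2]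
    by_cases h5 : y = hi j
    · subst h5; rw [adj, adj, Equiv.swap_apply_right, e1]
    rw [adj, adj, Equiv.swap_apply_of_ne_of_ne h4 h5, h3]
  have f1 := opT_vec h i
  have g1 := opT_vec h j
  have g2 := smul_opT_vec h i j
  have f2 := smul_opT_vec h j i
  rw [hb] at f2
  simp only [e1, e2] at g2
  simp only [e3, e4] at f2
  exact comm_aux f1 g1 f2 g2

/-- The diagonal operator `θ_i`. -/
def opTheta (i : Fin n) : Module.End K (Semi n μ) :=
  (semiBasis n μ).constr K fun τ => keyWeight (key τ.label τ.wt i) • vec τ.label τ.wt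

theorem opTheta_vec (L : Box μ ≃ Fin n) (w : Box μ → ℕ) (i : Fin n) :
    opTheta i (vec L w) = keyWeight (key L w i) • vec L w := by
  by_cases h : Increasing L w
  · conv_lhs => rw [vec_of_increasing h, opTheta, Module.Basis.constr_basis]
    rfl
  · rw [vec, dif_neg h, map_zero, smul_zero]

/-- The inverse of the operator `θ_i`. -/
def opThetaInv (i : Fin n) : Module.End K (Semi n μ) :=
  (semiBasis n μ).constr K fun τ => (keyWeight (key τ.label τ.wt i))⁻¹ • vec τ.label τ.wt

theorem opThetaInv_vec (L : Box μ ≃ Fin n) (w : Box μ → ℕ) (i : Fin n) :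
    opThetaInv i (vec L w) = (keyWeight (key L w i))⁻¹ • vec L w := by
  by_cases h : Increasing L w
  · conv_lhs => rw [vec_of_increasing h, opThetaInv, Module.Basis.constr_basis]
    rfl
  · rw [vec, dif_neg h, map_zero, smul_zero]

theorem opTheta_mul_inv (i : Fin n) :
    (opTheta i : Module.End K (Semi n μ)) * opThetaInv i = 1 := by
  refine end_ext fun L w _ => ?_
  rw [Module.End.mul_apply, opThetaInv_vec, map_smul, opTheta_vec, smul_smul,
    inv_mul_cancel₀ (keyWeight_ne_zero _), one_smul, Module.End.one_apply]

theorem opThetaInv_mul (i : Fin n) :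
    (opThetaInv i : Module.End K (Semi n μ)) * opTheta i = 1 := by
  refine end_ext fun L w _ => ?_
  rw [Module.End.mul_apply, opTheta_vec, map_smul, opThetaInv_vec, smul_smul,
    mul_inv_cancel₀ (keyWeight_ne_zero _), one_smul, Module.End.one_apply]

theorem opTheta_comm (i j : Fin n) :
    (opTheta i : Module.End K (Semi n μ)) * opTheta j = opTheta j * opTheta i := by
  refine end_ext fun L w _ => ?_
  simp only [Module.End.mul_apply, opTheta_vec, map_smul]
  exact smul_comm _ _ _

/-- The recursion for θ_{i+1}, multiplied by T_i on the left to clear an inverse. The diagonal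
coefficient of T_i is chosen so that it holds. -/
theorem opT_mul_opTheta_hi (i : Fin (n - 1)) :
    (opT i : Module.End K (Semi n μ)) * opTheta (hi i) =
      opTheta (lo i) * (opT i + algebraMap K _ (t - 1)) := by
  refine end_ext fun L w h => ?_
  simp only [Module.End.mul_apply, LinearMap.add_apply, Module.algebraMap_end_apply, opTheta_vec,
    map_smul, map_add, opT_vec h, key_trans_adj, adj, Equiv.swap_apply_left]
  exact theta_aux (diagCoeff_mul_sub (h.key_lo_ne i))

theorem opTheta_hi (i : Fin (n - 1)) :
    (opTheta (hi i) : Module.End K (Semi n μ)) =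
      t • (heckeInv (opT i) * opTheta (lo i) * heckeInv (opT i)) := by
  obtain ⟨h1, h2⟩ := heckeInv_spec _ (opT_quad (μ := μ) i)
  have h3 := opT_mul_opTheta_hi (μ := μ) i
  have h4 : (opT i : Module.End K (Semi n μ)) + algebraMap K _ (t - 1) = t • heckeInv (opT i) := by
    rw [heckeInv, smul_smul, mul_inv_cancel₀ t_ne_zero, one_smul]
  rw [h4] at h3
  calc opTheta (hi i) = heckeInv (opT i) * (opT i * opTheta (hi i)) := by
        rw [← mul_assoc, h2, one_mul]
    _ = _ := by rw [h3, mul_smul_comm, mul_smul_comm, mul_assoc]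

theorem opT_opTheta (i : Fin (n - 1)) (j : Fin n) (h1 : j ≠ lo i) (h2 : j ≠ hi i) :
    (opT i : Module.End K (Semi n μ)) * opTheta j = opTheta j * opT i := by
  refine end_ext fun L w h => ?_
  simp only [Module.End.mul_apply, opTheta_vec, map_smul, map_add, opT_vec h, key_trans_adj, adj,
    Equiv.swap_apply_of_ne_of_ne h1 h2, smul_add]
  rw [smul_comm (keyWeight _), smul_comm (keyWeight _) (swapCoeff _ _)]

/-! ### The raising operator -/

/-- The operator that maps the basis vector of `τ` to `q^{-w_τ(1)}` times that of `Ψ(τ)`. -/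
def opRaise (hn : 0 < n) : Module.End K (Semi n μ) :=
  (semiBasis n μ).constr K fun τ => (q ^ τ.w ⟨0, hn⟩)⁻¹ • semiBasis n μ τ.psi

theorem opRaise_vec (hn : 0 < n) (L : Box μ ≃ Fin n) (w : Box μ → ℕ) :
    opRaise hn (vec L w) = (q ^ (key L w ⟨0, hn⟩).1)⁻¹ • vec (psiLabel L) (psiWt L w) := by
  by_cases h : Increasing L w
  · conv_lhs => rw [vec_of_increasing h, opRaise, Module.Basis.constr_basis]
    rw [vec_of_increasing (increasing_psi_iff.2 h)]
    rfl
  · rw [vec, dif_neg h, vec, dif_neg (mt increasing_psi_iff.1 h), map_zero, smul_zero]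

theorem key_psi_of_succ (L : Box μ ≃ Fin n) (w : Box μ → ℕ) {i j : Fin n} (h : i.1 + 1 = j.1) :
    key (psiLabel L) (psiWt L w) i = key L w j := by
  have e : (psiLabel L).symm i = L.symm j := by
    rw [Equiv.symm_apply_eq, Fin.ext_iff, psiLabel_val, L.apply_symm_apply, if_neg (by omega)]
    omega
  rw [key, key, e, boxKey, boxKey, psiWt, L.apply_symm_apply, if_neg (by omega)]

theorem keyWeight_key_psi_last (hn : 0 < n) (L : Box μ ≃ Fin n) (w : Box μ → ℕ) {i : Fin n}
    (h : i.1 + 1 = n) :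
    keyWeight (key (psiLabel L) (psiWt L w) i) = q * keyWeight (key L w ⟨0, hn⟩) := by
  have e : (psiLabel L).symm i = L.symm ⟨0, hn⟩ := by
    rw [Equiv.symm_apply_eq, Fin.ext_iff, psiLabel_val, L.apply_symm_apply, if_pos rfl]
    omega
  rw [key, key, e, boxKey, boxKey, psiWt, L.apply_symm_apply, if_pos rfl, keyWeight, keyWeight,
    pow_succ]
  ring

theorem opTheta_opRaise (hn : 0 < n) {i j : Fin n} (h : i.1 + 1 = j.1) :
    (opTheta i : Module.End K (Semi n μ)) * opRaise hn = opRaise hn * opTheta j := by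
  refine end_ext fun L w _ => ?_
  simp only [Module.End.mul_apply, opTheta_vec, opRaise_vec, map_smul, key_psi_of_succ L w h]
  exact smul_comm _ _ _

theorem opTheta_last_opRaise (hn : 0 < n) {i : Fin n} (h : i.1 + 1 = n) :
    (opTheta i : Module.End K (Semi n μ)) * opRaise hn = q • (opRaise hn * opTheta ⟨0, hn⟩) := by
  refine end_ext fun L w _ => ?_
  simp only [Module.End.mul_apply, opTheta_vec, opRaise_vec, map_smul, LinearMap.smul_apply,
    keyWeight_key_psi_last hn L w h, smul_smul]
  congr 1; ring

theorem psiLabel_trans_adj (L : Box μ ≃ Fin n) {i j : Fin (n - 1)} (h : i.1 + 1 = j.1) :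
    psiLabel (L.trans (adj j)) = (psiLabel L).trans (adj i) := by
  ext x
  rw [psiLabel_val, Equiv.trans_apply, Equiv.trans_apply]
  have h1 := (L x).2
  have h2 := j.2
  simp only [adj_val, psiLabel_val]
  grind

theorem psiWt_trans_adj (L : Box μ ≃ Fin n) (w : Box μ → ℕ) (i : Fin (n - 1)) (h : i.1 ≠ 0) :
    psiWt (L.trans (adj i)) w = psiWt L w := by
  ext x
  have e : (adj i (L x)).1 = 0 ↔ (L x).1 = 0 := by
    rw [adj_val]
    grind
  simp only [psiWt, Equiv.trans_apply, e]

theorem opT_opRaise (hn : 0 < n) {i j : Fin (n - 1)} (h : i.1 + 1 = j.1) :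
    (opT i : Module.End K (Semi n μ)) * opRaise hn = opRaise hn * opT j := by
  refine end_ext fun L w hL => ?_
  have h0 : adj j ⟨0, hn⟩ = ⟨0, hn⟩ := Equiv.swap_apply_of_ne_of_ne
    (by simp [lo, Fin.ext_iff]; omega) (by simp [hi, Fin.ext_iff])
  simp only [Module.End.mul_apply, opRaise_vec, map_smul, map_add, opT_vec hL,
    opT_vec (increasing_psi_iff.2 hL)]
  rw [key_psi_of_succ L w (i := lo i) (j := lo j) (by simpa [lo] using h),
    key_psi_of_succ L w (i := hi i) (j := hi j) (by simpa [hi] using h),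
    psiLabel_trans_adj L h, psiWt_trans_adj L w j (by omega), key_trans_adj, h0]
  rw [smul_add, smul_comm _ (diagCoeff _ _), smul_comm _ (swapCoeff _ _)]

/-- Applying Ψ twice carries the labels 1, 2 to n-1, n and multiplies both weights by q. The
seminormal coefficients depend only on the ratio of the weights and on differences of exponents and
contents, so they do not change. -/
theorem opT_opRaise_opRaise (hn : 0 < n) {i j : Fin (n - 1)} (hi' : i.1 + 2 = n) (hj : j.1 = 0) :
    (opT i : Module.End K (Semi n μ)) * (opRaise hn * opRaise hn) =
      opRaise hn * opRaise hn * opT j := by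
  refine end_ext fun L w hL => ?_
  have hk : ∀ (L : Box μ ≃ Fin n) (w : Box μ → ℕ),
      key (psiLabel L) (psiWt L w) ⟨0, hn⟩ = key L w (hi j) := fun L w =>
    key_psi_of_succ L w (by simp [hi, hj])
  have hlo : lo j = ⟨0, hn⟩ := Fin.ext hj
  have hl : psiLabel (psiLabel (L.trans (adj j))) = (psiLabel (psiLabel L)).trans (adj i) := by
    ext x
    rw [psiLabel_val, psiLabel_val, Equiv.trans_apply, Equiv.trans_apply]
    have h1 := (L x).2
    have h2 := j.2
    simp only [adj_val, psiLabel_val]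
    grind
  have hw : psiWt (psiLabel (L.trans (adj j))) (psiWt (L.trans (adj j)) w) =
      psiWt (psiLabel L) (psiWt L w) := by
    ext x
    simp only [psiWt, psiLabel_val]
    have h1 := (L x).2
    have h2 := j.2
    simp only [Equiv.trans_apply, adj_val]
    grind
  have ha : keyWeight (key (psiLabel (psiLabel L)) (psiWt (psiLabel L) (psiWt L w)) (lo i)) =
      q * keyWeight (key L w (lo j)) := by
    rw [key_psi_of_succ _ _ (i := lo i) (j := hi i) (by simp [lo, hi]),
      keyWeight_key_psi_last hn L w (by simp [hi]; omega), hlo]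
  have hb : keyWeight (key (psiLabel (psiLabel L)) (psiWt (psiLabel L) (psiWt L w)) (hi i)) =
      q * keyWeight (key L w (hi j)) := by
    rw [keyWeight_key_psi_last hn _ _ (by simp [hi]; omega), hk]
  -- The off-diagonal coefficient is defined by cases on exponents and contents, so these must be
  -- recovered from the weights.
  have succ_key : ∀ p r : ℕ × ℤ, keyWeight p = q * keyWeight r → p = (r.1 + 1, r.2) := by
    intro p r h
    apply keyWeight_injective
    rw [h, keyWeight, keyWeight, pow_succ]; ring
  have ha' := succ_key _ _ ha
  have hb' := succ_key _ _ hb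
  have hd : diagCoeff (key (psiLabel (psiLabel L)) (psiWt (psiLabel L) (psiWt L w)) (lo i))
      (key (psiLabel (psiLabel L)) (psiWt (psiLabel L) (psiWt L w)) (hi i)) =
      diagCoeff (key L w (lo j)) (key L w (hi j)) := by
    rw [diagCoeff, diagCoeff, ha, hb, ← mul_sub, mul_left_comm, mul_div_mul_left _ _ q_ne_zero]
  have hs : swapCoeff (key (psiLabel (psiLabel L)) (psiWt (psiLabel L) (psiWt L w)) (lo i))
      (key (psiLabel (psiLabel L)) (psiWt (psiLabel L) (psiWt L w)) (hi i)) =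
      swapCoeff (key L w (lo j)) (key L w (hi j)) := by
    rw [swapCoeff, hd, ha', hb', swapCoeff]
    simp only [Linked, Ascends, Nat.add_right_cancel_iff, Nat.add_lt_add_iff_right]
    congr
  simp only [Module.End.mul_apply, opRaise_vec, map_smul, map_add, opT_vec hL,
    opT_vec (increasing_psi_iff.2 (increasing_psi_iff.2 hL)), hd, hs, hl, hw, hk, key_trans_adj]
  rw [← hlo, adj, Equiv.swap_apply_left, Equiv.swap_apply_right]
  simp only [smul_add, smul_smul]
  congr 2 <;> ring

end VVMac
end

noncomputable section
namespace VVMac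

/-! ### From a raising operator to the double affine Hecke relations -/

section Abstract

variable {R : Type} [Ring R] [Algebra K R]

theorem t_smul_heckeInv (x : R) : t • heckeInv x = x + algebraMap K R (t - 1) := by
  rw [heckeInv, smul_smul, mul_inv_cancel₀ t_ne_zero, one_smul]

theorem Commute.heckeInv_right {x y : R} (h : Commute x y) : Commute x (heckeInv y) :=
  (h.add_right (Algebra.commutes _ _).symm).smul_right _

theorem map_heckeInv {R' : Type} [Ring R'] [Algebra K R'] (f : R →ₐ[K] R') (x : R) :
    f (heckeInv x) = heckeInv (f x) := by
  simp [heckeInv]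

theorem heckeInv_semiconj {S x y : R} (h : x * S = S * y) :
    heckeInv x * S = S * heckeInv y := by
  rw [heckeInv, heckeInv, smul_mul_assoc, mul_smul_comm, add_mul, mul_add, h, Algebra.commutes]

/-- The relations of the positive affine Hecke algebra, with generators indexed by `ℕ`. -/
structure AffineRel (n : ℕ) (T θ : ℕ → R) : Prop where
  quad : ∀ i, i + 1 < n → (T i - 1) * (T i + algebraMap K R t) = 0
  braid : ∀ i, i + 2 < n → T i * T (i + 1) * T i = T (i + 1) * T i * T (i + 1)
  comm : ∀ i j, i + 1 < j → j + 1 < n → T i * T j = T j * T i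
  theta_comm : ∀ i j, i < n → j < n → θ i * θ j = θ j * θ i
  theta_succ : ∀ i, i + 1 < n → θ (i + 1) = t • (heckeInv (T i) * θ i * heckeInv (T i))
  T_theta : ∀ i j, i + 1 < n → j < n → j ≠ i → j ≠ i + 1 → T i * θ j = θ j * T i

/-- The relations of a raising operator with the positive affine Hecke algebra. -/
structure RaiseRel (n : ℕ) (T θ : ℕ → R) (S : R) : Prop where
  T_raise : ∀ i, i + 2 < n → T i * S = S * T (i + 1)
  theta_raise : ∀ i, i + 1 < n → θ i * S = S * θ (i + 1)
  theta_last : θ (n - 1) * S = q • (S * θ 0)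
  T_raise_raise : 2 ≤ n → T (n - 2) * (S * S) = S * S * T 0

/-- The product `T_0⁻¹ ⋯ T_{k-1}⁻¹`. -/
def invProd (T : ℕ → R) : ℕ → R
  | 0 => 1
  | k + 1 => invProd T k * heckeInv (T k)

/-- The product `T_0 ⋯ T_{k-1}`. -/
def ascProd (T : ℕ → R) : ℕ → R
  | 0 => 1
  | k + 1 => ascProd T k * T k

/-- The product `T_{k-1} ⋯ T_0`. -/
def descProd (T : ℕ → R) : ℕ → R
  | 0 => 1
  | k + 1 => T k * descProd T k

/-- The element `π`. -/
def piElt (n : ℕ) (T θ : ℕ → R) : R := t ^ (n - 1) • (θ 0 * invProd T (n - 1))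

theorem prod_ofFn_heckeInv (T : ℕ → R) (k : ℕ) :
    (List.ofFn fun i : Fin k => heckeInv (T i)).prod = invProd T k := by
  induction k with
  | zero => rfl
  | succ k ih => rw [List.ofFn_succ', List.concat_eq_append, List.prod_append, List.prod_singleton,
      invProd, ← ih]; rfl

theorem invProd_succ' (T : ℕ → R) (k : ℕ) :
    invProd T (k + 1) = heckeInv (T 0) * invProd (fun i => T (i + 1)) k := by
  induction k with
  | zero => simp [invProd]
  | succ k ih => rw [invProd, ih, invProd, mul_assoc]

theorem invProd_semiconj {T T' : ℕ → R} {S : R} {k : ℕ} (h : ∀ i < k, T i * S = S * T' i) :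
    invProd T k * S = S * invProd T' k := by
  induction k with
  | zero => simp [invProd]
  | succ k ih =>
    rw [invProd, mul_assoc, heckeInv_semiconj (h k (by omega)), ← mul_assoc,
      ih fun i hi => h i (by omega), mul_assoc]; rfl

/-! ### Consequences of the affine Hecke relations for π -/

namespace AffineRel

variable {n : ℕ} {T θ : ℕ → R} (A : AffineRel n T θ)
include A

theorem mul_inv {i : ℕ} (h : i + 1 < n) : T i * heckeInv (T i) = 1 :=
  (heckeInv_spec _ (A.quad i h)).1

theorem inv_mul {i : ℕ} (h : i + 1 < n) : heckeInv (T i) * T i = 1 :=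
  (heckeInv_spec _ (A.quad i h)).2

theorem invProd_mul_descProd {k : ℕ} (h : k < n) : invProd T k * descProd T k = 1 := by
  induction k with
  | zero => simp [invProd, descProd]
  | succ k ih =>
    rw [invProd, descProd, mul_assoc, ← mul_assoc (heckeInv _), A.inv_mul h, one_mul,
      ih (by omega)]

theorem descProd_mul_invProd {k : ℕ} (h : k < n) : descProd T k * invProd T k = 1 := by
  induction k with
  | zero => simp [invProd, descProd]
  | succ k ih =>
    rw [invProd, descProd, mul_assoc, ← mul_assoc (descProd T k), ih (by omega), one_mul,
      A.mul_inv h]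

theorem inv_inv_mul {i : ℕ} (h : i + 2 < n) :
    heckeInv (T i) * heckeInv (T (i + 1)) * T i =
      T (i + 1) * (heckeInv (T i) * heckeInv (T (i + 1))) := by
  have a := A.mul_inv (i := i) (by omega)
  have a' := A.inv_mul (i := i) (by omega)
  have b := A.mul_inv (i := i + 1) (by omega)
  have b' := A.inv_mul (i := i + 1) (by omega)
  have br := A.braid i h
  set x := T i
  set y := T (i + 1)
  set u := heckeInv x
  set v := heckeInv y
  calc u * v * x = u * v * (x * y * x) * (u * v) := by
        rw [show u * v * (x * y * x) * (u * v) = u * v * x * (y * (x * u) * v) by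
          simp only [mul_assoc], a, mul_one, b, mul_one]
    _ = u * (v * y) * x * y * (u * v) := by rw [br]; simp only [mul_assoc]
    _ = y * (u * v) := by rw [b', mul_one, a', one_mul]

theorem invProd_mul_T {i k : ℕ} (h : i + 1 < k) (hk : k < n) :
    invProd T k * T i = T (i + 1) * invProd T k := by
  induction k with
  | zero => omega
  | succ k ih =>
    rcases Nat.lt_succ_iff_lt_or_eq.1 h with h' | h'
    · have hc : Commute (T i) (heckeInv (T k)) :=
        Commute.heckeInv_right (A.comm i k h' hk)
      rw [invProd, mul_assoc, ← hc.eq, ← mul_assoc, ih h' (by omega), mul_assoc]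
    · subst h'
      have hc : invProd T i * T (i + 1) = T (i + 1) * invProd T i :=
        invProd_semiconj fun j hj => A.comm j (i + 1) (by omega) hk
      rw [invProd, invProd, mul_assoc (invProd T i), mul_assoc, A.inv_inv_mul hk, ← mul_assoc, hc,
        mul_assoc]

theorem pi_mul_T {i : ℕ} (h : i + 2 < n) : piElt n T θ * T i = T (i + 1) * piElt n T θ := by
  rw [piElt, smul_mul_assoc, mul_smul_comm, mul_assoc,
    A.invProd_mul_T (i := i) (k := n - 1) (by omega) (by omega), ← mul_assoc,
    ← A.T_theta (i + 1) 0 (by omega) (by omega) (by omega) (by omega), mul_assoc]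

theorem pi_mul_T_last (h : 2 ≤ n) :
    piElt n T θ * T (n - 2) = t ^ (n - 1) • (θ 0 * invProd T (n - 2)) := by
  obtain ⟨m, rfl⟩ : ∃ m, n = m + 2 := ⟨n - 2, by omega⟩
  simp only [piElt, Nat.add_sub_cancel, show m + 2 - 1 = m + 1 by omega]
  rw [invProd, smul_mul_assoc, mul_assoc, mul_assoc, A.inv_mul (by omega), mul_one]

theorem pi_eq (h : 2 ≤ n) : piElt n T θ =
    t ^ (n - 1) • (θ 0 * heckeInv (T 0) * invProd (fun i => T (i + 1)) (n - 2)) := by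
  obtain ⟨m, rfl⟩ : ∃ m, n = m + 2 := ⟨n - 2, by omega⟩
  simp only [piElt, Nat.add_sub_cancel, show m + 2 - 1 = m + 1 by omega]
  rw [invProd_succ', mul_assoc]

/-- This is the commutation of θ_1 and θ_2, with θ_2 written as t T_1⁻¹ θ_1 T_1⁻¹ and the scalar
cancelled. -/
theorem theta_inv_theta (h : 2 ≤ n) : θ 0 * heckeInv (T 0) * θ 0 =
    T 0 * (θ 0 * heckeInv (T 0) * (θ 0 * heckeInv (T 0))) := by
  have h1 := A.theta_comm 0 1 (by omega) (by omega)
  rw [A.theta_succ 0 (by omega), mul_smul_comm, smul_mul_assoc] at h1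
  have h2 := smul_right_injective R t_ne_zero h1
  have h3 : θ 0 * heckeInv (T 0) * (θ 0 * heckeInv (T 0)) =
      heckeInv (T 0) * (θ 0 * heckeInv (T 0) * θ 0) := by
    simpa only [mul_assoc] using h2
  rw [h3, ← mul_assoc, A.mul_inv (by omega), one_mul]

theorem pi_mul_theta (h : 2 ≤ n) :
    piElt n T θ * θ 0 = T 0 * (θ 0 * heckeInv (T 0)) * piElt n T θ := by
  have hc : invProd (fun i => T (i + 1)) (n - 2) * θ 0 =
      θ 0 * invProd (fun i => T (i + 1)) (n - 2) :=
    invProd_semiconj fun i hi => A.T_theta _ _ (by omega) (by omega) (by omega) (by omega)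
  rw [A.pi_eq h, smul_mul_assoc, mul_smul_comm, mul_assoc, hc, ← mul_assoc, A.theta_inv_theta h]
  simp only [mul_assoc]

/-- Conjugation by π shifts T_i to T_{i+1} except at the end of the chain; this closes the cycle
from T_{n-1} back to T_1 in two steps. It depends on the commutation of θ_1 and θ_2, through
`pi_mul_theta`. -/
theorem T_mul_pi_pi (h : 2 ≤ n) :
    T 0 * (piElt n T θ * piElt n T θ) = piElt n T θ * piElt n T θ * T (n - 2) := by
  have hc : invProd (fun i => T (i + 1)) (n - 2) * piElt n T θ =
      piElt n T θ * invProd T (n - 2) :=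
    invProd_semiconj fun i hi => (A.pi_mul_T (by omega)).symm
  have e1 : T 0 * (piElt n T θ * piElt n T θ) =
      t ^ (n - 1) • (T 0 * (θ 0 * heckeInv (T 0)) * piElt n T θ * invProd T (n - 2)) := by
    have e := congrArg (fun x => T 0 * x * piElt n T θ) (A.pi_eq h)
    rw [← mul_assoc, e, mul_smul_comm, smul_mul_assoc, mul_assoc (T 0), mul_assoc (θ 0 * heckeInv (T 0)), hc]
    simp only [mul_assoc]
  rw [e1, ← A.pi_mul_theta h, mul_assoc (piElt n T θ) (piElt n T θ), A.pi_mul_T_last h,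
    mul_smul_comm, mul_assoc]

omit A in
/-- A sequence with `y_{i+1} = t T_i⁻¹ y_i T_i⁻¹` satisfies
`t^k y_0 = T_0 ⋯ T_{k-1} y_k T_{k-1} ⋯ T_0`. -/
theorem conj_zero {y : ℕ → R} (hy : ∀ i, i + 1 < n → t • y i = T i * y (i + 1) * T i) {k : ℕ}
    (hk : k < n) : t ^ k • y 0 = ascProd T k * y k * descProd T k := by
  induction k with
  | zero => simp [ascProd, descProd]
  | succ k ih =>
    rw [pow_succ', mul_smul, ih (by omega), ascProd, descProd, ← smul_mul_assoc, ← mul_smul_comm,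
      hy k hk]
    simp only [mul_assoc]

theorem t_smul_theta {i : ℕ} (h : i + 1 < n) : t • θ i = T i * θ (i + 1) * T i := by
  rw [A.theta_succ i h, mul_smul_comm, smul_mul_assoc, ← mul_assoc, ← mul_assoc, A.mul_inv h,
    one_mul, mul_assoc, A.inv_mul h, mul_one]

theorem pi_eq_ascProd (h : 0 < n) : piElt n T θ = ascProd T (n - 1) * θ (n - 1) := by
  rw [piElt, ← smul_mul_assoc, conj_zero (T := T) (y := θ) (fun i hi => A.t_smul_theta hi) (by omega), mul_assoc,
    A.descProd_mul_invProd (by omega), mul_one]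

theorem pi_mul_descProd (h : 0 < n) :
    piElt n T θ * descProd T (n - 1) = t ^ (n - 1) • θ 0 := by
  rw [piElt, smul_mul_assoc, mul_assoc, A.invProd_mul_descProd (by omega), mul_one]

end AffineRel

/-- The elements `X_{n-1-k}`. -/
def xDesc (n : ℕ) (T θ : ℕ → R) (S : R) : ℕ → R
  | 0 => S * piElt n T θ
  | k + 1 => t⁻¹ • (T (n - 2 - k) * xDesc n T θ S k * T (n - 2 - k))

/-- The elements `X_i`: the last one is `S π`, and `X_i = t⁻¹ T_i X_{i+1} T_i`. -/
def xElt (n : ℕ) (T θ : ℕ → R) (S : R) (i : ℕ) : R := xDesc n T θ S (n - 1 - i)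

theorem xElt_last (n : ℕ) (T θ : ℕ → R) (S : R) : xElt n T θ S (n - 1) = S * piElt n T θ := by
  rw [xElt, Nat.sub_self, xDesc]

theorem xElt_of_lt {n : ℕ} (T θ : ℕ → R) (S : R) {i : ℕ} (h : i + 1 < n) :
    xElt n T θ S i = t⁻¹ • (T i * xElt n T θ S (i + 1) * T i) := by
  obtain ⟨k, hk⟩ : ∃ k, n - 1 - i = k + 1 := ⟨n - 2 - i, by omega⟩
  have h1 : n - 1 - (i + 1) = k := by omega
  have h2 : n - 2 - k = i := by omega
  rw [xElt, xElt, hk, h1, xDesc, h2]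

/-! ### Relations among the X_i, the T_i and π derived from the raising operator -/

namespace RaiseRel

variable {n : ℕ} {T θ : ℕ → R} {S : R} (A : AffineRel n T θ) (B : RaiseRel n T θ S)
include A B

omit A B in
theorem t_smul_x {i : ℕ} (h : i + 1 < n) :
    t • xElt n T θ S i = T i * xElt n T θ S (i + 1) * T i := by
  rw [xElt_of_lt T θ S h, smul_smul, mul_inv_cancel₀ t_ne_zero, one_smul]

omit B in
theorem x_succ {i : ℕ} (h : i + 1 < n) : xElt n T θ S (i + 1) =
    t • (heckeInv (T i) * xElt n T θ S i * heckeInv (T i)) := by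
  rw [← smul_mul_assoc, ← mul_smul_comm, t_smul_x h, ← mul_assoc, ← mul_assoc,
    A.inv_mul h, one_mul, mul_assoc, A.mul_inv h, mul_one]

/-- The factor T_{n-1} cancels the last inverse in π. The remaining inverses and θ_1 move through S
with indices raised by one, and expanding θ_2 rebuilds π. -/
theorem pi_T_raise (h : 2 ≤ n) :
    piElt n T θ * T (n - 2) * S = S * (t • heckeInv (T 0)) * piElt n T θ := by
  have hc : invProd T (n - 2) * S = S * invProd (fun i => T (i + 1)) (n - 2) :=
    invProd_semiconj fun i hi => B.T_raise i (by omega)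
  rw [A.pi_mul_T_last h, smul_mul_assoc, mul_assoc, hc, ← mul_assoc, B.theta_raise 0 (by omega),
    A.theta_succ 0 (by omega), A.pi_eq h]
  simp only [mul_smul_comm, smul_mul_assoc, mul_assoc]

theorem T_x_last {i : ℕ} (h : i + 2 < n) :
    T i * xElt n T θ S (n - 1) = xElt n T θ S (n - 1) * T i := by
  rw [xElt_last, ← mul_assoc, B.T_raise i h, mul_assoc, ← A.pi_mul_T h, mul_assoc]

theorem pi_x_pred_last (h : 2 ≤ n) :
    piElt n T θ * xElt n T θ S (n - 2) = xElt n T θ S (n - 1) * piElt n T θ := by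
  have h1 : n - 2 + 1 = n - 1 := by omega
  rw [xElt_of_lt T θ S (i := n - 2) (by omega), h1, xElt_last]
  calc piElt n T θ * t⁻¹ • (T (n - 2) * (S * piElt n T θ) * T (n - 2))
      = t⁻¹ • (piElt n T θ * T (n - 2) * S * piElt n T θ * T (n - 2)) := by
        simp only [mul_smul_comm, mul_assoc]
    _ = S * (heckeInv (T 0) * (piElt n T θ * piElt n T θ * T (n - 2))) := by
        rw [pi_T_raise A B h]
        simp only [mul_smul_comm, smul_mul_assoc, mul_assoc, smul_smul]
        rw [inv_mul_cancel₀ t_ne_zero, one_smul]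
    _ = _ := by
        rw [← A.T_mul_pi_pi h, ← mul_assoc (heckeInv _), A.inv_mul (by omega), one_mul, mul_assoc]

/-- Downward induction on j. The last X is Sπ, where π raises the index of T_i and S lowers it
again. -/
theorem T_x {i j : ℕ} (hi : i + 1 < n) (hj : j < n) (h1 : j ≠ i) (h2 : j ≠ i + 1) :
    Commute (T i) (xElt n T θ S j) := by
  obtain ⟨k, hk⟩ : ∃ k, n - 1 - j = k := ⟨_, rfl⟩
  induction k using Nat.strong_induction_on generalizing i j with
  | _ k ih =>
  rcases Nat.eq_zero_or_pos k with h0 | h0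
  · obtain rfl : j = n - 1 := by omega
    exact T_x_last A B (by omega)
  · rw [xElt_of_lt T θ S (i := j) (by omega)]
    -- For i = j + 1 the induction hypothesis does not apply to X_{j+1}. Two steps of the recursion
    -- give X_j = t⁻² T_j T_{j+1} X_{j+2} T_{j+1} T_j, and the braid relation carries T_{j+1}
    -- through as T_j.
    rcases eq_or_ne i (j + 1) with h3 | h3
    · subst h3
      rw [xElt_of_lt T θ S (i := j + 1) (by omega)]
      have hc : T j * xElt n T θ S (j + 2) = xElt n T θ S (j + 2) * T j :=
        ih (n - 1 - (j + 2)) (by omega) (i := j) (j := j + 2) (by omega) (by omega) (by omega)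
          (by omega) rfl
      have br := A.braid j (by omega)
      set a := T j
      set b := T (j + 1)
      set x := xElt n T θ S (j + 2)
      refine Commute.smul_right ?_ _
      rw [mul_smul_comm, smul_mul_assoc]
      refine Commute.smul_right ?_ _
      change b * (a * (b * x * b) * a) = a * (b * x * b) * a * b
      calc b * (a * (b * x * b) * a) = b * a * b * x * b * a := by simp only [mul_assoc]
        _ = a * b * (a * x) * b * a := by rw [← br]; simp only [mul_assoc]
        _ = a * b * x * (a * b * a) := by rw [hc]; simp only [mul_assoc]
        _ = _ := by rw [br]; simp only [mul_assoc]
    · have hT : Commute (T i) (T j) := by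
        rcases lt_or_gt_of_ne h1 with h4 | h4
        · exact (A.comm j i (by omega) (by omega)).symm
        · exact A.comm i j (by omega) (by omega)
      have hX := ih (n - 1 - (j + 1)) (by omega) (i := i) (j := j + 1) hi (by omega) (by omega)
        (by omega) rfl
      exact ((hT.mul_right hX).mul_right hT).smul_right _

theorem pi_x {i : ℕ} (h : i + 1 < n) :
    piElt n T θ * xElt n T θ S i = xElt n T θ S (i + 1) * piElt n T θ := by
  obtain ⟨k, hk⟩ : ∃ k, n - 2 - i = k := ⟨_, rfl⟩
  induction k generalizing i with
  | zero =>
    obtain rfl : i = n - 2 := by omega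
    rw [pi_x_pred_last A B (by omega)]
    congr 2; omega
  | succ k ih =>
    have e1 := A.pi_mul_T (i := i) (by omega)
    have e2 := ih (i := i + 1) (by omega) (by omega)
    have e3 := xElt_of_lt T θ S (i := i + 1) (n := n) (by omega)
    have e4 := congrArg (· * piElt n T θ) e3
    rw [xElt_of_lt T θ S h, e4, mul_smul_comm, smul_mul_assoc]
    congr 1
    rw [mul_assoc (T i), ← mul_assoc, e1, mul_assoc (T (i + 1)), ← mul_assoc (piElt n T θ), e2,
      mul_assoc (xElt n T θ S (i + 1 + 1)), e1]
    simp only [mul_assoc]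

/-- Unwinding the recursion gives X_1 = T_1 ⋯ T_{n-1} S θ_1, while π = T_1 ⋯ T_{n-1} θ_n. What
remains is θ_n S = q S θ_1. -/
theorem pi_x_last (h : 0 < n) : piElt n T θ * xElt n T θ S (n - 1) =
    q • (xElt n T θ S 0 * piElt n T θ) := by
  have e1 := AffineRel.conj_zero (y := xElt n T θ S) (fun i hi => t_smul_x hi) (k := n - 1) (by omega)
  have e2 : xElt n T θ S 0 =
      (t ^ (n - 1))⁻¹ • (ascProd T (n - 1) * xElt n T θ S (n - 1) * descProd T (n - 1)) := by
    rw [← e1, smul_smul, inv_mul_cancel₀ (pow_ne_zero _ t_ne_zero), one_smul]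
  have e3 : xElt n T θ S 0 = ascProd T (n - 1) * S * θ 0 := by
    rw [e2, xElt_last, mul_assoc, mul_assoc S, A.pi_mul_descProd h, mul_smul_comm, mul_smul_comm,
      smul_smul, inv_mul_cancel₀ (pow_ne_zero _ t_ne_zero), one_smul, mul_assoc]
  rw [e3, ← smul_mul_assoc, mul_assoc (ascProd T (n - 1)), ← mul_smul_comm, ← B.theta_last,
    ← mul_assoc, ← A.pi_eq_ascProd h, xElt_last, mul_assoc]

/-- Both products reduce to S² π². The relation of T_{n-1} with S² enters here. -/
theorem x_comm_last (h : 2 ≤ n) : xElt n T θ S (n - 2) * xElt n T θ S (n - 1) =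
    xElt n T θ S (n - 1) * xElt n T θ S (n - 2) := by
  have h1 : n - 2 + 1 = n - 1 := by omega
  have e1 : xElt n T θ S (n - 1) * xElt n T θ S (n - 2) =
      S * S * (piElt n T θ * piElt n T θ) := by
    conv_lhs => rw [xElt_last, mul_assoc, pi_x_pred_last A B h, xElt_last]
    simp only [mul_assoc]
  rw [e1, xElt_of_lt T θ S (i := n - 2) (by omega), h1, xElt_last]
  calc t⁻¹ • (T (n - 2) * (S * piElt n T θ) * T (n - 2)) * (S * piElt n T θ)
      = t⁻¹ • (T (n - 2) * S * (piElt n T θ * T (n - 2) * S) * piElt n T θ) := by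
        simp only [smul_mul_assoc, mul_assoc]
    _ = T (n - 2) * (S * S) * heckeInv (T 0) * (piElt n T θ * piElt n T θ) := by
        rw [pi_T_raise A B h]
        simp only [mul_smul_comm, smul_mul_assoc, mul_assoc, smul_smul]
        rw [inv_mul_cancel₀ t_ne_zero, one_smul]
    _ = _ := by rw [B.T_raise_raise h, mul_assoc (S * S), A.mul_inv (by omega), mul_one]

/-- Multiplying by π on the left shifts both indices up, so the last pair implies all others once π
can be cancelled. Cancellation is a hypothesis because the positive algebra does not contain π⁻¹. -/
theorem x_comm_succ (hπ : IsLeftRegular (piElt n T θ)) {i : ℕ} (h : i + 1 < n) :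
    xElt n T θ S i * xElt n T θ S (i + 1) = xElt n T θ S (i + 1) * xElt n T θ S i := by
  obtain ⟨k, hk⟩ : ∃ k, n - 2 - i = k := ⟨_, rfl⟩
  induction k generalizing i with
  | zero =>
    obtain rfl : i = n - 2 := by omega
    have h1 : n - 2 + 1 = n - 1 := by omega
    rw [h1]
    exact x_comm_last A B (by omega)
  | succ k ih =>
    apply hπ
    simp only
    rw [← mul_assoc, ← mul_assoc, pi_x A B h, pi_x A B (i := i + 1) (by omega), mul_assoc,
      pi_x A B (i := i + 1) (by omega), mul_assoc, pi_x A B h, ← mul_assoc, ← mul_assoc,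
      ih (i := i + 1) (by omega) (by omega)]

theorem x_comm_of_lt (hπ : IsLeftRegular (piElt n T θ)) {i j : ℕ} (hij : i < j) (hj : j < n) :
    Commute (xElt n T θ S i) (xElt n T θ S j) := by
  obtain ⟨k, hk⟩ : ∃ k, j - i = k + 1 := ⟨j - i - 1, by omega⟩
  induction k generalizing i with
  | zero =>
    obtain rfl : j = i + 1 := by omega
    exact x_comm_succ A B hπ hj
  | succ k ih =>
    have h1 := ih (i := i + 1) (by omega) (by omega)
    have h2 := T_x A B (i := i) (j := j) (by omega) hj (by omega) (by omega)
    rw [xElt_of_lt T θ S (by omega)]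
    exact ((h2.mul_left h1).mul_left h2).smul_left _

theorem x_comm (hπ : IsLeftRegular (piElt n T θ)) {i j : ℕ} (hi : i < n) (hj : j < n) :
    xElt n T θ S i * xElt n T θ S j = xElt n T θ S j * xElt n T θ S i := by
  rcases lt_trichotomy i j with h | h | h
  · exact x_comm_of_lt A B hπ h hj
  · rw [h]
  · exact (x_comm_of_lt A B hπ h hi).symm

end RaiseRel

end Abstract

end VVMac
end

noncomputable section
namespace VVMac

variable {n : ℕ} {μ : YoungDiagram}

/-! ### The representation on the seminormal module -/

/-- The operators `T_i`, indexed by `ℕ`. -/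
def natT (n : ℕ) (μ : YoungDiagram) (i : ℕ) : Module.End K (Semi n μ) :=
  if h : i < n - 1 then opT ⟨i, h⟩ else 0

/-- The operators `θ_i`, indexed by `ℕ`. -/
def natTheta (n : ℕ) (μ : YoungDiagram) (i : ℕ) : Module.End K (Semi n μ) :=
  if h : i < n then opTheta ⟨i, h⟩ else 0

/-- The raising operator. -/
def natRaise (n : ℕ) (μ : YoungDiagram) : Module.End K (Semi n μ) :=
  if h : 0 < n then opRaise h else 0

theorem natT_val (i : Fin (n - 1)) : natT n μ i = opT i := dif_pos i.2

theorem natT_of_lt {i : ℕ} (h : i + 1 < n) : natT n μ i = opT ⟨i, by omega⟩ :=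
  dif_pos (by omega)

theorem natTheta_of_lt {i : ℕ} (h : i < n) : natTheta n μ i = opTheta ⟨i, h⟩ := dif_pos h

theorem natRaise_of_pos (h : 0 < n) : natRaise n μ = opRaise h := dif_pos h

theorem affineRel_nat (n : ℕ) (μ : YoungDiagram) : AffineRel n (natT n μ) (natTheta n μ) where
  quad i h := by rw [natT_of_lt h]; exact opT_quad _
  braid i h := by
    rw [natT_of_lt (i := i) (by omega), natT_of_lt (i := i + 1) h]
    exact opT_braid _ _ rfl
  comm i j h h' := by
    rw [natT_of_lt (i := i) (by omega), natT_of_lt (i := j) h']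
    exact opT_comm _ _ h
  theta_comm i j h h' := by
    rw [natTheta_of_lt h, natTheta_of_lt h']
    exact opTheta_comm _ _
  theta_succ i h := by
    rw [natTheta_of_lt h, natTheta_of_lt (i := i) (by omega), natT_of_lt h]
    exact opTheta_hi (n := n) ⟨i, by omega⟩
  T_theta i j h h' h1 h2 := by
    rw [natT_of_lt h, natTheta_of_lt h']
    exact opT_opTheta _ _ (fun e => h1 (congrArg Fin.val e)) (fun e => h2 (congrArg Fin.val e))

theorem raiseRel_nat (hn : 0 < n) (μ : YoungDiagram) :
    RaiseRel n (natT n μ) (natTheta n μ) (natRaise n μ) where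
  T_raise i h := by
    rw [natT_of_lt (i := i) (by omega), natT_of_lt (i := i + 1) h, natRaise_of_pos hn]
    exact opT_opRaise hn rfl
  theta_raise i h := by
    rw [natTheta_of_lt (i := i) (by omega), natTheta_of_lt h, natRaise_of_pos hn]
    exact opTheta_opRaise hn rfl
  theta_last := by
    rw [natTheta_of_lt (i := n - 1) (by omega), natTheta_of_lt hn, natRaise_of_pos hn]
    exact opTheta_last_opRaise hn (by simp only; omega)
  T_raise_raise h := by
    rw [natT_of_lt (i := n - 2) (by omega), natT_of_lt (i := 0) (by omega), natRaise_of_pos hn]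
    exact opT_opRaise_opRaise hn (by simp only; omega) rfl

/-- The operator `π`. -/
def opPi (n : ℕ) (μ : YoungDiagram) : Module.End K (Semi n μ) :=
  piElt n (natT n μ) (natTheta n μ)

/-- The inverse of the operator `π`. -/
def opPiInv (hn : 0 < n) (μ : YoungDiagram) : Module.End K (Semi n μ) :=
  (t ^ (n - 1))⁻¹ • (descProd (natT n μ) (n - 1) * opThetaInv ⟨0, hn⟩)

theorem opPi_mul_inv (hn : 0 < n) (μ : YoungDiagram) : opPi n μ * opPiInv hn μ = 1 := by
  rw [opPi, opPiInv, mul_smul_comm, ← mul_assoc, (affineRel_nat n μ).pi_mul_descProd hn,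
    smul_mul_assoc, smul_smul, inv_mul_cancel₀ (pow_ne_zero _ t_ne_zero), one_smul,
    natTheta_of_lt hn, opTheta_mul_inv]

theorem opPiInv_mul (hn : 0 < n) (μ : YoungDiagram) : opPiInv hn μ * opPi n μ = 1 := by
  rw [opPi, opPiInv, piElt, mul_smul_comm, smul_mul_assoc, smul_smul,
    mul_inv_cancel₀ (pow_ne_zero _ t_ne_zero), one_smul, natTheta_of_lt hn, mul_assoc,
    ← mul_assoc (opThetaInv _), opThetaInv_mul, one_mul,
    (affineRel_nat n μ).descProd_mul_invProd (by omega)]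

/-- The operator `X_i`. -/
def opX (n : ℕ) (μ : YoungDiagram) (i : ℕ) : Module.End K (Semi n μ) :=
  xElt n (natT n μ) (natTheta n μ) (natRaise n μ) i

theorem opX_comm {i j : ℕ} (hi : i < n) (hj : j < n) : opX n μ i * opX n μ j =
    opX n μ j * opX n μ i := by
  have hn : 0 < n := by omega
  refine RaiseRel.x_comm (affineRel_nat n μ) (raiseRel_nat hn μ) ?_ hi hj
  intro a b h
  have hab : opPiInv hn μ * (opPi n μ * a) = opPiInv hn μ * (opPi n μ * b) :=
    congrArg (opPiInv hn μ * ·) h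
  simpa only [← mul_assoc, opPiInv_mul, one_mul] using hab

/-- The operators of the generators. -/
def opGen (n : ℕ) (μ : YoungDiagram) : DGen n → Module.End K (Semi n μ)
  | DGen.T i => opT i
  | DGen.theta i => opTheta i
  | DGen.X i => opX n μ i

/-- The operators of words in the generators. -/
def opWord (n : ℕ) (μ : YoungDiagram) : FreeAlgebra K (DGen n) →ₐ[K] Module.End K (Semi n μ) :=
  FreeAlgebra.lift K (opGen n μ)

theorem opWord_T (i : Fin (n - 1)) : opWord n μ (wT i) = opT i := FreeAlgebra.lift_ι_apply _ _

theorem opWord_theta (i : Fin n) : opWord n μ (wTheta i) = opTheta i :=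
  FreeAlgebra.lift_ι_apply _ _

theorem opWord_X (i : Fin n) : opWord n μ (wX i) = opX n μ i := FreeAlgebra.lift_ι_apply _ _

theorem opWord_pi (hn : 0 < n) : opWord n μ (wPi hn) = opPi n μ := by
  rw [wPi, map_smul, map_mul, opWord_theta, map_list_prod, List.map_ofFn, opPi, piElt,
    ← prod_ofFn_heckeInv, natTheta_of_lt hn]
  congr 4
  ext1 i
  rw [Function.comp_apply, map_heckeInv, opWord_T, natT_val]

theorem opWord_rel {a b : FreeAlgebra K (DGen n)} (h : DahaRel n a b) :
    opWord n μ a = opWord n μ b := by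
  have A := affineRel_nat n μ
  induction h with
  | quad i =>
    simp only [map_mul, map_sub, map_add, map_one, AlgHom.commutes, map_zero, opWord_T]
    exact opT_quad i
  | braid i j h => simp only [map_mul, opWord_T]; exact opT_braid i j h
  | comm i j h => simp only [map_mul, opWord_T]; exact opT_comm i j h
  | theta_comm i j => simp only [map_mul, opWord_theta]; exact opTheta_comm i j
  | theta_succ i =>
    simp only [map_mul, map_smul, map_heckeInv, opWord_theta, opWord_T]; exact opTheta_hi i
  | T_theta i j h h' => simp only [map_mul, opWord_theta, opWord_T]; exact opT_opTheta i j h h'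
  | X_comm i j => simp only [map_mul, opWord_X]; exact opX_comm i.2 j.2
  | X_succ i =>
    simp only [map_mul, map_smul, map_heckeInv, opWord_X, opWord_T, ← natT_val]
    exact RaiseRel.x_succ A (by have := i.2; omega)
  | T_X i j h h' =>
    simp only [map_mul, opWord_X, opWord_T, ← natT_val]
    have hi := i.2
    exact RaiseRel.T_x A (raiseRel_nat (by omega) μ) (by omega) j.2
      (fun e => h (Fin.ext e)) (fun e => h' (Fin.ext e))
  | pi_X hn i =>
    simp only [map_mul, opWord_X, opWord_pi]
    exact RaiseRel.pi_x A (raiseRel_nat hn μ) (i := i.1) (by have := i.2; omega)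
  | pi_X_last hn =>
    simp only [map_mul, map_smul, opWord_X, opWord_pi]
    exact RaiseRel.pi_x_last A (raiseRel_nat hn μ) hn

/-- The representation of the double affine Hecke algebra on the seminormal module. -/
def rep (n : ℕ) (μ : YoungDiagram) : Daha n →ₐ[K] Module.End K (Semi n μ) :=
  RingQuot.liftAlgHom K ⟨opWord n μ, fun _ _ h => opWord_rel h⟩

theorem rep_mk (a : FreeAlgebra K (DGen n)) : rep n μ (Daha.mk n a) = opWord n μ a :=
  RingQuot.liftAlgHom_mkAlgHom_apply _ _ _ _

theorem rep_T (i : Fin (n - 1)) : rep n μ (Daha.T i) = opT i := (rep_mk _).trans (opWord_T i)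

theorem rep_theta (i : Fin n) : rep n μ (Daha.theta i) = opTheta i :=
  (rep_mk _).trans (opWord_theta i)

theorem rep_X (i : Fin n) : rep n μ (Daha.X i) = opX n μ i := (rep_mk _).trans (opWord_X i)

theorem rep_pi (hn : 0 < n) : rep n μ (Daha.pi hn) = opPi n μ := (rep_mk _).trans (opWord_pi hn)

/-- The representation of the finite Hecke algebra on the seminormal module. -/
def heckeRep (n : ℕ) (μ : YoungDiagram) : Hecke n →ₐ[K] Module.End K (Semi n μ) :=
  RingQuot.liftAlgHom K ⟨FreeAlgebra.lift K opT, fun a b h => by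
    induction h with
    | quad i =>
      simp only [map_mul, map_sub, map_add, map_one, AlgHom.commutes, map_zero,
        FreeAlgebra.lift_ι_apply]
      exact opT_quad i
    | braid i j h => simp only [map_mul, FreeAlgebra.lift_ι_apply]; exact opT_braid i j h
    | comm i j h => simp only [map_mul, FreeAlgebra.lift_ι_apply]; exact opT_comm i j h⟩

theorem heckeRep_T (i : Fin (n - 1)) : heckeRep n μ (Hecke.T i) = opT i :=
  (RingQuot.liftAlgHom_mkAlgHom_apply _ _ _ _).trans (FreeAlgebra.lift_ι_apply _ _)

instance : Module (Daha n) (Semi n μ) := Module.compHom _ (rep n μ).toRingHom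

instance : Module (Hecke n) (Semi n μ) := Module.compHom _ (heckeRep n μ).toRingHom

theorem daha_smul_def (d : Daha n) (v : Semi n μ) : d • v = rep n μ d v := rfl

theorem hecke_smul_def (d : Hecke n) (v : Semi n μ) : d • v = heckeRep n μ d v := rfl

instance : IsScalarTower K (Daha n) (Semi n μ) :=
  ⟨fun a d v => by rw [daha_smul_def, map_smul]; rfl⟩

instance : IsScalarTower K (Hecke n) (Semi n μ) :=
  ⟨fun a d v => by rw [hecke_smul_def, map_smul]; rfl⟩

instance : SMulCommClass K (Daha n) (Semi n μ) :=
  ⟨fun a d v => by rw [daha_smul_def, daha_smul_def, map_smul]⟩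

/-! ### The Specht module inside the seminormal module -/

/-- The basis vector of a standard tableau. -/
def stdVec (S : SYT n μ) : Semi n μ := semiBasis n μ S.toPSYT

theorem stdVec_eq (S : SYT n μ) : stdVec S = vec S.label (fun _ => 0) :=
  (vec_label S.toPSYT).symm

theorem SYT.increasing (S : SYT n μ) : Increasing S.label (fun _ => 0) := S.toPSYT.increasing

/-- The span of the standard tableaux. -/
def stdSpan (n : ℕ) (μ : YoungDiagram) : Submodule K (Semi n μ) :=
  Submodule.span K (Set.range stdVec)

theorem vec_mem_stdSpan (L : Box μ ≃ Fin n) : vec L (fun _ => 0) ∈ stdSpan n μ := by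
  by_cases h : Increasing L (fun _ => 0)
  · rw [vec_of_increasing h, ← h.toPSYT.toSYT_toPSYT fun _ => rfl]
    exact Submodule.subset_span ⟨_, rfl⟩
  · rw [vec, dif_neg h]; exact zero_mem _

theorem opT_mem_stdSpan (i : Fin (n - 1)) {v : Semi n μ} (hv : v ∈ stdSpan n μ) :
    opT i v ∈ stdSpan n μ := by
  have : stdSpan n μ ≤ (stdSpan n μ).comap (opT i) := by
    refine Submodule.span_le.2 ?_
    rintro _ ⟨S, rfl⟩
    rw [SetLike.mem_coe, Submodule.mem_comap, stdVec_eq, opT_vec S.increasing]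
    exact add_mem (Submodule.smul_mem _ _ (vec_mem_stdSpan _))
      (Submodule.smul_mem _ _ (vec_mem_stdSpan _))
  exact this hv

theorem heckeInv_opT_mem_stdSpan (i : Fin (n - 1)) {v : Semi n μ} (hv : v ∈ stdSpan n μ) :
    heckeInv (opT i) v ∈ stdSpan n μ := by
  rw [heckeInv, LinearMap.smul_apply, LinearMap.add_apply, Module.algebraMap_end_apply]
  exact Submodule.smul_mem _ _ (add_mem (opT_mem_stdSpan i hv) (Submodule.smul_mem _ _ hv))

theorem SYT.box_zero (S : SYT n μ) (hn : 0 < n) : (S.label.symm ⟨0, hn⟩).1 = (0, 0) := by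
  set x := S.label.symm ⟨0, hn⟩ with hx
  by_contra hne
  let y : Box μ := ⟨(0, 0), μ.up_left_mem (Nat.zero_le _) (Nat.zero_le _) x.2⟩
  have := S.increasing.entryLT (x := y) (y := x) (Nat.zero_le _) (Nat.zero_le _)
    (fun h => hne (congrArg Subtype.val h).symm)
  simp [EntryLT, hx, Fin.lt_def] at this

/-- The sequences θ_i and θ̄_i obey the same recursion and agree at i = 1: label 1 of a standard
tableau sits in the corner box, whose weight is 1. The restriction to standard tableaux is
essential, since θ_1 is not the identity in general. -/
theorem heckeRep_theta (i : ℕ) (h : i < n) {v : Semi n μ} (hv : v ∈ stdSpan n μ) :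
    heckeRep n μ (Hecke.thetaAux n i h) v = opTheta ⟨i, h⟩ v := by
  induction i generalizing v with
  | zero =>
    rw [Hecke.thetaAux, map_one, Module.End.one_apply]
    have : stdSpan n μ ≤ LinearMap.eqLocus (LinearMap.id) (opTheta (μ := μ) ⟨0, h⟩) := by
      refine Submodule.span_le.2 ?_
      rintro _ ⟨S, rfl⟩
      rw [SetLike.mem_coe, LinearMap.mem_eqLocus, stdVec_eq, opTheta_vec]
      have : keyWeight (key S.label (fun _ => 0) ⟨0, h⟩) = 1 := by
        simp [keyWeight, key, boxKey, content, S.box_zero h]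
      rw [this, one_smul]; rfl
    exact this hv
  | succ i ih =>
    have e := opTheta_hi (μ := μ) (n := n) ⟨i, by omega⟩
    change opTheta ⟨i + 1, h⟩ = _ at e
    rw [Hecke.thetaAux, map_smul, map_mul, map_mul, map_heckeInv, heckeRep_T, e]
    simp only [LinearMap.smul_apply, Module.End.mul_apply]
    rw [ih (by omega) (heckeInv_opT_mem_stdSpan _ hv)]
    rfl

theorem stdVec_mem (S : SYT n μ) : stdVec S ∈ stdSpan n μ := Submodule.subset_span ⟨S, rfl⟩

theorem hecke_theta_stdVec (S : SYT n μ) (i : Fin n) :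
    Hecke.theta i • stdVec S = t ^ S.toPSYT.c i • stdVec S := by
  rw [hecke_smul_def, Hecke.theta, heckeRep_theta i.1 i.2 (stdVec_mem S), stdVec_eq, opTheta_vec]
  congr 1
  simp only [keyWeight, key, boxKey, pow_zero, one_mul]
  rfl

theorem hecke_T_stdVec (S : SYT n μ) (i : Fin (n - 1)) :
    Hecke.T i • stdVec S = opT i (stdVec S) := by
  rw [hecke_smul_def, heckeRep_T]

theorem opT_vec_of_ascends {L : Box μ ≃ Fin n} {w : Box μ → ℕ} (h : Increasing L w)
    {i : Fin (n - 1)} (ha : Ascends (key L w (lo i)) (key L w (hi i))) :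
    vec (L.trans (adj i)) w =
      opT i (vec L w) - diagCoeff (key L w (lo i)) (key L w (hi i)) • vec L w := by
  rw [opT_vec h, swapCoeff_of_ascends ha, one_smul, add_sub_cancel_left]

theorem phi_aux {R M : Type*} [CommRing R] [AddCommGroup M] [Module R M] {f : M} {e : M}
    {t a x y : R} (h : a * (x - y) = (1 - t) * x) :
    (x • (f + (t - 1) • e)) - y • f = (x - y) • (f - a • e) := by
  linear_combination (norm := module) h • e

theorem hecke_phi_stdVec {S R : SYT n μ} {i : Fin (n - 1)} (h : SwapUp i S.toPSYT R.toPSYT) :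
    Hecke.phi i • stdVec S =
      (t ^ S.toPSYT.c (lo i) - t ^ S.toPSYT.c (hi i)) • stdVec R := by
  have hR : stdVec R = vec (S.label.trans (adj i)) (fun _ => 0) := by
    rw [stdVec_eq]; congr 1; exact Equiv.ext h.1.1
  have hk : ∀ j, t ^ S.toPSYT.c j = keyWeight (key S.label (fun _ => 0) j) := by
    intro j; simp only [keyWeight, key, boxKey, pow_zero, one_mul]; rfl
  have e1 : (t • heckeInv (opT i)) = (opT i : Module.End K (Semi n μ)) +
    algebraMap K _ (t - 1) := t_smul_heckeInv _
  have hm : ((opT i : Module.End K (Semi n μ)) + algebraMap K _ (t - 1)) (stdVec S) ∈ stdSpan n μ := by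
    rw [LinearMap.add_apply, Module.algebraMap_end_apply]
    exact add_mem (opT_mem_stdSpan i (stdVec_mem S)) (Submodule.smul_mem _ _ (stdVec_mem S))
  rw [hecke_smul_def, Hecke.phi, map_sub, map_mul, map_mul, map_smul, map_heckeInv, heckeRep_T, e1,
    LinearMap.sub_apply, Module.End.mul_apply, Module.End.mul_apply, Hecke.theta,
    heckeRep_theta _ _ hm, heckeRep_theta _ _ (stdVec_mem S), ← Module.End.mul_apply]
  have e2 := opT_mul_opTheta_hi (μ := μ) i
  have e3 : (opTheta ⟨(lo i).1, (lo i).2⟩ : Module.End K (Semi n μ)) = opTheta (lo i) := rfl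
  rw [← Module.End.mul_apply, e3, ← e2, hR, opT_vec_of_ascends S.increasing h.ascends,
    Module.End.mul_apply, Module.End.mul_apply, stdVec_eq, opTheta_vec, opTheta_vec, map_smul,
    map_smul, LinearMap.add_apply, Module.algebraMap_end_apply, hk, hk]
  exact phi_aux (diagCoeff_mul_sub (S.increasing.key_lo_ne i))

theorem hecke_T_row {S : SYT n μ} {i : Fin (n - 1)}
    (h : (S.label.symm (lo i)).1.1 = (S.label.symm (hi i)).1.1) :
    Hecke.T i • stdVec S = stdVec S := by
  have h1 := S.increasing.linked_of_row h (by simp [lo, hi]) rfl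
  have h2 : (key S.label (fun _ => 0) (hi i)).2 - (key S.label (fun _ => 0) (lo i)).2 = 1 := by
    simp only [key, boxKey, content]; omega
  have h3 : (key S.label (fun _ => 0) (lo i)).1 = (key S.label (fun _ => 0) (hi i)).1 := rfl
  rw [hecke_T_stdVec, stdVec_eq, opT_vec S.increasing, diagCoeff_of_succ h3 h2,
    swapCoeff_of_linked ⟨h3, Or.inr h2⟩, one_smul, zero_smul, add_zero]

theorem hecke_T_col {S : SYT n μ} {i : Fin (n - 1)}
    (h : (S.label.symm (lo i)).1.2 = (S.label.symm (hi i)).1.2) :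
    Hecke.T i • stdVec S = -(t • stdVec S) := by
  have h1 := S.increasing.linked_of_col h (by simp [lo, hi]) rfl
  have h2 : (key S.label (fun _ => 0) (lo i)).2 - (key S.label (fun _ => 0) (hi i)).2 = 1 := by
    simp only [key, boxKey, content]; omega
  have h3 : (key S.label (fun _ => 0) (lo i)).1 = (key S.label (fun _ => 0) (hi i)).1 := rfl
  rw [hecke_T_stdVec, stdVec_eq, opT_vec S.increasing, diagCoeff_of_pred h3 h2,
    swapCoeff_of_linked ⟨h3, Or.inl h2⟩, neg_smul, zero_smul, add_zero]

/-- The map from the Specht module to the seminormal module. -/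
def spechtMap (n : ℕ) (μ : YoungDiagram) : Specht n μ →ₗ[Hecke n] Semi n μ :=
  Submodule.liftQ _ (Finsupp.linearCombination (Hecke n) stdVec) (by
    refine Submodule.span_le.2 ?_
    intro v hv
    have hg : ∀ S : SYT n μ, Finsupp.linearCombination (Hecke n) stdVec (gen S) = stdVec S :=
      fun S => by rw [gen, Finsupp.linearCombination_single, one_smul]
    have hs : ∀ (a : K) (v : SYT n μ →₀ Hecke n),
        Finsupp.linearCombination (Hecke n) stdVec (a • v) =
          a • Finsupp.linearCombination (Hecke n) (stdVec (μ := μ)) v := fun a v =>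
      LinearMap.map_smul_of_tower _ a v
    rw [SetLike.mem_coe, LinearMap.mem_ker]
    induction hv with
    | weight S i => rw [map_sub, map_smul, hs, hg, hecke_theta_stdVec, sub_self]
    | inter S R i h => rw [map_sub, map_smul, hs, hg, hg, hecke_phi_stdVec h, sub_self]
    | row S i h => rw [map_sub, map_smul, hg, hecke_T_row h, sub_self]
    | col S i h => rw [map_add, map_smul, hs, hg, hecke_T_col h, neg_add_cancel])

theorem spechtMap_of (S : SYT n μ) : spechtMap n μ (Specht.of S) = stdVec S := by
  rw [spechtMap, Specht.of]
  erw [Submodule.liftQ_apply]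
  rw [gen, Finsupp.linearCombination_single, one_smul]

/-! ### The induced module and the seminormal module -/

/-- Needed for the balancing relations of the induced module, because θ̄_i agrees with θ_i only on
the span of the standard tableaux. -/
theorem spechtMap_mem (v : Specht n μ) : spechtMap n μ v ∈ stdSpan n μ := by
  obtain ⟨f, rfl⟩ := Submodule.Quotient.mk_surjective _ v
  induction f using Finsupp.induction_linear with
  | zero => rw [Submodule.Quotient.mk_zero, map_zero]; exact zero_mem _
  | add f g hf hg => rw [Submodule.Quotient.mk_add, map_add]; exact add_mem hf hg
  | single S a =>
    have : (Finsupp.single S a : SYT n μ →₀ Hecke n) = a • gen S := by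
      rw [gen, Finsupp.smul_single, smul_eq_mul, mul_one]
    rw [this, Submodule.Quotient.mk_smul, map_smul]
    change a • spechtMap n μ (Specht.of S) ∈ _
    rw [spechtMap_of]
    clear this
    obtain ⟨b, rfl⟩ := RingQuot.mkAlgHom_surjective K (HeckeRel n) a
    have key : ∀ v ∈ stdSpan n μ, (Hecke.mk n b) • v ∈ stdSpan n μ := by
      induction b using FreeAlgebra.induction with
      | grade0 r =>
        intro v hv
        rw [AlgHom.commutes, hecke_smul_def, AlgHom.commutes, Module.algebraMap_end_apply]
        exact Submodule.smul_mem _ _ hv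
      | grade1 i =>
        intro v hv
        change Hecke.T i • v ∈ _
        rw [hecke_smul_def, heckeRep_T]
        exact opT_mem_stdSpan i hv
      | mul a b ha hb => intro v hv; rw [map_mul, mul_smul]; exact ha _ (hb _ hv)
      | add a b ha hb => intro v hv; rw [map_add, add_smul]; exact add_mem (ha _ hv) (hb _ hv)
    exact key _ (stdVec_mem S)

/-- The map from the induced module to the seminormal module. -/
def vMap (n : ℕ) (μ : YoungDiagram) : V n μ →ₗ[Daha n] Semi n μ :=
  Submodule.liftQ _ (TensorProduct.AlgebraTensorModule.lift
    (LinearMap.toSpanSingleton (Daha n) _ ((spechtMap n μ).restrictScalars K))) (by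
    refine Submodule.span_le.2 ?_
    intro v hv
    rw [SetLike.mem_coe, LinearMap.mem_ker]
    induction hv with
    | T i v =>
      simp only [map_sub, TensorProduct.AlgebraTensorModule.lift_tmul,
        LinearMap.toSpanSingleton_apply, LinearMap.smul_apply, one_smul,
        LinearMap.restrictScalars_apply, map_smul]
      rw [daha_smul_def, hecke_smul_def, rep_T, heckeRep_T, sub_self]
    | theta i v =>
      simp only [map_sub, TensorProduct.AlgebraTensorModule.lift_tmul,
        LinearMap.toSpanSingleton_apply, LinearMap.smul_apply, one_smul,
        LinearMap.restrictScalars_apply, map_smul]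
      rw [daha_smul_def, hecke_smul_def, rep_theta, Hecke.theta,
        heckeRep_theta _ _ (spechtMap_mem v)]
      exact sub_self _)

theorem vMap_tmul (d : Daha n) (v : Specht n μ) :
    vMap n μ (V.tmul d v) = d • spechtMap n μ v := rfl

end VVMac
end

noncomputable section
namespace VVMac

variable {n : ℕ} {μ : YoungDiagram}

/-! ### Relations in the double affine Hecke algebra -/

namespace Daha

theorem mk_rel {a b : FreeAlgebra K (DGen n)} (h : DahaRel n a b) : Daha.mk n a = Daha.mk n b :=
  RingQuot.mkAlgHom_rel K h

theorem quad (i : Fin (n - 1)) :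
    (Daha.T i - 1) * (Daha.T i + algebraMap K (Daha n) t) = 0 := by
  have := mk_rel (DahaRel.quad i)
  simp only [map_mul, map_sub, map_add, map_one, AlgHom.commutes, map_zero] at this
  exact this

theorem T_mul_inv (i : Fin (n - 1)) : Daha.T i * heckeInv (Daha.T i) = 1 :=
  (heckeInv_spec _ (quad i)).1

theorem inv_mul_T (i : Fin (n - 1)) : heckeInv (Daha.T i) * Daha.T i = 1 :=
  (heckeInv_spec _ (quad i)).2

theorem theta_succ (i : Fin (n - 1)) : Daha.theta (hi i) =
    t • (heckeInv (Daha.T i) * Daha.theta (lo i) * heckeInv (Daha.T i)) := by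
  have := mk_rel (DahaRel.theta_succ i)
  simp only [map_mul, map_smul, map_heckeInv] at this
  exact this

theorem X_succ (i : Fin (n - 1)) : Daha.X (hi i) =
    t • (heckeInv (Daha.T i) * Daha.X (lo i) * heckeInv (Daha.T i)) := by
  have := mk_rel (DahaRel.X_succ i)
  simp only [map_mul, map_smul, map_heckeInv] at this
  exact this

theorem X_comm (i j : Fin n) : Daha.X i * Daha.X j = Daha.X j * Daha.X i := by
  have := mk_rel (DahaRel.X_comm i j)
  simp only [map_mul] at this
  exact this

theorem T_X (i : Fin (n - 1)) (j : Fin n) (h : j ≠ lo i) (h' : j ≠ hi i) :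
    Daha.T i * Daha.X j = Daha.X j * Daha.T i := by
  have := mk_rel (DahaRel.T_X i j h h')
  simp only [map_mul] at this
  exact this

theorem pi_X (hn : 0 < n) (i : Fin (n - 1)) :
    Daha.pi hn * Daha.X (lo i) = Daha.X (hi i) * Daha.pi hn := by
  have := mk_rel (DahaRel.pi_X hn i)
  simp only [map_mul] at this
  exact this

theorem pi_X_last (hn : 0 < n) : Daha.pi hn * Daha.X ⟨n - 1, Nat.sub_lt hn Nat.one_pos⟩ =
    q • (Daha.X ⟨0, hn⟩ * Daha.pi hn) := by
  have := mk_rel (DahaRel.pi_X_last hn)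
  simp only [map_mul, map_smul] at this
  exact this

theorem X_hi_mul_T (i : Fin (n - 1)) : Daha.X (hi i) * Daha.T i =
    (Daha.T i + algebraMap K (Daha n) (t - 1)) * Daha.X (lo i) := by
  rw [X_succ, smul_mul_assoc, mul_assoc, inv_mul_T, mul_one, ← smul_mul_assoc, t_smul_heckeInv]

theorem T_mul_X_hi (i : Fin (n - 1)) : Daha.T i * Daha.X (hi i) =
    Daha.X (lo i) * (Daha.T i + algebraMap K (Daha n) (t - 1)) := by
  rw [X_succ, mul_smul_comm, ← mul_assoc, ← mul_assoc, T_mul_inv, one_mul, ← mul_smul_comm,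
    t_smul_heckeInv]

theorem T_mul_X_lo (i : Fin (n - 1)) : Daha.T i * Daha.X (lo i) =
    Daha.X (hi i) * Daha.T i - (t - 1) • Daha.X (lo i) := by
  rw [X_hi_mul_T, add_mul, Algebra.smul_def, add_sub_cancel_right]

/-- The generators `T_i`, indexed by `ℕ`. -/
def natT (n : ℕ) (i : ℕ) : Daha n := if h : i < n - 1 then Daha.T ⟨i, h⟩ else 0

theorem natT_val (i : Fin (n - 1)) : natT n i = Daha.T i := dif_pos i.2

theorem pi_eq (hn : 0 < n) :
    Daha.pi hn = t ^ (n - 1) • (Daha.theta ⟨0, hn⟩ * invProd (natT n) (n - 1)) := by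
  rw [Daha.pi, wPi, map_smul, map_mul, map_list_prod, List.map_ofFn, ← prod_ofFn_heckeInv]
  congr 4
  ext1 i
  rw [Function.comp_apply, map_heckeInv, natT_val]; rfl

theorem invProd_mul_descProd {k : ℕ} (h : k < n) :
    invProd (natT n) k * descProd (natT n) k = 1 := by
  induction k with
  | zero => simp [invProd, descProd]
  | succ k ih =>
    have := inv_mul_T (n := n) ⟨k, by omega⟩
    rw [← natT_val] at this
    rw [invProd, descProd, mul_assoc, ← mul_assoc (heckeInv _), this, one_mul, ih (by omega)]

theorem theta_zero_eq (hn : 0 < n) :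
    Daha.theta ⟨0, hn⟩ = (t ^ (n - 1))⁻¹ • (Daha.pi hn * descProd (natT n) (n - 1)) := by
  rw [pi_eq, smul_mul_assoc, mul_assoc, invProd_mul_descProd (by omega), mul_one, smul_smul,
    inv_mul_cancel₀ (pow_ne_zero _ t_ne_zero), one_smul]

theorem heckeInv_mem {R : Type} [Ring R] [Algebra K R] {C : Subalgebra K R} {x : R} (h : x ∈ C) :
    heckeInv x ∈ C :=
  C.smul_mem (C.add_mem h (C.algebraMap_mem _)) _

theorem natT_mem {C : Subalgebra K (Daha n)} (h : ∀ i, Daha.T i ∈ C) (i : ℕ) : natT n i ∈ C := by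
  unfold natT
  split_ifs
  · exact h _
  · exact C.zero_mem

theorem invProd_mem {C : Subalgebra K (Daha n)} (h : ∀ i, Daha.T i ∈ C) (k : ℕ) :
    invProd (natT n) k ∈ C := by
  induction k with
  | zero => exact C.one_mem
  | succ k ih => exact C.mul_mem ih (heckeInv_mem (natT_mem h k))

theorem descProd_mem {C : Subalgebra K (Daha n)} (h : ∀ i, Daha.T i ∈ C) (k : ℕ) :
    descProd (natT n) k ∈ C := by
  induction k with
  | zero => exact C.one_mem
  | succ k ih => exact C.mul_mem (natT_mem h k) ih

theorem pi_mem {C : Subalgebra K (Daha n)} (h : ∀ i, Daha.T i ∈ C) (h' : ∀ i, Daha.theta i ∈ C)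
    (hn : 0 < n) : Daha.pi hn ∈ C := by
  rw [pi_eq]; exact C.smul_mem (C.mul_mem (h' _) (invProd_mem h _)) _

/-- The θ_i are superfluous as generators, since θ_1 = t^{1-n} π T_{n-1} ⋯ T_1. Unlike the θ_i, π
has simple relations with the X_j. -/
theorem subalgebra_eq_top {C : Subalgebra K (Daha n)} (hT : ∀ i, Daha.T i ∈ C)
    (hX : ∀ i, Daha.X i ∈ C) (hpi : ∀ hn : 0 < n, Daha.pi hn ∈ C) (d : Daha n) : d ∈ C := by
  have hθ : ∀ k (h : k < n), Daha.theta ⟨k, h⟩ ∈ C := by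
    intro k
    induction k with
    | zero =>
      intro h
      rw [theta_zero_eq]
      exact C.smul_mem (C.mul_mem (hpi _) (descProd_mem hT _)) _
    | succ k ih =>
      intro h
      have e := theta_succ (n := n) ⟨k, by omega⟩
      change Daha.theta ⟨k + 1, h⟩ = _ at e
      rw [e]
      exact C.smul_mem (C.mul_mem (C.mul_mem (heckeInv_mem (hT _)) (ih (by omega)))
        (heckeInv_mem (hT _))) _
  obtain ⟨a, rfl⟩ := RingQuot.mkAlgHom_surjective K (DahaRel n) d
  change Daha.mk n a ∈ C
  induction a using FreeAlgebra.induction with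
  | grade0 r => rw [AlgHom.commutes]; exact C.algebraMap_mem r
  | grade1 g =>
    cases g with
    | T i => exact hT i
    | theta i => exact hθ i.1 i.2
    | X i => exact hX i
  | mul a b ha hb => rw [map_mul]; exact C.mul_mem ha hb
  | add a b ha hb => rw [map_add]; exact C.add_mem ha hb

end Daha

/-- The elements of an algebra that preserve a subspace. -/
def stabilizerAlgebra (A : Type) [Ring A] [Algebra K A] {M : Type} [AddCommGroup M] [Module K M]
    [Module A M] [IsScalarTower K A M] (U : Submodule K M) : Subalgebra K A where
  carrier := {d | ∀ x ∈ U, d • x ∈ U}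
  mul_mem' {a b} ha hb x hx := by rw [mul_smul]; exact ha _ (hb _ hx)
  add_mem' {a b} ha hb x hx := by rw [add_smul]; exact U.add_mem (ha _ hx) (hb _ hx)
  algebraMap_mem' r x hx := by rw [algebraMap_smul]; exact U.smul_mem r hx

/-! ### The Specht module is spanned by the standard tableaux -/

namespace Hecke

theorem quad (i : Fin (n - 1)) :
    (Hecke.T i - 1) * (Hecke.T i + algebraMap K (Hecke n) t) = 0 := by
  have : Hecke.mk n _ = Hecke.mk n _ := RingQuot.mkAlgHom_rel K (HeckeRel.quad (n := n) i)
  simp only [map_mul, map_sub, map_add, map_one, AlgHom.commutes, map_zero] at this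
  exact this

theorem T_mul_theta_hi (i : Fin (n - 1)) : Hecke.T i * Hecke.theta (hi i) =
    Hecke.theta (lo i) * (t • heckeInv (Hecke.T i)) := by
  have e : Hecke.theta (hi i) =
    t • (heckeInv (Hecke.T i) * Hecke.theta (lo i) * heckeInv (Hecke.T i)) := rfl
  rw [e, mul_smul_comm, ← mul_assoc, ← mul_assoc, (heckeInv_spec _ (quad i)).1, one_mul,
    mul_smul_comm]

theorem phi_eq (i : Fin (n - 1)) : Hecke.phi i =
    (Hecke.T i + algebraMap K _ (t - 1)) * Hecke.theta (lo i) -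
      Hecke.T i * Hecke.theta (hi i) := by
  rw [T_mul_theta_hi, phi, t_smul_heckeInv]

theorem T_mul_T (i : Fin (n - 1)) :
    Hecke.T i * Hecke.T i = (1 - t) • Hecke.T i + algebraMap K (Hecke n) t := by
  have h := quad (n := n) i
  rw [Algebra.smul_def, map_sub, map_one, ← sub_eq_zero, ← h]
  have := Algebra.commutes t (Hecke.T i)
  simp only [sub_mul, mul_add, one_mul, this]
  abel

end Hecke

namespace Specht

theorem mk_rel {v : SYT n μ →₀ Hecke n} (h : SpechtRel n μ v) :
    (Submodule.Quotient.mk v : Specht n μ) = 0 :=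
  (Submodule.Quotient.mk_eq_zero _).2 (Submodule.subset_span h)

theorem theta_of (S : SYT n μ) (i : Fin n) :
    Hecke.theta i • Specht.of S = t ^ S.toPSYT.c i • Specht.of S :=
  sub_eq_zero.1 (mk_rel (SpechtRel.weight S i))

theorem phi_of {S R : SYT n μ} {i : Fin (n - 1)} (h : SwapUp i S.toPSYT R.toPSYT) :
    Hecke.phi i • Specht.of S =
      (t ^ S.toPSYT.c (lo i) - t ^ S.toPSYT.c (hi i)) • Specht.of R :=
  sub_eq_zero.1 (mk_rel (SpechtRel.inter S R i h))

theorem T_of_row {S : SYT n μ} {i : Fin (n - 1)}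
    (h : (S.label.symm (lo i)).1.1 = (S.label.symm (hi i)).1.1) :
    Hecke.T i • Specht.of S = Specht.of S :=
  sub_eq_zero.1 (mk_rel (SpechtRel.row S i h))

theorem T_of_col {S : SYT n μ} {i : Fin (n - 1)}
    (h : (S.label.symm (lo i)).1.2 = (S.label.symm (hi i)).1.2) :
    Hecke.T i • Specht.of S = -(t • Specht.of S) :=
  eq_neg_of_add_eq_zero_left (mk_rel (SpechtRel.col S i h))

theorem solve_aux {R M : Type*} [Field R] [AddCommGroup M] [Module R M] {f e e' : M}
    {t x y : R} (h : x ≠ y) (h' : (x • (f + (t - 1) • e)) - y • f = (x - y) • e') :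
    f = ((1 - t) * x / (x - y)) • e + e' := by
  have hxy : x - y ≠ 0 := sub_ne_zero.2 h
  apply smul_right_injective M hxy
  have e1 : (x - y) * ((1 - t) * x / (x - y)) = (1 - t) * x := mul_div_cancel₀ _ hxy
  simp only [smul_add, smul_smul, e1]
  rw [← h']
  module

/-- Expressing φ̄_i through T_i, θ̄_i and θ̄_{i+1} turns the intertwining relation into a linear
equation for T_i S, solvable because the two weights differ. -/
theorem T_of_up {S R : SYT n μ} {i : Fin (n - 1)} (h : SwapUp i S.toPSYT R.toPSYT) :
    Hecke.T i • Specht.of S =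
      diagCoeff (key S.label (fun _ => 0) (lo i)) (key S.label (fun _ => 0) (hi i)) •
        Specht.of S + Specht.of R := by
  have hk : ∀ j, t ^ S.toPSYT.c j = keyWeight (key S.label (fun _ => 0) j) := by
    intro j; simp only [keyWeight, key, boxKey, pow_zero, one_mul]; rfl
  have h1 := phi_of h
  rw [Hecke.phi_eq, sub_smul, mul_smul, mul_smul, theta_of, theta_of, smul_comm (Hecke.T i),
    smul_comm _ (t ^ S.toPSYT.c (lo i)), add_smul, algebraMap_smul, hk, hk] at h1
  exact solve_aux (fun e => S.increasing.key_lo_ne i (keyWeight_injective e)) h1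

theorem T_of_mem_span (S : SYT n μ) (i : Fin (n - 1)) :
    Hecke.T i • Specht.of S ∈ Submodule.span K (Set.range (Specht.of (n := n) (μ := μ))) := by
  have hof : ∀ R : SYT n μ, Specht.of R ∈ Submodule.span K (Set.range (Specht.of (μ := μ))) :=
    fun R => Submodule.subset_span ⟨R, rfl⟩
  have hup : ∀ {R R' : SYT n μ}, SwapUp i R.toPSYT R'.toPSYT →
      Hecke.T i • Specht.of R ∈ Submodule.span K (Set.range (Specht.of (μ := μ))) := by
    intro R R' h
    rw [T_of_up h]
    exact add_mem (Submodule.smul_mem _ _ (hof R)) (hof R')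
  rcases linked_or_ascends (S.increasing.key_lo_ne i) with h | h | h
  · rcases S.increasing.of_linked h with h' | h'
    · rw [T_of_row h']; exact hof S
    · rw [T_of_col h']; exact neg_mem (Submodule.smul_mem _ _ (hof S))
  · exact hup (R' := (S.increasing.trans_adj h.not_linked).toPSYT.toSYT fun _ => rfl)
      (swapUp_of_ascends S.toPSYT h)
  · have hl : ¬ Linked (key S.label (fun _ => 0) (lo i)) (key S.label (fun _ => 0) (hi i)) :=
      fun hl => h.not_linked hl.symm
    let R := (S.increasing.trans_adj hl).toPSYT.toSYT fun _ => rfl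
    have hR : SwapUp i R.toPSYT S.toPSYT := by
      refine ⟨⟨fun x => ?_, fun _ => rfl⟩, ?_⟩
      · change S.label x = adj i (adj i (S.label x)); simp
      · have e : R.toPSYT.label = S.label.trans (adj i) := rfl
        refine Or.inr ⟨rfl, ?_⟩
        simpa [PSYT.c, e, Ascends, key, boxKey] using h
    -- If the swap goes down, S is written through the lower tableau R; the quadratic relation then
    -- reduces T_i S to T_i R and R.
    have h1 : Specht.of S = Hecke.T i • Specht.of R -
        diagCoeff (key R.label (fun _ => 0) (lo i)) (key R.label (fun _ => 0) (hi i)) •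
          Specht.of R := by
      rw [T_of_up hR, add_sub_cancel_left]
    rw [h1, smul_sub, smul_smul, Hecke.T_mul_T, add_smul, smul_assoc, algebraMap_smul,
      smul_comm (Hecke.T i)]
    exact sub_mem (add_mem (Submodule.smul_mem _ _ (hup hR)) (Submodule.smul_mem _ _ (hof R)))
      (Submodule.smul_mem _ _ (hup hR))

theorem span_of : Submodule.span K (Set.range (Specht.of (n := n) (μ := μ))) = ⊤ := by
  rw [eq_top_iff]
  rintro v -
  obtain ⟨f, rfl⟩ := Submodule.Quotient.mk_surjective _ v
  have hT : ∀ i, Hecke.T i ∈ stabilizerAlgebra (Hecke n)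
      (Submodule.span K (Set.range (Specht.of (n := n) (μ := μ)))) := by
    intro i x hx
    induction hx using Submodule.span_induction with
    | mem x h => obtain ⟨S, rfl⟩ := h; exact T_of_mem_span S i
    | zero => rw [smul_zero]; exact zero_mem _
    | add x y _ _ hx hy => rw [smul_add]; exact add_mem hx hy
    | smul a x _ hx => rw [smul_comm]; exact Submodule.smul_mem _ _ hx
  have hall : ∀ a, a ∈ stabilizerAlgebra (Hecke n)
      (Submodule.span K (Set.range (Specht.of (n := n) (μ := μ)))) := by
    intro a
    obtain ⟨b, rfl⟩ := RingQuot.mkAlgHom_surjective K (HeckeRel n) a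
    change Hecke.mk n b ∈ _
    induction b using FreeAlgebra.induction with
    | grade0 r => rw [AlgHom.commutes]; exact Subalgebra.algebraMap_mem _ r
    | grade1 i => exact hT i
    | mul a b ha hb => rw [map_mul]; exact Subalgebra.mul_mem _ ha hb
    | add a b ha hb => rw [map_add]; exact Subalgebra.add_mem _ ha hb
  induction f using Finsupp.induction_linear with
  | zero => exact zero_mem _
  | add f g hf hg => rw [Submodule.Quotient.mk_add]; exact add_mem hf hg
  | single S a =>
    have : (Finsupp.single S a : SYT n μ →₀ Hecke n) = a • gen S := by
      rw [gen, Finsupp.smul_single, smul_eq_mul, mul_one]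
    rw [this, Submodule.Quotient.mk_smul]
    exact hall a _ (Submodule.subset_span ⟨S, rfl⟩)

end Specht

/-! ### The induced module is spanned by the products of monomials and standard tableaux -/

namespace V

theorem smul_tmul (d d' : Daha n) (v : Specht n μ) :
    d • V.tmul d' v = V.tmul (d * d') v := rfl

theorem tmul_add (d : Daha n) (v w : Specht n μ) :
    V.tmul d (v + w) = V.tmul d v + V.tmul d w := by
  rw [tmul, TensorProduct.tmul_add, Submodule.Quotient.mk_add]; rfl

theorem tmul_smul (d : Daha n) (a : K) (v : Specht n μ) :
    V.tmul d (a • v) = a • V.tmul d v := by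
  rw [tmul, TensorProduct.tmul_smul, Submodule.Quotient.mk_smul]; rfl

theorem T_tmul (i : Fin (n - 1)) (v : Specht n μ) :
    Daha.T i • V.tmul 1 v = V.tmul 1 (Hecke.T i • v) := by
  rw [smul_tmul, mul_one]
  exact (Submodule.Quotient.eq _).2 (Submodule.subset_span (IndRel.T i v))

theorem theta_tmul (i : Fin n) (v : Specht n μ) :
    Daha.theta i • V.tmul 1 v = V.tmul 1 (Hecke.theta i • v) := by
  rw [smul_tmul, mul_one]
  exact (Submodule.Quotient.eq _).2 (Submodule.subset_span (IndRel.theta i v))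

/-- The map `v ↦ 1 ⊗ v`. -/
def ofSpecht (n : ℕ) (μ : YoungDiagram) : Specht n μ →ₗ[K] V n μ where
  toFun := V.tmul 1
  map_add' := tmul_add 1
  map_smul' := tmul_smul 1

/-- Vectors obtained from `1 ⊗ v` by multiplication with the `X_j`. -/
inductive Reached : V n μ → Prop
  | base (v : Specht n μ) : Reached (V.tmul 1 v)
  | X (j : Fin n) (x : V n μ) : Reached x → Reached (Daha.X j • x)

theorem X_smul_mem_span (j : Fin n) {x : V n μ}
    (hx : x ∈ Submodule.span K {x : V n μ | Reached x}) :
    Daha.X j • x ∈ Submodule.span K {x : V n μ | Reached x} := by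
  induction hx using Submodule.span_induction with
  | mem x h => exact Submodule.subset_span (Reached.X j x h)
  | zero => rw [smul_zero]; exact zero_mem _
  | add x y _ _ hx hy => rw [smul_add]; exact add_mem hx hy
  | smul a x _ hx => rw [smul_comm]; exact Submodule.smul_mem _ _ hx

theorem mem_stabilizer_of_reached {d : Daha n}
    (h : ∀ x : V n μ, Reached x → d • x ∈ Submodule.span K {x : V n μ | Reached x}) :
    d ∈ stabilizerAlgebra (Daha n) (Submodule.span K {x : V n μ | Reached x}) := by
  intro x hx
  induction hx using Submodule.span_induction with
  | mem x hx => exact h x hx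
  | zero => rw [smul_zero]; exact zero_mem _
  | add x y _ _ hx hy => rw [smul_add]; exact add_mem hx hy
  | smul a x _ hx => rw [smul_comm]; exact Submodule.smul_mem _ _ hx

/-- Moving T_i past X_j leaves only terms X_k T_i x and X_k x, so induction on the number of factors
X applies. -/
theorem T_mem_stabilizer (i : Fin (n - 1)) :
    Daha.T i ∈ stabilizerAlgebra (Daha n) (Submodule.span K {x : V n μ | Reached x}) := by
  refine mem_stabilizer_of_reached fun x hx => ?_
  induction hx with
  | base v => rw [T_tmul]; exact Submodule.subset_span (Reached.base _)
  | X j x hx ih =>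
    have hx' : x ∈ Submodule.span K {x : V n μ | Reached x} := Submodule.subset_span hx
    rw [← mul_smul]
    by_cases h1 : j = lo i
    · subst h1
      rw [Daha.T_mul_X_lo, sub_smul, mul_smul, smul_assoc]
      exact sub_mem (X_smul_mem_span _ ih) (Submodule.smul_mem _ _ (X_smul_mem_span _ hx'))
    by_cases h2 : j = hi i
    · subst h2
      rw [Daha.T_mul_X_hi, mul_smul, add_smul, algebraMap_smul]
      exact X_smul_mem_span _ (add_mem ih (Submodule.smul_mem _ _ hx'))
    rw [Daha.T_X i j h1 h2, mul_smul]
    exact X_smul_mem_span _ ih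

theorem eq_last_or_eq_lo (hn : 0 < n) (j : Fin n) :
    j = ⟨n - 1, Nat.sub_lt hn Nat.one_pos⟩ ∨ ∃ i : Fin (n - 1), j = lo i := by
  by_cases h : j.1 = n - 1
  · exact Or.inl (Fin.ext h)
  · exact Or.inr ⟨⟨j.1, by omega⟩, rfl⟩

/-- π moves past every X_j at the cost of a cyclic shift and perhaps a factor q, until it meets 1 ⊗
v; there it acts through the affine algebra and stays in 1 ⊗ μ. -/
theorem pi_mem_stabilizer (hn : 0 < n) :
    Daha.pi hn ∈ stabilizerAlgebra (Daha n) (Submodule.span K {x : V n μ | Reached x}) := by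
  refine mem_stabilizer_of_reached fun x hx => ?_
  induction hx with
  | base v =>
    have h := Daha.pi_mem (C := stabilizerAlgebra (Daha n) (LinearMap.range (ofSpecht n μ)))
      (by rintro i _ ⟨v, rfl⟩; exact ⟨_, (T_tmul i v).symm⟩)
      (by rintro i _ ⟨v, rfl⟩; exact ⟨_, (theta_tmul i v).symm⟩) hn
    obtain ⟨w, hw⟩ := h (V.tmul 1 v) ⟨v, rfl⟩
    rw [← hw]
    exact Submodule.subset_span (Reached.base w)
  | X j x hx ih =>
    rw [← mul_smul]
    rcases eq_last_or_eq_lo hn j with rfl | ⟨i, rfl⟩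
    · rw [Daha.pi_X_last, smul_assoc, mul_smul]
      exact Submodule.smul_mem _ _ (X_smul_mem_span _ ih)
    · rw [Daha.pi_X, mul_smul]
      exact X_smul_mem_span _ ih

theorem span_reached : Submodule.span K {x : V n μ | Reached x} = ⊤ := by
  rw [eq_top_iff]
  rintro x -
  obtain ⟨y, rfl⟩ := Submodule.Quotient.mk_surjective _ x
  induction y using TensorProduct.induction_on with
  | zero => exact zero_mem _
  | add x y hx hy => rw [Submodule.Quotient.mk_add]; exact add_mem hx hy
  | tmul d v =>
    have hd := Daha.subalgebra_eq_top
      (C := stabilizerAlgebra (Daha n) (Submodule.span K {x : V n μ | Reached x}))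
      T_mem_stabilizer (fun i x hx => X_smul_mem_span i hx) pi_mem_stabilizer d
    have := hd (V.tmul 1 v) (Submodule.subset_span (Reached.base v))
    rwa [smul_tmul, mul_one] at this

/-- Induction over the vectors of the induced module. -/
theorem induction_on {P : V n μ → Prop} (base : ∀ v, P (V.tmul 1 v))
    (X : ∀ (j : Fin n) x, P x → P (Daha.X j • x)) (add : ∀ x y, P x → P y → P (x + y))
    (smul : ∀ (a : K) x, P x → P (a • x)) (x : V n μ) : P x := by
  have hx : x ∈ Submodule.span K {x : V n μ | Reached x} := span_reached ▸ Submodule.mem_top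
  induction hx using Submodule.span_induction with
  | mem x h =>
    induction h with
    | base v => exact base v
    | X j x _ ih => exact X j x ih
  | zero => rw [← zero_smul K (V.tmul 1 0 : V n μ)]; exact smul _ _ (base _)
  | add x y _ _ hx hy => exact add x y hx hy
  | smul a x _ hx => exact smul a x hx

end V

theorem prod_ofFn_single {R : Type} [Ring R] {n : ℕ} (x : Fin n → R)
    (hx : ∀ i j, x i * x j = x j * x i) (α : Fin n → ℕ) (j : Fin n) :
    (List.ofFn fun i => x i ^ (α + Pi.single j 1 : Fin n → ℕ) i).prod =
      x j * (List.ofFn fun i => x i ^ α i).prod := by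
  induction n with
  | zero => exact j.elim0
  | succ n ih =>
    rw [List.ofFn_succ, List.prod_cons, List.ofFn_succ, List.prod_cons]
    induction j using Fin.cases with
    | zero => simp [pow_succ', mul_assoc]
    | succ j =>
      have h := ih (fun i => x i.succ) (fun i j => hx _ _) (fun i => α i.succ) j
      have e : (fun i : Fin n => x i.succ ^ (α + Pi.single j.succ 1 : Fin (n + 1) → ℕ) i.succ) =
          fun i => x i.succ ^ ((fun i => α i.succ) + Pi.single j 1 : Fin n → ℕ) i := by
        ext i; simp [Pi.single_apply]
      have hc : Commute (x 0 ^ α 0) (x j.succ) := Commute.pow_left (hx 0 j.succ) _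
      rw [e, h]
      simp [← mul_assoc, hc.eq]

theorem Daha.X_mul_Xpow (j : Fin n) (α : Fin n → ℕ) :
    Daha.X j * Daha.Xpow α = Daha.Xpow (α + Pi.single j 1) :=
  (prod_ofFn_single _ Daha.X_comm α j).symm

theorem Daha.Xpow_zero : Daha.Xpow (0 : Fin n → ℕ) = 1 := by
  simp [Daha.Xpow, List.ofFn_const]

/-- The vectors `X^α ⊗ S`. -/
def monomialVec (p : (Fin n → ℕ) × SYT n μ) : V n μ := V.tmul (Daha.Xpow p.1) (Specht.of p.2)

theorem X_smul_monomialVec (j : Fin n) (α : Fin n → ℕ) (S : SYT n μ) :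
    Daha.X j • monomialVec (α, S) = monomialVec (α + Pi.single j 1, S) := by
  rw [monomialVec, monomialVec, V.smul_tmul, Daha.X_mul_Xpow]

theorem span_monomialVec : Submodule.span K (Set.range (monomialVec (n := n) (μ := μ))) = ⊤ := by
  rw [eq_top_iff]
  rintro x -
  induction x using V.induction_on with
  | base v =>
    have hv : v ∈ Submodule.span K (Set.range (Specht.of (n := n) (μ := μ))) :=
      Specht.span_of ▸ Submodule.mem_top
    have := Submodule.mem_map_of_mem (f := V.ofSpecht n μ) hv
    rw [Submodule.map_span] at this
    refine Submodule.span_mono ?_ this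
    rintro _ ⟨_, ⟨S, rfl⟩, rfl⟩
    exact ⟨(0, S), by rw [monomialVec, Daha.Xpow_zero]; rfl⟩
  | X j x hx =>
    induction hx using Submodule.span_induction with
    | mem x h =>
      obtain ⟨⟨α, S⟩, rfl⟩ := h
      rw [X_smul_monomialVec]
      exact Submodule.subset_span ⟨_, rfl⟩
    | zero => rw [smul_zero]; exact zero_mem _
    | add x y _ _ hx hy => rw [smul_add]; exact add_mem hx hy
    | smul a x _ hx => rw [smul_comm]; exact Submodule.smul_mem _ _ hx
  | add x y hx hy => exact add_mem hx hy
  | smul a x hx => exact Submodule.smul_mem _ _ hx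

end VVMac
end

noncomputable section
namespace VVMac

variable {n : ℕ} {μ : YoungDiagram}

/-! ### Degrees -/

/-- The homogeneous vectors of degree `d`. -/
def homog (n : ℕ) (μ : YoungDiagram) (d : ℕ) : Submodule K (Semi n μ) :=
  Submodule.span K (semiBasis n μ '' {τ | τ.deg = d})

/-- The operator raises degrees by `k`. -/
def Shifts (k : ℕ) (f : Module.End K (Semi n μ)) : Prop :=
  ∀ d, ∀ v ∈ homog n μ d, f v ∈ homog n μ (d + k)

theorem vec_mem_homog (L : Box μ ≃ Fin n) (w : Box μ → ℕ) : vec L w ∈ homog n μ (∑ x, w x) := by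
  by_cases h : Increasing L w
  · rw [vec_of_increasing h]; exact Submodule.subset_span ⟨_, rfl, rfl⟩
  · rw [vec, dif_neg h]; exact zero_mem _

theorem Shifts.of_basis {k : ℕ} {f : Module.End K (Semi n μ)}
    (h : ∀ τ, f (semiBasis n μ τ) ∈ homog n μ (τ.deg + k)) : Shifts k f := by
  intro d v hv
  induction hv using Submodule.span_induction with
  | mem v hv => obtain ⟨τ, rfl, rfl⟩ := hv; exact h τ
  | zero => rw [map_zero]; exact zero_mem _
  | add x y _ _ hx hy => rw [map_add]; exact add_mem hx hy
  | smul a x _ hx => rw [map_smul]; exact Submodule.smul_mem _ _ hx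

theorem Shifts.mul {k l m : ℕ} {f g : Module.End K (Semi n μ)} (hf : Shifts k f)
    (hg : Shifts l g) (h : k + l = m) : Shifts m (f * g) := fun d v hv => by
  rw [Module.End.mul_apply, ← h, add_comm k l, ← add_assoc]
  exact hf _ _ (hg _ _ hv)

theorem Shifts.smul {k : ℕ} {f : Module.End K (Semi n μ)} (hf : Shifts k f) (a : K) :
    Shifts k (a • f) := fun d v hv => Submodule.smul_mem _ _ (hf d v hv)

theorem Shifts.add {k : ℕ} {f g : Module.End K (Semi n μ)} (hf : Shifts k f) (hg : Shifts k g) :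
    Shifts k (f + g) := fun d v hv => add_mem (hf d v hv) (hg d v hv)

theorem Shifts.one : Shifts 0 (1 : Module.End K (Semi n μ)) := fun _ _ hv => hv

theorem Shifts.zero (k : ℕ) : Shifts k (0 : Module.End K (Semi n μ)) := fun _ _ _ => zero_mem _

theorem Shifts.scalar (a : K) :
    Shifts 0 (algebraMap K (Module.End K (Semi n μ)) a) := fun _ _ hv =>
  Submodule.smul_mem _ _ hv

theorem Shifts.inverse {f : Module.End K (Semi n μ)} (hf : Shifts 0 f) :
    Shifts 0 (heckeInv f) := (hf.add (Shifts.scalar _)).smul _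

theorem shifts_natT (i : ℕ) : Shifts 0 (natT n μ i) := by
  unfold natT
  split_ifs with h
  · refine Shifts.of_basis fun τ => ?_
    rw [← vec_label, opT_vec τ.increasing]
    exact add_mem (Submodule.smul_mem _ _ (vec_mem_homog _ _))
      (Submodule.smul_mem _ _ (vec_mem_homog _ _))
  · exact Shifts.zero 0

theorem shifts_natTheta (i : ℕ) : Shifts 0 (natTheta n μ i) := by
  unfold natTheta
  split_ifs with h
  · refine Shifts.of_basis fun τ => ?_
    rw [← vec_label, opTheta_vec]
    exact Submodule.smul_mem _ _ (vec_mem_homog _ _)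
  · exact Shifts.zero 0

theorem opRaise_basis (hn : 0 < n) (τ : PSYT n μ) :
    opRaise hn (semiBasis n μ τ) = (q ^ τ.w ⟨0, hn⟩)⁻¹ • semiBasis n μ τ.psi := by
  rw [opRaise, Module.Basis.constr_basis]

theorem shifts_natRaise : Shifts 1 (natRaise n μ) := by
  unfold natRaise
  split_ifs with h
  · refine Shifts.of_basis fun τ => ?_
    rw [opRaise_basis, ← τ.isPsi_psi.deg h]
    exact Submodule.smul_mem _ _ (Submodule.subset_span ⟨_, rfl, rfl⟩)
  · exact Shifts.zero 1

theorem shifts_invProd (k : ℕ) : Shifts 0 (invProd (natT n μ) k) := by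
  induction k with
  | zero => exact Shifts.one
  | succ k ih => rw [invProd]; exact ih.mul (shifts_natT k).inverse rfl

theorem shifts_xDesc (k : ℕ) :
    Shifts 1 (xDesc n (natT n μ) (natTheta n μ) (natRaise n μ) k) := by
  induction k with
  | zero => rw [xDesc, piElt]; exact
      shifts_natRaise.mul (((shifts_natTheta 0).mul (shifts_invProd _) (add_zero 0)).smul _) rfl
  | succ k ih => rw [xDesc]; exact
      (((shifts_natT _).mul ih (zero_add 1)).mul (shifts_natT _) (add_zero 1)).smul _

theorem shifts_opX (i : ℕ) : Shifts 1 (opX n μ i) := shifts_xDesc _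

theorem Shifts.pow {f : Module.End K (Semi n μ)} (hf : Shifts 1 f) (k : ℕ) : Shifts k (f ^ k) := by
  induction k with
  | zero => rw [pow_zero]; exact Shifts.one
  | succ k ih => rw [pow_succ]; exact ih.mul hf rfl

theorem Shifts.prod_ofFn {m : ℕ} {k : Fin m → ℕ} {f : Fin m → Module.End K (Semi n μ)}
    (h : ∀ i, Shifts (k i) (f i)) : Shifts (∑ i, k i) (List.ofFn f).prod := by
  induction m with
  | zero => simpa using Shifts.one
  | succ m ih =>
    rw [List.ofFn_succ, List.prod_cons, Fin.sum_univ_succ]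
    exact (h 0).mul (ih fun i => h i.succ) rfl

theorem vMap_monomialVec (p : (Fin n → ℕ) × SYT n μ) :
    vMap n μ (monomialVec p) = rep n μ (Daha.Xpow p.1) (stdVec p.2) := by
  rw [monomialVec, vMap_tmul, spechtMap_of, daha_smul_def]

theorem vMap_monomialVec_mem (p : (Fin n → ℕ) × SYT n μ) :
    vMap n μ (monomialVec p) ∈ homog n μ (∑ i, p.1 i) := by
  rw [vMap_monomialVec, Daha.Xpow, map_list_prod, List.map_ofFn]
  have h := Shifts.prod_ofFn (μ := μ) (n := n) (k := p.1)
    (f := rep n μ ∘ fun i => Daha.X i ^ p.1 i) (fun i => by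
      rw [Function.comp_apply, map_pow, rep_X]; exact (shifts_opX _).pow _)
  have := h 0 (stdVec p.2) (Submodule.subset_span ⟨p.2.toPSYT, by simp [PSYT.deg, SYT.toPSYT], rfl⟩)
  rwa [zero_add] at this

/-! ### The induced module maps onto the seminormal module -/

theorem semiBasis_of_swapUp {τ σ : PSYT n μ} {i : Fin (n - 1)} (h : SwapUp i τ σ) :
    semiBasis n μ σ = opT i (semiBasis n μ τ) -
      diagCoeff (key τ.label τ.wt (lo i)) (key τ.label τ.wt (hi i)) • semiBasis n μ τ := by
  rw [← vec_label τ, ← opT_vec_of_ascends τ.increasing h.ascends, h.eq,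
    vec_of_increasing (τ.increasing.trans_adj h.ascends.not_linked)]

theorem opX_last (hn : 0 < n) : opX n μ (n - 1) = opRaise hn * opPi n μ := by
  rw [opX, xElt_last, natRaise_of_pos hn]; rfl

theorem semiBasis_of_isPsi (hn : 0 < n) {τ σ : PSYT n μ} (h : IsPsi τ σ) : semiBasis n μ σ =
    q ^ τ.w ⟨0, hn⟩ • opX n μ (n - 1) (opPiInv hn μ (semiBasis n μ τ)) := by
  rw [opX_last hn, Module.End.mul_apply, ← Module.End.mul_apply (opPi n μ), opPi_mul_inv,
    Module.End.one_apply, opRaise_basis, smul_smul, mul_inv_cancel₀ (pow_ne_zero _ q_ne_zero),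
    one_smul, h.eq]

/-- Induction along covers: the range contains the standard tableaux, and each further basis vector
is obtained from an earlier one by T_i or by X_n π⁻¹. -/
theorem vMap_surjective : Function.Surjective (vMap n μ) := by
  suffices h : ∀ τ, semiBasis n μ τ ∈ LinearMap.range (vMap n μ) by
    intro v
    have hv : v ∈ Submodule.span K (Set.range (semiBasis n μ)) :=
      (semiBasis n μ).span_eq ▸ Submodule.mem_top
    change v ∈ (LinearMap.range (vMap n μ)).restrictScalars K
    refine Submodule.span_le.2 ?_ hv
    rintro _ ⟨τ, rfl⟩
    exact h τ
  intro τ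
  induction τ using PSYT.induction_cover with
  | std S => exact ⟨V.tmul 1 (Specht.of S), by rw [vMap_tmul, spechtMap_of, one_smul]; rfl⟩
  | swap i τ σ h ih =>
    rw [semiBasis_of_swapUp h, ← rep_T, ← daha_smul_def]
    exact sub_mem (Submodule.smul_mem _ _ ih)
      (Submodule.smul_mem ((LinearMap.range (vMap n μ)).restrictScalars K) _ ih)
  | psi τ σ hn h ih =>
    -- π⁻¹ does not come from the algebra, but it is a product of the T_i and θ_1⁻¹ up to a scalar,
    -- and θ_1⁻¹ merely rescales the basis vector.
    have hd : ∀ k, descProd (natT n μ) k (semiBasis n μ τ) ∈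
        (LinearMap.range (vMap n μ)).restrictScalars K := by
      intro k
      induction k with
      | zero => exact ih
      | succ k ihk =>
        rw [descProd, Module.End.mul_apply, natT]
        split_ifs
        · rw [← rep_T, ← daha_smul_def]
          exact Submodule.smul_mem (LinearMap.range (vMap n μ)) _ ihk
        · exact zero_mem _
    have hp : opPiInv hn μ (semiBasis n μ τ) ∈
        (LinearMap.range (vMap n μ)).restrictScalars K := by
      rw [opPiInv, LinearMap.smul_apply, Module.End.mul_apply, ← vec_label, opThetaInv_vec,
        vec_label, map_smul]
      exact Submodule.smul_mem _ _ (Submodule.smul_mem _ _ (hd _))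
    rw [semiBasis_of_isPsi hn h, ← rep_X ⟨n - 1, Nat.sub_lt hn Nat.one_pos⟩, ← daha_smul_def]
    exact Submodule.smul_mem ((LinearMap.range (vMap n μ)).restrictScalars K) _
      (Submodule.smul_mem (LinearMap.range (vMap n μ)) _ hp)

/-! ### Counting -/

/-- The periodic tableau with prescribed exponents at the labels and prescribed standardization. -/
def destandardize (p : (Fin n → ℕ) × SYT n μ) : PSYT n μ :=
  Increasing.toPSYT (L := p.2.label.trans (Tuple.sort (OrderDual.toDual ∘ p.1)))
    (w := fun x => p.1 (Tuple.sort (OrderDual.toDual ∘ p.1) (p.2.label x))) (by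
    intro x y h
    obtain ⟨hm, hs⟩ := (Tuple.eq_sort_iff (f := OrderDual.toDual ∘ p.1)).1 rfl
    have hlt : p.2.label x < p.2.label y :=
      h.elim (fun h => p.2.row_lt x y h.1 h.2) (fun h => p.2.col_lt x y h.1 h.2)
    have hle : p.1 (Tuple.sort (OrderDual.toDual ∘ p.1) (p.2.label y)) ≤
        p.1 (Tuple.sort (OrderDual.toDual ∘ p.1) (p.2.label x)) := hm hlt.le
    rcases hle.lt_or_eq with h1 | h1
    · exact Or.inl h1
    · exact Or.inr ⟨h1.symm, hs _ _ hlt (congrArg OrderDual.toDual h1.symm)⟩)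

/-- The exponents at the labels recover α, hence the sorting permutation, hence S. Injectivity
suffices: it bounds the number of monomials by the number of tableaux, and surjectivity of `vMap`
gives the opposite bound on dimensions. -/
theorem destandardize_injective : Function.Injective (destandardize (n := n) (μ := μ)) := by
  rintro ⟨α, S⟩ ⟨β, R⟩ h
  have hw : ∀ (p : (Fin n → ℕ) × SYT n μ) (j : Fin n), (destandardize p).w j = p.1 j := by
    intro p j
    simp [destandardize, PSYT.w, Increasing.toPSYT]
  have h1 : α = β := by
    ext j
    exact (hw (α, S) j).symm.trans ((congrArg (PSYT.w · j) h).trans (hw (β, R) j))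
  subst h1
  have h2 := congrArg PSYT.label h
  simp only [destandardize, Increasing.toPSYT] at h2
  have h3 : S.label = R.label := by
    ext1 x
    exact (Tuple.sort (OrderDual.toDual ∘ α)).injective (DFunLike.congr_fun h2 x)
  rw [SYT.ext' h3]

theorem deg_destandardize (p : (Fin n → ℕ) × SYT n μ) : (destandardize p).deg = ∑ i, p.1 i := by
  rw [PSYT.deg, ← Equiv.sum_comp
    (p.2.label.trans (Tuple.sort (OrderDual.toDual ∘ p.1))) p.1]
  rfl

theorem finite_deg_le (D : ℕ) : Finite {τ : PSYT n μ // τ.deg ≤ D} := by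
  let f : {τ : PSYT n μ // τ.deg ≤ D} → (Box μ ≃ Fin n) × (Box μ → Fin (D + 1)) := fun τ =>
    (τ.1.label, fun x => ⟨τ.1.wt x, Nat.lt_succ_of_le
      ((Finset.single_le_sum (fun _ _ => Nat.zero_le _) (Finset.mem_univ x)).trans τ.2)⟩)
  refine Finite.of_injective f fun τ σ h => Subtype.ext (PSYT.ext' (congrArg Prod.fst h) ?_)
  ext x
  exact congrArg Fin.val (congrFun (congrArg Prod.snd h) x)

open scoped Classical in
/-- The projection to degrees at most `D`. -/
def truncate (n : ℕ) (μ : YoungDiagram) (D : ℕ) : Module.End K (Semi n μ) :=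
  (semiBasis n μ).constr K fun τ => if τ.deg ≤ D then semiBasis n μ τ else 0

theorem truncate_of_mem {d D : ℕ} {v : Semi n μ} (hv : v ∈ homog n μ d) :
    truncate n μ D v = if d ≤ D then v else 0 := by
  induction hv using Submodule.span_induction with
  | mem v h =>
    obtain ⟨τ, rfl, rfl⟩ := h
    rw [truncate, Module.Basis.constr_basis]
  | zero => rw [map_zero, ite_self]
  | add x y _ _ hx hy => rw [map_add, hx, hy]; split_ifs <;> simp
  | smul a x _ hx => rw [map_smul, hx]; split_ifs <;> simp

theorem span_vMap_monomialVec :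
    Submodule.span K (Set.range fun p => vMap n μ (monomialVec p)) = ⊤ := by
  have h : (Set.range fun p => vMap n μ (monomialVec p)) =
      ((vMap n μ).restrictScalars K) '' Set.range monomialVec := by
    rw [← Set.range_comp]; rfl
  rw [h, ← Submodule.map_span, span_monomialVec, Submodule.map_top, LinearMap.range_eq_top]
  exact vMap_surjective

/-- A spanning family with no more members than the dimension is independent. The infinite families
are compared after truncation to bounded degree, where both are finite. -/
theorem linearIndependent_vMap_monomialVec :
    LinearIndependent K fun p : (Fin n → ℕ) × SYT n μ => vMap n μ (monomialVec p) := by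
  rw [← linearIndepOn_univ_iff]
  refine linearIndepOn_of_finite _ fun s _ hs => ?_
  obtain ⟨D, hD⟩ : ∃ D, ∀ p ∈ s, ∑ i, p.1 i ≤ D := by
    obtain ⟨D, hD⟩ := (hs.image fun p : (Fin n → ℕ) × SYT n μ => ∑ i, p.1 i).bddAbove
    exact ⟨D, fun p hp => hD ⟨p, hp, rfl⟩⟩
  refine LinearIndepOn.mono (s := {p : (Fin n → ℕ) × SYT n μ | ∑ i, p.1 i ≤ D}) ?_ hD
  have := finite_deg_le (n := n) (μ := μ) D
  let j : {p : (Fin n → ℕ) × SYT n μ // ∑ i, p.1 i ≤ D} → {τ : PSYT n μ // τ.deg ≤ D} :=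
    fun p => ⟨destandardize p.1, (deg_destandardize p.1).trans_le p.2⟩
  have hj : Function.Injective j := fun p r h =>
    Subtype.ext (destandardize_injective (congrArg Subtype.val h))
  have hfin := Finite.of_injective j hj
  let _ := Fintype.ofFinite {τ : PSYT n μ // τ.deg ≤ D}
  let _ := Fintype.ofFinite {p : (Fin n → ℕ) × SYT n μ // ∑ i, p.1 i ≤ D}
  let c : {p : (Fin n → ℕ) × SYT n μ // ∑ i, p.1 i ≤ D} → Semi n μ :=
    fun p => vMap n μ (monomialVec p.1)
  let e : {τ : PSYT n μ // τ.deg ≤ D} → Semi n μ := fun τ => semiBasis n μ τ.1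
  change LinearIndependent K c
  have he : LinearIndependent K e :=
    (semiBasis n μ).linearIndependent.comp _ Subtype.val_injective
  -- Expand a basis vector of degree at most D in all monomials and truncate: the vector is
  -- unchanged, and each monomial either survives or vanishes, being homogeneous.
  have hspan : Submodule.span K (Set.range e) ≤ Submodule.span K (Set.range c) := by
    refine Submodule.span_le.2 ?_
    rintro _ ⟨τ, rfl⟩
    have h1 : semiBasis n μ τ.1 ∈ Submodule.span K (Set.range fun p => vMap n μ (monomialVec p)) :=
      span_vMap_monomialVec ▸ Submodule.mem_top
    have h2 := Submodule.mem_map_of_mem (f := truncate n μ D) h1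
    rw [truncate_of_mem (d := τ.1.deg) (Submodule.subset_span ⟨τ.1, rfl, rfl⟩), if_pos τ.2,
      Submodule.map_span] at h2
    refine Submodule.span_le.2 ?_ h2
    rintro _ ⟨_, ⟨p, rfl⟩, rfl⟩
    simp only
    rw [truncate_of_mem (vMap_monomialVec_mem p)]
    split_ifs with hp
    · exact Submodule.subset_span ⟨⟨p, hp⟩, rfl⟩
    · exact zero_mem _
  rw [linearIndependent_iff_card_eq_finrank_span]
  refine le_antisymm ?_ (finrank_range_le_card c)
  calc Fintype.card _ ≤ Fintype.card {τ : PSYT n μ // τ.deg ≤ D} :=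
        Fintype.card_le_of_injective j hj
    _ = Module.finrank K (Submodule.span K (Set.range e)) := (finrank_span_eq_card he).symm
    _ ≤ Module.finrank K (Submodule.span K (Set.range c)) := by
        have : FiniteDimensional K (Submodule.span K (Set.range c)) :=
          FiniteDimensional.span_of_finite K (Set.finite_range c)
        exact Submodule.finrank_mono hspan

theorem linearIndependent_monomialVec :
    LinearIndependent K (monomialVec (n := n) (μ := μ)) :=
  LinearIndependent.of_comp ((vMap n μ).restrictScalars K) linearIndependent_vMap_monomialVec

/-- The basis of the induced module that consists of the `X^α ⊗ S`. -/
def monomialBasis (n : ℕ) (μ : YoungDiagram) :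
    Module.Basis ((Fin n → ℕ) × SYT n μ) K (V n μ) :=
  Module.Basis.mk linearIndependent_monomialVec span_monomialVec.ge

theorem monomialBasis_apply (p : (Fin n → ℕ) × SYT n μ) :
    monomialBasis n μ p = monomialVec p := Module.Basis.mk_apply _ _ p

theorem vMap_injective : Function.Injective (vMap n μ) := by
  have h : LinearMap.ker ((vMap n μ).restrictScalars K) = ⊥ := by
    rw [LinearMap.ker_eq_bot']
    intro v hv
    have h1 := (monomialBasis n μ).linearCombination_repr v
    have h2 := congrArg ((vMap n μ).restrictScalars K) h1
    rw [hv, Finsupp.apply_linearCombination] at h2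
    have h3 : ((vMap n μ).restrictScalars K) ∘ (monomialBasis n μ) =
        fun p => vMap n μ (monomialVec p) := by
      ext1 p; rw [Function.comp_apply, monomialBasis_apply]; rfl
    rw [h3] at h2
    have h4 := linearIndependent_iff.1 linearIndependent_vMap_monomialVec _ h2
    rwa [LinearEquiv.map_eq_zero_iff] at h4
  exact fun u v huv => LinearMap.ker_eq_bot.1 h huv

/-- The induced module is isomorphic to the seminormal module. -/
def vEquiv (n : ℕ) (μ : YoungDiagram) : V n μ ≃ₗ[Daha n] Semi n μ :=
  LinearEquiv.ofBijective (vMap n μ) ⟨vMap_injective, vMap_surjective⟩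

theorem vEquiv_tmul_of (S : SYT n μ) :
    vEquiv n μ (V.tmul 1 (Specht.of S)) = semiBasis n μ S.toPSYT := by
  change vMap n μ _ = _
  rw [vMap_tmul, spechtMap_of, one_smul]; rfl

theorem vEquiv_symm_smul (a : K) (v : Semi n μ) :
    (vEquiv n μ).symm (a • v) = a • (vEquiv n μ).symm v :=
  LinearMap.map_smul_of_tower (vEquiv n μ).symm.toLinearMap a v

theorem linearIndependent_of : LinearIndependent K (Specht.of (n := n) (μ := μ)) := by
  refine LinearIndependent.of_comp ((spechtMap n μ).restrictScalars K) ?_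
  have : ((spechtMap n μ).restrictScalars K) ∘ Specht.of = semiBasis n μ ∘ SYT.toPSYT := by
    ext1 S; exact spechtMap_of S
  rw [this]
  refine (semiBasis n μ).linearIndependent.comp _ fun S R h => ?_
  exact SYT.ext' (congrArg PSYT.label h)

/-- The standard tableaux form a basis of the Specht module. -/
def spechtBasis (n : ℕ) (μ : YoungDiagram) : Module.Basis (SYT n μ) K (Specht n μ) :=
  Module.Basis.mk linearIndependent_of Specht.span_of.ge

theorem spechtBasis_apply (S : SYT n μ) : spechtBasis n μ S = Specht.of S :=
  Module.Basis.mk_apply _ _ S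

/-! ### The family of Macdonald polynomials -/

/-- π is invertible in the model, although the algebra has no inverse for it. This makes π_n⁻¹ F_τ
meaningful and unique. -/
theorem pi_injective (hn : 0 < n) {u v : V n μ} (h : Daha.pi hn • u = Daha.pi hn • v) : u = v := by
  apply (vEquiv n μ).injective
  have h1 := congrArg (vEquiv n μ) h
  rw [map_smul, map_smul, daha_smul_def, daha_smul_def, rep_pi] at h1
  have h2 := congrArg (opPiInv hn μ) h1
  rwa [← Module.End.mul_apply, ← Module.End.mul_apply, opPiInv_mul] at h2

/-- The family `(F_τ)`. -/
def macdonald (τ : PSYT n μ) : V n μ := (vEquiv n μ).symm (semiBasis n μ τ)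

/-- Since t T_i⁻¹ = T_i + t - 1, the Knop–Sahi operator is T_i minus its diagonal coefficient, which
is why upward swaps have off-diagonal coefficient 1 in the model. -/
theorem swap_scalar {p r : ℕ × ℤ} (h : p ≠ r) :
    t - 1 + (t - 1) * keyWeight r / (keyWeight p - keyWeight r) = -diagCoeff p r := by
  have := keyWeight_sub_ne_zero h
  rw [diagCoeff]
  field_simp
  ring

theorem isMacdonald_macdonald : IsMacdonald (macdonald (n := n) (μ := μ)) where
  weight τ i := by
    rw [macdonald, ← map_smul, daha_smul_def, rep_theta, ← vec_label, opTheta_vec,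
      vEquiv_symm_smul, PSYT.weight_eq]
  std S := by rw [macdonald, ← vEquiv_tmul_of, LinearEquiv.symm_apply_apply]
  swap i τ σ h := by
    rw [macdonald, macdonald, ← map_smul, semiBasis_of_swapUp h, t_smul_heckeInv, add_assoc,
      ← map_add, PSYT.weight_eq, PSYT.weight_eq, swap_scalar (τ.increasing.key_lo_ne i), add_smul,
      algebraMap_smul, neg_smul, daha_smul_def, rep_T, sub_eq_add_neg]
  psi hn τ σ h := by
    refine ⟨(vEquiv n μ).symm (opPiInv hn μ (semiBasis n μ τ)), ?_, ?_⟩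
    · rw [← map_smul, daha_smul_def, rep_pi, ← Module.End.mul_apply, opPi_mul_inv]; rfl
    · rw [← map_smul, daha_smul_def, rep_X, ← vEquiv_symm_smul, macdonald,
        semiBasis_of_isPsi hn h]

theorem IsMacdonald.unique {F G : PSYT n μ → V n μ} (hF : IsMacdonald F) (hG : IsMacdonald G) :
    F = G := by
  ext1 τ
  induction τ using PSYT.induction_cover with
  | std S => rw [hF.std, hG.std]
  | swap i τ σ h ih => rw [← hF.swap i τ σ h, ← hG.swap i τ σ h, ih]
  | psi τ σ hn h ih =>
    obtain ⟨u, hu, hu'⟩ := hF.psi hn τ σ h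
    obtain ⟨v, hv, hv'⟩ := hG.psi hn τ σ h
    rw [hu', hv', pi_injective hn (hu.trans (ih.trans hv.symm))]

theorem existsUnique_isMacdonald : ∃! F : PSYT n μ → V n μ, IsMacdonald F :=
  ⟨macdonald, isMacdonald_macdonald, fun _ h => h.unique isMacdonald_macdonald⟩

end VVMac
end

noncomputable section
namespace VVMac

variable {n : ℕ} {μ : YoungDiagram}

/-! ### Greatest tableaux -/

/-- No swap of the tableau goes up. -/
def Saturated (τ : PSYT n μ) : Prop :=
  ∀ i : Fin (n - 1), ¬ Ascends (key τ.label τ.wt (lo i)) (key τ.label τ.wt (hi i))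

/-- Boxes ordered by decreasing exponent, then by column, then by row. -/
def columnKey (w : Box μ → ℕ) (x : Box μ) : ℕᵒᵈ ×ₗ ℕ ×ₗ ℕ :=
  toLex (OrderDual.toDual (w x), toLex (x.1.2, x.1.1))

theorem columnKey_injective (w : Box μ → ℕ) : Function.Injective (columnKey w) := by
  intro x y h
  have h1 : x.1.2 = y.1.2 := congrArg (fun z => (ofLex (ofLex z).2).1) h
  have h2 : x.1.1 = y.1.1 := congrArg (fun z => (ofLex (ofLex z).2).2) h
  exact Subtype.ext (Prod.ext h2 h1)

theorem columnKey_lt {w : Box μ → ℕ} {x y : Box μ} : columnKey w x < columnKey w y ↔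
    w y < w x ∨ (w x = w y ∧ (x.1.2 < y.1.2 ∨ (x.1.2 = y.1.2 ∧ x.1.1 < y.1.1))) := by
  simp [columnKey, Prod.Lex.toLex_lt_toLex, OrderDual.toDual_lt_toDual]

/-- Suppose two consecutive labels have the same exponent and are not in column order. Then the
bound on the contents forces the box of the larger label to lie weakly above and to the left of the
other, which is impossible in an increasing labelling. -/
theorem Saturated.columnKey_lt {τ : PSYT n μ} (h : Saturated τ) (i : Fin (n - 1)) :
    columnKey τ.wt (τ.label.symm (lo i)) < columnKey τ.wt (τ.label.symm (hi i)) := by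
  rw [VVMac.columnKey_lt]
  have hs := h i
  simp only [Ascends, key, boxKey, content] at hs
  set x := τ.label.symm (lo i) with hx
  set y := τ.label.symm (hi i) with hy
  have hne : y ≠ x := fun e => lo_ne_hi i (τ.label.symm.injective e).symm
  have hlab : (τ.label y).1 = (τ.label x).1 + 1 := by rw [hx, hy]; simp [lo, hi]
  by_contra hcon
  have := τ.increasing.entryLT (x := y) (y := x) (by omega) (by omega) hne
  simp only [EntryLT, Fin.lt_def] at this
  omega

theorem strictMono_of_lo_lt_hi {α : Type*} [Preorder α] {f : Fin n → α}
    (h : ∀ i : Fin (n - 1), f (lo i) < f (hi i)) : StrictMono f := by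
  cases n with
  | zero => exact fun i => i.elim0
  | succ m => exact Fin.strictMono_iff_lt_succ.2 h

/-- Both labellings list the boxes increasingly for the same linear order, which depends only on the
exponents. -/
theorem Saturated.eq {τ σ : PSYT n μ} (hτ : Saturated τ) (hσ : Saturated σ) (h : τ.wt = σ.wt) :
    τ = σ := by
  have h1 : StrictMono fun j => columnKey τ.wt (τ.label.symm j) :=
    strictMono_of_lo_lt_hi hτ.columnKey_lt
  have h2 : StrictMono fun j => columnKey σ.wt (σ.label.symm j) :=
    strictMono_of_lo_lt_hi hσ.columnKey_lt
  rw [← h] at h2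
  have hr : Set.range (fun j => columnKey τ.wt (τ.label.symm j)) =
      Set.range fun j => columnKey τ.wt (σ.label.symm j) :=
    (τ.label.symm.surjective.range_comp (columnKey τ.wt)).trans
      (σ.label.symm.surjective.range_comp (columnKey τ.wt)).symm
  have h3 := (h1.range_inj h2).1 hr
  refine PSYT.ext' ?_ h
  rw [← τ.label.symm_symm, ← σ.label.symm_symm]
  congr 1
  ext1 j
  exact columnKey_injective _ (congrFun h3 j)

/-- A bound for differences of contents. -/
def contentBound (μ : YoungDiagram) : ℤ := 1 + 2 * ∑ x : Box μ, |content x|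

theorem content_sub_lt (x y : Box μ) : content y - content x < contentBound μ := by
  have hx := Finset.single_le_sum (f := fun x : Box μ => |content x|)
    (fun _ _ => abs_nonneg _) (Finset.mem_univ x)
  have hy := Finset.single_le_sum (f := fun x : Box μ => |content x|)
    (fun _ _ => abs_nonneg _) (Finset.mem_univ y)
  have h1 := neg_abs_le (content x)
  have h2 := le_abs_self (content y)
  unfold contentBound
  linarith

/-- The weight of a box in `height`. -/
def heightWeight (w : Box μ → ℕ) (x : Box μ) : ℤ := content x - contentBound μ * w x

/-- A quantity that increases along swaps. -/
def PSYT.height (τ : PSYT n μ) : ℤ := ∑ j, (j.1 : ℤ) * heightWeight τ.wt (τ.label.symm j)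

theorem heightWeight_lt {w : Box μ → ℕ} {x y : Box μ} (h : Ascends (boxKey w x) (boxKey w y)) :
    heightWeight w y < heightWeight w x := by
  have h1 := content_sub_lt x y
  unfold heightWeight
  rcases h with h | ⟨h, h'⟩ <;> simp only [boxKey] at h
  · have h0 : 0 ≤ contentBound μ :=
      add_nonneg zero_le_one (mul_nonneg zero_le_two (Finset.sum_nonneg fun _ _ => abs_nonneg _))
    have h2 : contentBound μ * (w x + 1 : ℤ) ≤ contentBound μ * w y :=
      mul_le_mul_of_nonneg_left (by omega) h0
    linarith
  · simp only [boxKey] at h'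
    rw [h]; linarith

/-- An upward swap gives the larger label to the box with smaller exponent, or equal exponent and
larger content. The content bound makes exponents dominate contents in the weight of a box, so the
weighted sum grows. -/
theorem SwapUp.height_lt {τ σ : PSYT n μ} {i : Fin (n - 1)} (h : SwapUp i τ σ) :
    τ.height < σ.height := by
  have hσ : σ.height = ∑ j, ((adj i j).1 : ℤ) * heightWeight τ.wt (τ.label.symm j) := by
    rw [h.eq, PSYT.height, ← Equiv.sum_comp (adj i)]
    refine Finset.sum_congr rfl fun j _ => ?_
    simp [Increasing.toPSYT]
  have hd : σ.height - τ.height = heightWeight τ.wt (τ.label.symm (lo i)) -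
      heightWeight τ.wt (τ.label.symm (hi i)) := by
    rw [hσ, PSYT.height, ← Finset.sum_sub_distrib,
      Finset.sum_eq_add (lo i) (hi i) (lo_ne_hi i) _ (by simp) (by simp)]
    · rw [adj, Equiv.swap_apply_left, Equiv.swap_apply_right]
      simp only [lo, hi]
      push_cast
      ring
    · rintro j - ⟨h1, h2⟩
      rw [adj, Equiv.swap_apply_of_ne_of_ne h1 h2, sub_self]
  have := heightWeight_lt h.ascends
  linarith

/-- Among the finitely many tableaux above σ with the same exponents, one of maximal height admits
no upward swap. -/
theorem exists_saturated (σ : PSYT n μ) : ∃ τ : PSYT n μ, Saturated τ ∧ τ.wt = σ.wt ∧ σ.Le τ := by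
  have hfin : {τ : PSYT n μ | τ.wt = σ.wt ∧ σ.Le τ}.Finite := by
    have := finite_deg_le (n := n) (μ := μ) σ.deg
    refine Set.Finite.subset (s := {τ : PSYT n μ | τ.deg ≤ σ.deg}) this fun τ h => ?_
    simp [PSYT.deg, h.1]
  obtain ⟨τ, ⟨h1, h2⟩, hmax⟩ := Set.exists_max_image _ PSYT.height hfin
    ⟨σ, rfl, Relation.ReflTransGen.refl⟩
  refine ⟨τ, fun i ha => ?_, h1, h2⟩
  have hup := swapUp_of_ascends τ ha
  have h3 := hmax (τ.increasing.trans_adj ha.not_linked).toPSYT ⟨h1, h2.tail (Or.inr ⟨i, hup⟩)⟩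
  exact (hup.height_lt.trans_le h3).false

theorem Cover.deg_le {τ σ : PSYT n μ} (h : Cover τ σ) : τ.deg ≤ σ.deg := by
  rcases h with h | ⟨i, h⟩
  · refine Finset.sum_le_sum fun x _ => ?_
    by_cases h0 : (τ.label x).1 = 0
    · rw [((h x).2 h0).2]; exact Nat.le_succ _
    · rw [((h x).1 h0).2]
  · rw [h.1.deg]

theorem PSYT.Le.deg_le {τ σ : PSYT n μ} (h : τ.Le σ) : τ.deg ≤ σ.deg := by
  induction h with
  | refl => exact le_rfl
  | tail _ h ih => exact ih.trans h.deg_le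

/-- Covers never lower the degree and Ψ raises it, so a chain within one degree consists of swaps,
and a saturated tableau admits none. This gives uniqueness of the greatest element without proving
antisymmetry of the order. -/
theorem Saturated.eq_of_le {τ σ : PSYT n μ} (hτ : Saturated τ) (h : τ.Le σ)
    (hd : σ.deg = τ.deg) : σ = τ := by
  rcases Relation.ReflTransGen.cases_head h with h | ⟨ρ, h1, h2⟩
  · exact h.symm
  rcases h1 with h1 | ⟨i, h1⟩
  -- For n = 0 the relation defining Ψ holds vacuously and raises no degree; there is then only one
  -- tableau.
  · rcases Nat.eq_zero_or_pos n with h0 | h0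
    · subst h0
      have : IsEmpty (Box μ) := τ.label.isEmpty
      exact PSYT.ext' (Equiv.ext fun x => isEmptyElim x) (funext fun x => isEmptyElim x)
    · have := h1.deg h0
      have := PSYT.Le.deg_le h2
      omega
  · exact absurd h1.ascends (hτ i)

theorem PSYT.Over.deg_eq {τ σ : PSYT n μ} {T : RYT μ} (hτ : τ.Over T) (hσ : σ.Over T) :
    τ.deg = σ.deg :=
  Finset.sum_congr rfl fun x _ => (hτ x).trans (hσ x).symm

theorem Saturated.isTop {T : RYT μ} {τ : PSYT n μ} (h : Saturated τ) (hT : τ.Over T) :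
    IsTop T τ := by
  refine ⟨hT, fun σ hσ => ?_⟩
  obtain ⟨ρ, h1, h2, h3⟩ := exists_saturated σ
  have : ρ = τ := h1.eq h (by rw [h2]; ext x; rw [hσ x, hT x])
  rwa [this] at h3

theorem Saturated.eq_of_isTop {T : RYT μ} {τ σ : PSYT n μ} (h : Saturated τ) (hT : τ.Over T)
    (hσ : IsTop T σ) : σ = τ :=
  h.eq_of_le (hσ.2 τ hT) (hσ.1.deg_eq hT)

/-- Numbering the boxes by decreasing exponent, then by column, then by row gives an increasing
labelling; the number of boxes must equal n. -/
theorem exists_over (hn : μ.card = n) (T : RYT μ) : ∃ τ : PSYT n μ, τ.Over T := by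
  have hcard : Fintype.card (Box μ) = n := (Fintype.card_of_subtype μ.cells fun _ => Iff.rfl).trans hn
  let L := Fintype.equivFinOfCardEq hcard
  let f := fun j => columnKey T.val (L.symm j)
  let L' := L.trans (Tuple.sort f).symm
  have hf : ∀ x, f (Tuple.sort f (L' x)) = columnKey T.val x := by
    intro x; simp [f, L']
  have hlt : ∀ x y, columnKey T.val x < columnKey T.val y → L' x < L' y := by
    intro x y h
    by_contra hcon
    have := Tuple.monotone_sort f (not_lt.1 hcon)
    simp only [Function.comp_apply, hf] at this
    exact (h.trans_le this).false
  have hinc : Increasing L' T.val := by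
    intro x y h
    have hle : T.val y ≤ T.val x :=
      h.elim (fun h => T.row_le x y h.1 h.2) (fun h => T.col_le x y h.1 h.2)
    rcases hle.lt_or_eq with h1 | h1
    · exact Or.inl h1
    · refine Or.inr ⟨h1.symm, hlt x y ?_⟩
      rw [columnKey_lt]
      exact Or.inr ⟨h1.symm, by omega⟩
  exact ⟨hinc.toPSYT, fun _ => rfl⟩

theorem exists_saturated_over (hn : μ.card = n) (T : RYT μ) :
    ∃ τ : PSYT n μ, Saturated τ ∧ τ.Over T := by
  obtain ⟨σ, hσ⟩ := exists_over hn T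
  obtain ⟨τ, h1, h2, -⟩ := exists_saturated σ
  exact ⟨τ, h1, fun x => by rw [h2]; exact hσ x⟩

theorem existsUnique_isTop (hn : μ.card = n) (T : RYT μ) : ∃! τ : PSYT n μ, IsTop T τ := by
  obtain ⟨τ, h1, h2⟩ := exists_saturated_over hn T
  exact ⟨τ, h1.isTop h2, fun σ hσ => h1.eq_of_isTop h2 hσ⟩

/-! ### Padded diagrams -/

theorem mem_pad {lam : YoungDiagram} {hn : nMin lam ≤ n} {r c : ℕ} : (r, c) ∈ pad lam n hn ↔
    (r = 0 ∧ c < n - lam.card) ∨ ∃ k, r = k + 1 ∧ (k, c) ∈ lam := by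
  rw [pad, YoungDiagram.mem_ofRowLens]
  cases r with
  | zero => simp
  | succ k =>
    simp only [List.length_cons, List.getElem_cons_succ, YoungDiagram.mem_iff_lt_rowLen]
    constructor
    · rintro ⟨h1, h2⟩
      rw [YoungDiagram.get_rowLens] at h2
      exact Or.inr ⟨k, rfl, h2⟩
    · rintro (⟨h, -⟩ | ⟨k', h, h'⟩)
      · omega
      · obtain rfl : k = k' := by omega
        have hlen : k < lam.rowLens.length := by
          rw [YoungDiagram.length_rowLens, ← YoungDiagram.mem_iff_lt_colLen]
          exact lam.up_left_mem le_rfl (Nat.zero_le _) (YoungDiagram.mem_iff_lt_rowLen.2 h')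
        exact ⟨by omega, by rw [YoungDiagram.get_rowLens]; exact h'⟩

theorem card_pad {lam : YoungDiagram} (hn : nMin lam ≤ n) : (pad lam n hn).card = n := by
  have h : (pad lam n hn).cells =
      (Finset.range (n - lam.card)).map ⟨fun c => (0, c), fun a b h => (Prod.mk.inj h).2⟩ ∪
      lam.cells.map ⟨fun x => (x.1 + 1, x.2), fun a b h => by
        simp only [Prod.mk.injEq] at h; exact Prod.ext (by omega) h.2⟩ := by
    ext ⟨r, c⟩
    rw [YoungDiagram.mem_cells, mem_pad]
    simp only [Finset.mem_union, Finset.mem_map, Finset.mem_range, YoungDiagram.mem_cells,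
      Prod.exists]
    constructor
    · rintro (⟨rfl, h⟩ | ⟨k, rfl, h⟩)
      · exact Or.inl ⟨c, h, rfl⟩
      · exact Or.inr ⟨k, c, h, rfl⟩
    · rintro (⟨c', h, h'⟩ | ⟨k, c', h, h'⟩) <;> obtain ⟨rfl, rfl⟩ := Prod.mk.inj h'
      · exact Or.inl ⟨rfl, h⟩
      · exact Or.inr ⟨k, rfl, h⟩
  rw [YoungDiagram.card, h, Finset.card_union_of_disjoint, Finset.card_map, Finset.card_map,
    Finset.card_range]
  · unfold nMin YoungDiagram.card at *; omega
  · rw [Finset.disjoint_left]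
    rintro x hx hx'
    obtain ⟨c, -, rfl⟩ := Finset.mem_map.1 hx
    obtain ⟨y, -, hy⟩ := Finset.mem_map.1 hx'
    exact absurd (Prod.mk.inj hy).1 (Nat.succ_ne_zero _)

end VVMac
end

noncomputable section
namespace VVMac

variable {n : ℕ} {μ ν : YoungDiagram} {x₀ : ℕ × ℕ}

/-! ### Adding a box with the largest label -/

/-- The diagram `ν` is obtained from `μ` by adding the box `x₀`. -/
structure AddBox (μ ν : YoungDiagram) (x₀ : ℕ × ℕ) : Prop where
  mem_iff : ∀ x, x ∈ ν ↔ x ∈ μ ∨ x = x₀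
  notMem : x₀ ∉ μ

namespace AddBox

variable (A : AddBox μ ν x₀)

/-- A box of the smaller diagram as a box of the larger one. -/
def incl (x : Box μ) : Box ν := ⟨x.1, (A.mem_iff _).2 (Or.inl x.2)⟩

/-- The added box. -/
def corner : Box ν := ⟨x₀, (A.mem_iff _).2 (Or.inr rfl)⟩

theorem incl_ne_corner (x : Box μ) : A.incl x ≠ A.corner := fun h => by
  have h1 : x.1 = x₀ := congrArg Subtype.val h
  exact A.notMem (h1 ▸ x.2)

theorem incl_injective : Function.Injective A.incl := fun x y h =>
  Subtype.ext (show x.1 = y.1 from congrArg (fun z : Box ν => z.1) h)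

theorem eq_corner_or (y : Box ν) : y = A.corner ∨ ∃ x, y = A.incl x := by
  rcases (A.mem_iff y.1).1 y.2 with h | h
  · exact Or.inr ⟨⟨y.1, h⟩, rfl⟩
  · exact Or.inl (Subtype.ext h)

/-- The boxes of the larger diagram are those of the smaller one and the added box. -/
def boxEquiv : Option (Box μ) ≃ Box ν :=
  Equiv.ofBijective (fun o => o.elim A.corner A.incl) (by
    constructor
    · rintro (_ | x) (_ | y) h
      · rfl
      · exact absurd h.symm (A.incl_ne_corner y)
      · exact absurd h (A.incl_ne_corner x)
      · exact congrArg some (A.incl_injective h)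
    · intro y
      rcases A.eq_corner_or y with rfl | ⟨x, rfl⟩
      · exact ⟨none, rfl⟩
      · exact ⟨some x, rfl⟩)

theorem boxEquiv_symm_incl (x : Box μ) : A.boxEquiv.symm (A.incl x) = some x :=
  (Equiv.symm_apply_eq _).2 rfl

theorem boxEquiv_symm_corner : A.boxEquiv.symm A.corner = none :=
  (Equiv.symm_apply_eq _).2 rfl

/-- Labels extended by the largest label at the added box. -/
def extLabel (L : Box μ ≃ Fin n) : Box ν ≃ Fin (n + 1) :=
  A.boxEquiv.symm.trans (L.optionCongr.trans finSuccEquivLast.symm)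

/-- Exponents extended by zero at the added box. -/
def extWt (w : Box μ → ℕ) (y : Box ν) : ℕ := (A.boxEquiv.symm y).elim 0 w

theorem extLabel_incl (L : Box μ ≃ Fin n) (x : Box μ) :
    A.extLabel L (A.incl x) = (L x).castSucc := by
  simp [extLabel, boxEquiv_symm_incl]

theorem extLabel_corner (L : Box μ ≃ Fin n) : A.extLabel L A.corner = Fin.last n := by
  simp [extLabel, boxEquiv_symm_corner]

theorem extWt_incl (w : Box μ → ℕ) (x : Box μ) : A.extWt w (A.incl x) = w x := by
  simp [extWt, boxEquiv_symm_incl]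

theorem extWt_corner (w : Box μ → ℕ) : A.extWt w A.corner = 0 := by
  simp [extWt, boxEquiv_symm_corner]

theorem extWt_zero : A.extWt (fun _ => 0) = fun _ => 0 := by
  ext y
  rcases A.eq_corner_or y with rfl | ⟨x, rfl⟩
  · exact A.extWt_corner _
  · exact A.extWt_incl _ _

theorem key_extLabel (L : Box μ ≃ Fin n) (w : Box μ → ℕ) (j : Fin n) :
    key (A.extLabel L) (A.extWt w) j.castSucc = key L w j := by
  have e : (A.extLabel L).symm j.castSucc = A.incl (L.symm j) := by
    rw [Equiv.symm_apply_eq, extLabel_incl, L.apply_symm_apply]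
  rw [key, e, boxKey, extWt_incl]; rfl

theorem key_extLabel_last (L : Box μ ≃ Fin n) (w : Box μ → ℕ) :
    key (A.extLabel L) (A.extWt w) (Fin.last n) = (0, content A.corner) := by
  have e : (A.extLabel L).symm (Fin.last n) = A.corner := by
    rw [Equiv.symm_apply_eq, extLabel_corner]
  rw [key, e, boxKey, extWt_corner]

/-- The largest label with exponent 0 comes last in the order, so the added box imposes no
condition. -/
theorem increasing_ext_iff {L : Box μ ≃ Fin n} {w : Box μ → ℕ} :
    Increasing (A.extLabel L) (A.extWt w) ↔ Increasing L w := by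
  constructor
  · intro h x y hxy
    have := h (A.incl x) (A.incl y) hxy
    simpa [EntryLT, extLabel_incl, extWt_incl] using this
  · intro h x y hxy
    rcases A.eq_corner_or y with rfl | ⟨y, rfl⟩
    · rcases A.eq_corner_or x with rfl | ⟨x, rfl⟩
      · omega
      · rw [extLabel_incl, extLabel_corner, extWt_incl, extWt_corner]
        rcases Nat.eq_zero_or_pos (w x) with h0 | h0
        · exact Or.inr ⟨h0, Fin.castSucc_lt_last _⟩
        · exact Or.inl h0
    · rcases A.eq_corner_or x with rfl | ⟨x, rfl⟩
      -- The added box cannot precede an old box in its row or column, because the smaller diagram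
      -- would then contain it.
      · refine absurd (μ.up_left_mem (i1 := x₀.1) (j1 := x₀.2) ?_ ?_ y.2) A.notMem
        · rcases hxy with hxy | hxy
          · exact hxy.1.le
          · exact hxy.2.le
        · rcases hxy with hxy | hxy
          · exact hxy.2.le
          · exact hxy.1.le
      · have := h x y hxy
        simpa [EntryLT, extLabel_incl, extWt_incl] using this

/-- The tableau extended by the largest label, with exponent zero, at the added box. -/
def extend (τ : PSYT n μ) : PSYT (n + 1) ν := (A.increasing_ext_iff.2 τ.increasing).toPSYT

/-- The standard tableau extended by the largest label at the added box. -/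
def extendStd (S : SYT n μ) : SYT (n + 1) ν :=
  (A.extend S.toPSYT).toSYT fun x => congrFun A.extWt_zero x

theorem extendStd_toPSYT (S : SYT n μ) : (A.extendStd S).toPSYT = A.extend S.toPSYT :=
  PSYT.toSYT_toPSYT _ _

theorem exists_extLabel_eq {L' : Box ν ≃ Fin (n + 1)} (h : L' A.corner = Fin.last n) :
    ∃ L : Box μ ≃ Fin n, L' = A.extLabel L := by
  let e : Option (Box μ) ≃ Option (Fin n) := A.boxEquiv.trans (L'.trans finSuccEquivLast)
  have h0 : e none = none := by
    change finSuccEquivLast (L' A.corner) = none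
    rw [h, finSuccEquivLast_last]
  refine ⟨Equiv.removeNone e, Equiv.ext fun y => ?_⟩
  rcases A.eq_corner_or y with rfl | ⟨x, rfl⟩
  · rw [h, extLabel_corner]
  · have hx : ∃ z, e (some x) = some z := by
      rw [← Option.ne_none_iff_exists']
      intro hx
      exact absurd (e.injective (hx.trans h0.symm)) (by simp)
    have h1 := Equiv.removeNone_some e hx
    rw [extLabel_incl, ← finSuccEquivLast.apply_eq_iff_eq, finSuccEquivLast_castSucc, h1]
    rfl

theorem exists_extendStd_eq {S' : SYT (n + 1) ν} (h : S'.label A.corner = Fin.last n) :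
    ∃ S : SYT n μ, S' = A.extendStd S := by
  obtain ⟨L, hL⟩ := A.exists_extLabel_eq h
  have hinc : Increasing L fun _ => 0 := by
    rw [← A.increasing_ext_iff, ← hL, A.extWt_zero]; exact S'.increasing
  exact ⟨hinc.toPSYT.toSYT fun _ => rfl, SYT.ext' hL⟩

theorem extendStd_injective : Function.Injective (A.extendStd (n := n)) := by
  intro S R h
  refine SYT.ext' (Equiv.ext fun x => ?_)
  have h1 : A.extLabel S.label (A.incl x) = A.extLabel R.label (A.incl x) :=
    congrArg (fun Q : SYT (n + 1) ν => Q.label (A.incl x)) h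
  rw [extLabel_incl, extLabel_incl] at h1
  exact Fin.castSucc_injective _ h1

end AddBox

/-- The index of the same simple transposition, for one label more. -/
def upIdx (i : Fin (n - 1)) : Fin (n + 1 - 1) := ⟨i.1, by have := i.2; omega⟩

/-- The index of the transposition of the two largest labels. -/
def topIdx (hn : 0 < n) : Fin (n + 1 - 1) := ⟨n - 1, by omega⟩

theorem lo_upIdx (i : Fin (n - 1)) : lo (upIdx i) = (lo i).castSucc := rfl

theorem hi_upIdx (i : Fin (n - 1)) : hi (upIdx i) = (hi i).castSucc := rfl

theorem lo_topIdx (hn : 0 < n) :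
    lo (topIdx hn) = (⟨n - 1, Nat.sub_lt hn Nat.one_pos⟩ : Fin n).castSucc := rfl

theorem hi_topIdx (hn : 0 < n) : hi (topIdx hn) = Fin.last n :=
  Fin.ext (Nat.sub_add_cancel hn)

theorem adj_upIdx_castSucc (i : Fin (n - 1)) (j : Fin n) :
    adj (upIdx i) j.castSucc = (adj i j).castSucc := by
  apply Fin.ext
  rw [adj_val, Fin.val_castSucc, Fin.val_castSucc, adj_val]
  rfl

theorem adj_upIdx_last (i : Fin (n - 1)) : adj (upIdx i) (Fin.last n) = Fin.last n := by
  have := i.2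
  apply Fin.ext
  rw [adj_val, Fin.val_last, if_neg (by simp [upIdx]; omega), if_neg (by simp [upIdx]; omega)]

namespace AddBox

variable (A : AddBox μ ν x₀)

theorem extLabel_trans_adj (L : Box μ ≃ Fin n) (i : Fin (n - 1)) :
    (A.extLabel L).trans (adj (upIdx i)) = A.extLabel (L.trans (adj i)) := by
  ext1 y
  rcases A.eq_corner_or y with rfl | ⟨x, rfl⟩
  · rw [Equiv.trans_apply, extLabel_corner, extLabel_corner, adj_upIdx_last]
  · rw [Equiv.trans_apply, extLabel_incl, extLabel_incl, adj_upIdx_castSucc, Equiv.trans_apply]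

theorem swapUp_extend {τ σ : PSYT n μ} {i : Fin (n - 1)} (h : SwapUp i τ σ) :
    SwapUp (upIdx i) (A.extend τ) (A.extend σ) := by
  refine ⟨⟨fun y => ?_, fun y => ?_⟩, ?_⟩
  · have h1 : σ.label = τ.label.trans (adj i) := Equiv.ext h.1.1
    change A.extLabel σ.label y = _
    rw [h1, ← extLabel_trans_adj]; rfl
  · have h1 : σ.wt = τ.wt := funext h.1.2
    change A.extWt σ.wt y = A.extWt τ.wt y
    rw [h1]
  · change Ascends (key (A.extLabel τ.label) (A.extWt τ.wt) (lo i).castSucc)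
      (key (A.extLabel τ.label) (A.extWt τ.wt) (hi i).castSucc)
    rw [key_extLabel, key_extLabel]
    exact h.ascends

/-- The extension of `Ψ(τ)` is obtained from `Ψ` of the extension of `τ` by a swap. -/
theorem swapUp_psi_extend (hn : 0 < n) {τ σ : PSYT n μ} (h : IsPsi τ σ) :
    SwapUp (topIdx hn) (A.extend τ).psi (A.extend σ) := by
  have hl : ∀ y, (A.extend τ).psi.label y = psiLabel (A.extLabel τ.label) y := fun _ => rfl
  have hw : ∀ y, (A.extend τ).psi.wt y = psiWt (A.extLabel τ.label) (A.extWt τ.wt) y :=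
    fun _ => rfl
  refine ⟨⟨fun y => ?_, fun y => ?_⟩, Or.inl ?_⟩
  · change A.extLabel σ.label y = adj (topIdx hn) _
    apply Fin.ext
    rw [adj_val, hl, psiLabel_val]
    rcases A.eq_corner_or y with rfl | ⟨x, rfl⟩
    · rw [extLabel_corner, extLabel_corner, Fin.val_last]
      simp only [topIdx]
      grind
    · rw [extLabel_incl, extLabel_incl, Fin.val_castSucc, Fin.val_castSucc]
      have := (τ.label x).2
      simp only [topIdx]
      by_cases h0 : (τ.label x).1 = 0
      · have := ((h x).2 h0).1
        grind
      · have := ((h x).1 h0).1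
        grind
  · change A.extWt σ.wt y = _
    rw [hw, psiWt]
    rcases A.eq_corner_or y with rfl | ⟨x, rfl⟩
    · rw [extLabel_corner, extWt_corner, extWt_corner, Fin.val_last, if_neg (by omega)]
    · rw [extLabel_incl, extWt_incl, extWt_incl, Fin.val_castSucc]
      by_cases h0 : (τ.label x).1 = 0
      · rw [if_pos h0, ((h x).2 h0).2]
      · rw [if_neg h0, ((h x).1 h0).2]
  · have e1 : (A.extend τ).psi.label.symm (lo (topIdx hn)) = A.corner := by
      rw [Equiv.symm_apply_eq, hl]
      apply Fin.ext
      rw [psiLabel_val, extLabel_corner, Fin.val_last, if_neg (by omega)]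
      rfl
    have e2 : (A.extend τ).psi.label.symm (hi (topIdx hn)) =
        A.incl (τ.label.symm ⟨0, hn⟩) := by
      rw [Equiv.symm_apply_eq, hl]
      apply Fin.ext
      rw [psiLabel_val, extLabel_incl, hi_topIdx, Fin.val_last]
      simp
    rw [PSYT.w, PSYT.w, e1, e2, hw, hw, psiWt, psiWt, extLabel_corner, extLabel_incl,
      extWt_corner, Fin.val_last, if_neg (by omega), if_pos (by simp)]
    exact Nat.succ_pos _

/-- The only new pair of consecutive labels is (n, n+1). It cannot ascend: the exponent at n+1 is 0,
and the content of the added box is maximal. -/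
theorem saturated_extend {τ : PSYT n μ} (h : Saturated τ)
    (hc : ∀ y : Box ν, content y ≤ content A.corner) : Saturated (A.extend τ) := by
  intro i
  change ¬ Ascends (key (A.extLabel τ.label) (A.extWt τ.wt) _)
      (key (A.extLabel τ.label) (A.extWt τ.wt) _)
  by_cases hi' : i.1 < n - 1
  · have e1 : lo i = (lo ⟨i.1, hi'⟩).castSucc := rfl
    have e2 : hi i = (hi ⟨i.1, hi'⟩).castSucc := rfl
    rw [e1, e2, key_extLabel, key_extLabel]
    exact h _
  · have hlast : hi i = Fin.last n := Fin.ext (by have := i.2; simp [hi]; omega)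
    rw [hlast, key_extLabel_last]
    rintro (h1 | ⟨-, h1⟩)
    · exact absurd h1 (Nat.not_lt_zero _)
    · have := hc ((A.extLabel τ.label).symm (lo i))
      simp only [key, boxKey] at h1
      omega

end AddBox

/-! ### The seminormal form of the Specht module -/

/-- The vector of a labelling in the Specht module, zero if it is not standard. -/
def spechtVec (L : Box μ ≃ Fin n) : Specht n μ :=
  open scoped Classical in
  if h : Increasing L fun _ => 0 then Specht.of (h.toPSYT.toSYT fun _ => rfl) else 0

theorem spechtVec_label (S : SYT n μ) : spechtVec S.label = Specht.of S := dif_pos S.increasing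

theorem spechtMap_spechtVec (L : Box μ ≃ Fin n) :
    spechtMap n μ (spechtVec L) = vec L fun _ => 0 := by
  by_cases h : Increasing L fun _ => 0
  · rw [spechtVec, dif_pos h, spechtMap_of, vec_of_increasing h]; rfl
  · rw [spechtVec, dif_neg h, vec, dif_neg h, map_zero]

theorem spechtMap_injective : Function.Injective (spechtMap n μ) := by
  intro u v huv
  apply (spechtBasis n μ).repr.injective
  have hli : LinearIndependent K (fun S : SYT n μ => stdVec S) :=
    (semiBasis n μ).linearIndependent.comp SYT.toPSYT
      fun S R h => SYT.ext' (congrArg PSYT.label h)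
  have hf : ∀ v, Finsupp.linearCombination K stdVec ((spechtBasis n μ).repr v) =
      spechtMap n μ v := by
    intro v
    conv_rhs => rw [← (spechtBasis n μ).linearCombination_repr v]
    change _ = ((spechtMap n μ).restrictScalars K) _
    rw [Finsupp.apply_linearCombination]
    congr 2
    ext1 S
    rw [Function.comp_apply, spechtBasis_apply]
    exact (spechtMap_of S).symm
  refine hli ?_
  rw [hf, hf, huv]

/-- The seminormal formula is pulled back along the embedding into the model, which avoids a second
computation in the Specht module. -/
theorem T_smul_of (S : SYT n μ) (i : Fin (n - 1)) : Hecke.T i • Specht.of S =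
    diagCoeff (key S.label (fun _ => 0) (lo i)) (key S.label (fun _ => 0) (hi i)) • Specht.of S +
    swapCoeff (key S.label (fun _ => 0) (lo i)) (key S.label (fun _ => 0) (hi i)) •
      spechtVec (S.label.trans (adj i)) := by
  have hs : ∀ (a : K) (v : Specht n μ), spechtMap n μ (a • v) = a • spechtMap n μ v :=
    fun a v => LinearMap.map_smul_of_tower _ a v
  apply spechtMap_injective
  rw [map_smul, map_add, hs, hs, spechtMap_spechtVec, spechtMap_of, hecke_T_stdVec, stdVec_eq,
    opT_vec S.increasing]

/-! ### Restriction of Specht modules -/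

namespace AddBox

variable (A : AddBox μ ν x₀)

/-- The map of Specht modules that restricts tableaux with the largest label in the added box, and
kills the others. -/
structure Restricts (g : Specht (n + 1) ν →ₗ[K] Specht n μ) : Prop where
  extend : ∀ S : SYT n μ, g (Specht.of (A.extendStd S)) = Specht.of S
  other : ∀ S' : SYT (n + 1) ν, S'.label A.corner ≠ Fin.last n → g (Specht.of S') = 0

theorem exists_restricts : ∃ g : Specht (n + 1) ν →ₗ[K] Specht n μ, A.Restricts g := by
  classical
  refine ⟨(spechtBasis (n + 1) ν).constr K fun S' =>
    if h : S'.label A.corner = Fin.last n then Specht.of (A.exists_extendStd_eq h).choose else 0,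
    fun S => ?_, fun S' h => ?_⟩
  · have h : (A.extendStd S).label A.corner = Fin.last n := A.extLabel_corner _
    rw [← spechtBasis_apply, Module.Basis.constr_basis, dif_pos h]
    congr 1
    exact (A.extendStd_injective (A.exists_extendStd_eq h).choose_spec).symm
  · rw [← spechtBasis_apply, Module.Basis.constr_basis, dif_neg h]

variable {A}

theorem Restricts.unique {g g' : Specht (n + 1) ν →ₗ[K] Specht n μ} (h : A.Restricts g)
    (h' : A.Restricts g') : g = g' := by
  refine (spechtBasis (n + 1) ν).ext fun S' => ?_
  rw [spechtBasis_apply]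
  by_cases hS : S'.label A.corner = Fin.last n
  · obtain ⟨S, rfl⟩ := A.exists_extendStd_eq hS
    rw [h.extend, h'.extend]
  · rw [h.other S' hS, h'.other S' hS]

theorem Restricts.spechtVec_ext {g : Specht (n + 1) ν →ₗ[K] Specht n μ} (h : A.Restricts g)
    (L : Box μ ≃ Fin n) : g (spechtVec (A.extLabel L)) = spechtVec L := by
  by_cases hL : Increasing L fun _ => 0
  · have e := spechtVec_label (A.extendStd (hL.toPSYT.toSYT fun _ => rfl))
    change spechtVec (A.extLabel L) = _ at e
    rw [e, h.extend, ← spechtVec_label]; rfl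
  · have hL' : ¬ Increasing (A.extLabel L) fun _ => 0 := by
      rw [← A.extWt_zero, A.increasing_ext_iff]; exact hL
    rw [spechtVec, dif_neg hL', spechtVec, dif_neg hL, map_zero]

theorem Restricts.spechtVec_other {g : Specht (n + 1) ν →ₗ[K] Specht n μ} (h : A.Restricts g)
    {L : Box ν ≃ Fin (n + 1)} (hL : L A.corner ≠ Fin.last n) : g (spechtVec L) = 0 := by
  by_cases hi : Increasing L fun _ => 0
  · rw [spechtVec, dif_pos hi]; exact h.other _ hL
  · rw [spechtVec, dif_neg hi, map_zero]

/-- For i < n the generator T_i leaves the label n+1 in place, and its seminormal coefficients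
involve only the boxes of the labels i and i+1. Hence restriction is equivariant for the smaller
Hecke algebra. -/
theorem Restricts.map_T {g : Specht (n + 1) ν →ₗ[K] Specht n μ} (h : A.Restricts g)
    (i : Fin (n - 1)) (v : Specht (n + 1) ν) :
    g (Hecke.T (upIdx i) • v) = Hecke.T i • g v := by
  have hv : v ∈ Submodule.span K (Set.range (Specht.of (n := n + 1) (μ := ν))) :=
    Specht.span_of ▸ Submodule.mem_top
  induction hv using Submodule.span_induction with
  | mem v hv =>
    obtain ⟨S', rfl⟩ := hv
    rw [T_smul_of, map_add, map_smul, map_smul]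
    by_cases hS : S'.label A.corner = Fin.last n
    · obtain ⟨S, rfl⟩ := A.exists_extendStd_eq hS
      have e : (A.extendStd S).label = A.extLabel S.label := rfl
      rw [h.extend, T_smul_of, e, A.extLabel_trans_adj, h.spechtVec_ext, lo_upIdx, hi_upIdx,
        ← A.extWt_zero, A.key_extLabel, A.key_extLabel]
    · rw [h.other S' hS, h.spechtVec_other, smul_zero, smul_zero, smul_zero, add_zero]
      rw [Equiv.trans_apply]
      intro h'
      rw [← adj_upIdx_last i] at h'
      exact hS ((adj (upIdx i)).injective h')
  | zero => simp only [smul_zero, map_zero]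
  | add x y _ _ hx hy => rw [smul_add, map_add, hx, hy, map_add, smul_add]
  | smul a x _ hx => rw [smul_comm, map_smul, hx, map_smul, smul_comm]

end AddBox

end VVMac
end

noncomputable section
namespace VVMac

variable {n : ℕ} {μ ν : YoungDiagram} {x₀ : ℕ × ℕ}

/-! ### Linear maps that set the last variable to zero -/

section SetLastZero

variable {M' M : Type} [AddCommGroup M'] [Module K M'] [Module (Daha (n + 1)) M']
  [IsScalarTower K (Daha (n + 1)) M'] [AddCommGroup M] [Module K M] [Module (Daha n) M]
  [IsScalarTower K (Daha n) M]

theorem Daha.T_smul_X_lo (i : Fin (n - 1)) (x : M) : Daha.T i • Daha.X (lo i) • x =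
    Daha.X (hi i) • Daha.T i • x - (t - 1) • Daha.X (lo i) • x := by
  rw [← mul_smul, Daha.T_mul_X_lo, sub_smul, mul_smul, smul_assoc]

theorem Daha.T_smul_X_hi (i : Fin (n - 1)) (x : M) : Daha.T i • Daha.X (hi i) • x =
    Daha.X (lo i) • (Daha.T i • x + (t - 1) • x) := by
  rw [← mul_smul, Daha.T_mul_X_hi, mul_smul, add_smul, algebraMap_smul]

omit [Module K M] [IsScalarTower K (Daha n) M] in
theorem Daha.T_smul_X {i : Fin (n - 1)} {j : Fin n} (h : j ≠ lo i) (h' : j ≠ hi i) (x : M) :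
    Daha.T i • Daha.X j • x = Daha.X j • Daha.T i • x := by
  rw [← mul_smul, Daha.T_X i j h h', mul_smul]

omit [Module K M] [IsScalarTower K (Daha n) M] in
theorem Daha.pi_smul_X (hn : 0 < n) (i : Fin (n - 1)) (x : M) :
    Daha.pi hn • Daha.X (lo i) • x = Daha.X (hi i) • Daha.pi hn • x := by
  rw [← mul_smul, Daha.pi_X, mul_smul]

theorem Daha.pi_smul_X_last (hn : 0 < n) (x : M) :
    Daha.pi hn • Daha.X ⟨n - 1, Nat.sub_lt hn Nat.one_pos⟩ • x =
      q • Daha.X ⟨0, hn⟩ • Daha.pi hn • x := by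
  rw [← mul_smul, Daha.pi_X_last, smul_assoc, mul_smul]

theorem Daha.t_heckeInv_smul (i : Fin (n - 1)) (x : M) :
    (t • heckeInv (Daha.T i)) • x = Daha.T i • x + (t - 1) • x := by
  rw [t_smul_heckeInv, add_smul, algebraMap_smul]

theorem Daha.t_smul_pi (hn : 0 < n) (x : M) : t • Daha.pi hn • x =
    t ^ n • Daha.theta ⟨0, hn⟩ • invProd (Daha.natT n) (n - 1) • x := by
  rw [Daha.pi_eq, smul_assoc, smul_smul, ← pow_succ', Nat.sub_add_cancel hn, mul_smul]

/-- T_n cancels the last inverse in π_{n+1}, leaving the same word that `Daha.t_smul_pi` gives for t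
π_n in the smaller algebra. -/
theorem Daha.pi_smul_T_top (hn : 0 < n) (x : M') :
    Daha.pi (Nat.succ_pos n) • Daha.T (topIdx hn) • x =
      t ^ n • Daha.theta ⟨0, Nat.succ_pos n⟩ • invProd (Daha.natT (n + 1)) (n - 1) • x := by
  have e : invProd (Daha.natT (n + 1)) (n + 1 - 1) =
      invProd (Daha.natT (n + 1)) (n - 1) * heckeInv (Daha.T (topIdx hn)) := by
    obtain ⟨m, rfl⟩ : ∃ m, n = m + 1 := ⟨n - 1, by omega⟩
    rw [← Daha.natT_val]; rfl
  have e' : heckeInv (Daha.T (topIdx hn)) • Daha.T (topIdx hn) • x = x := by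
    rw [← mul_smul, Daha.inv_mul_T, one_smul]
  rw [Daha.pi_eq, smul_assoc, mul_smul, e, mul_smul, e']; rfl

/-- The map `Φ` sets the last variable to zero. -/
structure SetsLastZero (Φ : M' →ₗ[K] M) : Prop where
  map_X : ∀ (j : Fin n) x, Φ (Daha.X j.castSucc • x) = Daha.X j • Φ x
  map_X_last : ∀ x, Φ (Daha.X (Fin.last n) • x) = 0

namespace SetsLastZero

variable {Φ : M' →ₗ[K] M} (C : SetsLastZero (n := n) Φ)
include C

theorem map_T_X {i : Fin (n - 1)} {x : M'} (hx : Φ (Daha.T (upIdx i) • x) = Daha.T i • Φ x)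
    (j : Fin (n + 1)) :
    Φ (Daha.T (upIdx i) • Daha.X j • x) = Daha.T i • Φ (Daha.X j • x) := by
  induction j using Fin.lastCases with
  | last =>
    rw [Daha.T_smul_X, C.map_X_last, C.map_X_last, smul_zero]
    · rw [lo_upIdx]; exact (Fin.castSucc_lt_last _).ne'
    · rw [hi_upIdx]; exact (Fin.castSucc_lt_last _).ne'
  | cast j =>
    rw [C.map_X]
    by_cases h1 : j = lo i
    · subst h1
      rw [← lo_upIdx, Daha.T_smul_X_lo, Daha.T_smul_X_lo, map_sub, Φ.map_smul, hi_upIdx, lo_upIdx,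
        C.map_X, C.map_X, hx]
    by_cases h2 : j = hi i
    · subst h2
      rw [← hi_upIdx, Daha.T_smul_X_hi, Daha.T_smul_X_hi, lo_upIdx, C.map_X, map_add, Φ.map_smul,
        hx]
    have h1' : j.castSucc ≠ lo (upIdx i) := fun h => h1 (Fin.castSucc_injective _ h)
    have h2' : j.castSucc ≠ hi (upIdx i) := fun h => h2 (Fin.castSucc_injective _ h)
    rw [Daha.T_smul_X h1 h2, Daha.T_smul_X h1' h2', C.map_X, hx]

omit [IsScalarTower K (Daha (n + 1)) M'] [IsScalarTower K (Daha n) M] in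
theorem map_pi_X_lo (hn : 0 < n) (x : M') :
    Φ (Daha.pi (Nat.succ_pos n) • Daha.X (lo (topIdx hn)) • x) = 0 := by
  rw [Daha.pi_smul_X, hi_topIdx, C.map_X_last]

/-- Inductive step of Φ π_{n+1} T_n = t π_n Φ. For X_{n+1} both sides vanish. For X_n, the
correction term of T_n X_n is killed by Φ, and π_{n+1} X_{n+1} = q X_1 π_{n+1} matches π_n X_n = q
X_1 π_n. For the remaining X_j both elements shift the index. -/
theorem map_pi_T_X (hn : 0 < n) {x : M'}
    (hx : Φ (Daha.pi (Nat.succ_pos n) • Daha.T (topIdx hn) • x) = t • Daha.pi hn • Φ x)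
    (j : Fin (n + 1)) : Φ (Daha.pi (Nat.succ_pos n) • Daha.T (topIdx hn) • Daha.X j • x) =
      t • Daha.pi hn • Φ (Daha.X j • x) := by
  induction j using Fin.lastCases with
  | last =>
    rw [C.map_X_last, ← hi_topIdx hn, Daha.T_smul_X_hi, C.map_pi_X_lo, smul_zero, smul_zero]
  | cast j =>
    rw [C.map_X]
    rcases V.eq_last_or_eq_lo hn j with rfl | ⟨i, rfl⟩
    · have e : ∀ y : M', Daha.pi (Nat.succ_pos n) • Daha.X (Fin.last n) • y =
          q • Daha.X (⟨0, hn⟩ : Fin n).castSucc • Daha.pi (Nat.succ_pos n) • y :=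
        Daha.pi_smul_X_last (Nat.succ_pos n)
      rw [← lo_topIdx hn, Daha.T_smul_X_lo, smul_sub, map_sub, smul_comm _ (t - 1), Φ.map_smul,
        C.map_pi_X_lo, smul_zero, sub_zero, hi_topIdx, e, Φ.map_smul, C.map_X, hx,
        Daha.pi_smul_X_last, smul_comm (Daha.X _) t, smul_comm q t]
    · have h1 : (lo i).castSucc ≠ lo (topIdx hn) := by
        have := i.2
        simp [lo, topIdx, Fin.ext_iff]; omega
      have h2 : (lo i).castSucc ≠ hi (topIdx hn) := by
        rw [hi_topIdx]; exact (Fin.castSucc_lt_last _).ne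
      rw [Daha.T_smul_X h1 h2, ← lo_upIdx, Daha.pi_smul_X, Daha.pi_smul_X, hi_upIdx, C.map_X, hx,
        smul_comm (Daha.X _) t]

omit C in
theorem map_heckeInv_T {i : Fin (n - 1)} {x : M'}
    (hx : Φ (Daha.T (upIdx i) • x) = Daha.T i • Φ x) :
    Φ (heckeInv (Daha.T (upIdx i)) • x) = heckeInv (Daha.T i) • Φ x := by
  rw [heckeInv, heckeInv, smul_assoc, smul_assoc, add_smul, add_smul, algebraMap_smul,
    algebraMap_smul, Φ.map_smul, map_add, Φ.map_smul, hx]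

omit C in
theorem map_intertwiner {i : Fin (n - 1)} {x : M'}
    (hx : Φ (Daha.T (upIdx i) • x) = Daha.T i • Φ x) (a : K) :
    Φ ((t • heckeInv (Daha.T (upIdx i)) + algebraMap K (Daha (n + 1)) a) • x) =
      (t • heckeInv (Daha.T i) + algebraMap K (Daha n) a) • Φ x := by
  rw [add_smul, add_smul, algebraMap_smul, algebraMap_smul, Daha.t_heckeInv_smul,
    Daha.t_heckeInv_smul, map_add, map_add, Φ.map_smul, Φ.map_smul, hx]

-- The scalar a drops out because Φ kills X_{n+1}; what survives comes from T_n X_{n+1} = X_n (t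
-- T_n⁻¹). This is how Ψ followed by s_n becomes Ψ under Φ.
omit [IsScalarTower K (Daha n) M] in
theorem map_intertwiner_X_last (hn : 0 < n) (a : K) (x : M') :
    Φ ((t • heckeInv (Daha.T (topIdx hn)) + algebraMap K (Daha (n + 1)) a) •
      Daha.X (Fin.last n) • x) = Daha.X ⟨n - 1, Nat.sub_lt hn Nat.one_pos⟩ •
        Φ ((t • heckeInv (Daha.T (topIdx hn))) • x) := by
  have hX : Daha.T (topIdx hn) • Daha.X (Fin.last n) • x =
      Daha.X (lo (topIdx hn)) • (t • heckeInv (Daha.T (topIdx hn))) • x := by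
    rw [← hi_topIdx hn, Daha.T_smul_X_hi, Daha.t_heckeInv_smul]
  rw [add_smul, Daha.t_heckeInv_smul _ (Daha.X (Fin.last n) • x), algebraMap_smul, map_add, map_add,
    Φ.map_smul, Φ.map_smul, C.map_X_last, smul_zero, smul_zero, add_zero, add_zero, hX, lo_topIdx,
    C.map_X]

end SetsLastZero

end SetLastZero

/-! ### Connecting maps -/

/-- The map `Φ` restricts tableaux by `g` and sets the last variable to zero. -/
def Connects (g : Specht (n + 1) ν →ₗ[K] Specht n μ) (Φ : V (n + 1) ν →ₗ[K] V n μ) : Prop :=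
  ∀ (α : Fin (n + 1) → ℕ) (v : Specht (n + 1) ν), Φ (V.tmul (Daha.Xpow α) v) =
    if α (Fin.last n) = 0 then V.tmul (Daha.Xpow fun i : Fin n => α i.castSucc) (g v) else 0

theorem V.induction_monomial {P : V n μ → Prop}
    (mono : ∀ α v, P (V.tmul (Daha.Xpow α) v)) (add : ∀ x y, P x → P y → P (x + y))
    (smul : ∀ (a : K) x, P x → P (a • x)) (x : V n μ) : P x := by
  have hx : x ∈ Submodule.span K (Set.range (monomialVec (n := n) (μ := μ))) :=
    span_monomialVec ▸ Submodule.mem_top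
  induction hx using Submodule.span_induction with
  | mem x h => obtain ⟨p, rfl⟩ := h; exact mono _ _
  | zero => rw [← zero_smul K (V.tmul (Daha.Xpow 0) 0 : V n μ)]; exact smul _ _ (mono _ _)
  | add x y _ _ hx hy => exact add x y hx hy
  | smul a x _ hx => exact smul a x hx

/-- The T_i⁻¹ preserve 1 ⊗ μ, where θ_1 acts as θ̄_1 = 1. -/
theorem V.theta_invProd_tmul (hn : 0 < n) (k : ℕ) (v : Specht n μ) :
    Daha.theta ⟨0, hn⟩ • invProd (Daha.natT n) k • V.tmul 1 v =
      invProd (Daha.natT n) k • V.tmul 1 v := by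
  obtain ⟨w, hw⟩ := Daha.invProd_mem
    (C := stabilizerAlgebra (Daha n) (LinearMap.range (V.ofSpecht n μ)))
    (by rintro i _ ⟨v, rfl⟩; exact ⟨_, (V.T_tmul i v).symm⟩) k (V.tmul 1 v) ⟨v, rfl⟩
  have hw' : invProd (Daha.natT n) k • V.tmul 1 v = V.tmul 1 w := hw.symm
  have h1 : Hecke.theta (⟨0, hn⟩ : Fin n) = 1 := rfl
  rw [hw', V.theta_tmul, h1, one_smul]

theorem V.tmul_zero (d : Daha n) : V.tmul d (0 : Specht n μ) = 0 := by
  have := V.tmul_smul d 0 (0 : Specht n μ)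
  rwa [zero_smul, zero_smul] at this

theorem exists_map_monomialVec {M : Type} [AddCommGroup M] [Module K M]
    (f : (Fin n → ℕ) × SYT n μ → M) : ∃ Φ : V n μ →ₗ[K] M, ∀ p, Φ (monomialVec p) = f p :=
  ⟨(monomialBasis n μ).constr K f, fun p => by
    rw [← monomialBasis_apply, Module.Basis.constr_basis]⟩

/-- The prescription is imposed on the basis X^α ⊗ S and extended linearly; without this basis the
formula could be inconsistent. -/
theorem exists_connects (g : Specht (n + 1) ν →ₗ[K] Specht n μ) :
    ∃ Φ : V (n + 1) ν →ₗ[K] V n μ, Connects g Φ := by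
  obtain ⟨Φ, hΦ⟩ := exists_map_monomialVec fun p : (Fin (n + 1) → ℕ) × SYT (n + 1) ν =>
    if p.1 (Fin.last n) = 0 then
      V.tmul (Daha.Xpow fun i : Fin n => p.1 i.castSucc) (g (Specht.of p.2)) else 0
  refine ⟨Φ, fun α v => ?_⟩
  have hv : v ∈ Submodule.span K (Set.range (Specht.of (n := n + 1) (μ := ν))) :=
    Specht.span_of ▸ Submodule.mem_top
  induction hv using Submodule.span_induction with
  | mem v hv =>
    obtain ⟨S, rfl⟩ := hv
    exact hΦ (α, S)
  | zero =>
    rw [V.tmul_zero, map_zero, map_zero, V.tmul_zero, ite_self]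
  | add x y _ _ hx hy =>
    rw [V.tmul_add, map_add, hx, hy, map_add, V.tmul_add]
    split_ifs
    · rfl
    · rw [add_zero]
  | smul a x _ hx =>
    rw [V.tmul_smul, Φ.map_smul, hx, g.map_smul, V.tmul_smul]
    split_ifs
    · rfl
    · rw [smul_zero]

namespace Connects

variable {g : Specht (n + 1) ν →ₗ[K] Specht n μ} {Φ : V (n + 1) ν →ₗ[K] V n μ}
  (C : Connects g Φ)
include C

theorem unique {Φ' : V (n + 1) ν →ₗ[K] V n μ} (C' : Connects g Φ') : Φ = Φ' := by
  refine LinearMap.ext fun x => ?_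
  induction x using V.induction_monomial with
  | mono α v => rw [C, C']
  | add x y hx hy => rw [map_add, map_add, hx, hy]
  | smul a x hx => rw [Φ.map_smul, Φ'.map_smul, hx]

theorem map_tmul_one (v : Specht (n + 1) ν) : Φ (V.tmul 1 v) = V.tmul 1 (g v) := by
  have h := C 0 v
  rw [Daha.Xpow_zero, Pi.zero_apply, if_pos rfl] at h
  rw [h]
  congr 1
  exact Daha.Xpow_zero

theorem map_X (j : Fin n) (x : V (n + 1) ν) :
    Φ (Daha.X j.castSucc • x) = Daha.X j • Φ x := by
  induction x using V.induction_monomial with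
  | mono α v =>
    have e1 : (α + Pi.single j.castSucc 1 : Fin (n + 1) → ℕ) (Fin.last n) = α (Fin.last n) := by
      simp [(Fin.castSucc_lt_last j).ne']
    have e2 : (fun i : Fin n => (α + Pi.single j.castSucc 1 : Fin (n + 1) → ℕ) i.castSucc) =
        (fun i : Fin n => α i.castSucc) + Pi.single j 1 := by
      ext i; simp [Pi.single_apply]
    rw [V.smul_tmul, Daha.X_mul_Xpow, C, C, e1, e2]
    split_ifs
    · rw [V.smul_tmul, Daha.X_mul_Xpow]
    · rw [smul_zero]
  | add x y hx hy => rw [smul_add, map_add, hx, hy, map_add, smul_add]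
  | smul a x hx => rw [smul_comm, Φ.map_smul, hx, Φ.map_smul, smul_comm]

theorem map_X_last (x : V (n + 1) ν) : Φ (Daha.X (Fin.last n) • x) = 0 := by
  induction x using V.induction_monomial with
  | mono α v =>
    rw [V.smul_tmul, Daha.X_mul_Xpow, C, if_neg]
    simp
  | add x y hx hy => rw [smul_add, map_add, hx, hy, add_zero]
  | smul a x hx => rw [smul_comm, Φ.map_smul, hx, smul_zero]

theorem setsLastZero : SetsLastZero (n := n) Φ := ⟨C.map_X, C.map_X_last⟩

end Connects

theorem AddBox.weight_extend (A : AddBox μ ν x₀) (τ : PSYT n μ) (j : Fin n) :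
    (A.extend τ).weight j.castSucc = τ.weight j := by
  have h : key (A.extend τ).label (A.extend τ).wt j.castSucc = key τ.label τ.wt j :=
    A.key_extLabel τ.label τ.wt j
  have h1 : (A.extend τ).w j.castSucc = τ.w j := congrArg Prod.fst h
  have h2 : (A.extend τ).c j.castSucc = τ.c j := congrArg Prod.snd h
  rw [PSYT.weight, PSYT.weight, h1, h2]

/-! ### Equivariance of the connecting map and its effect on Macdonald polynomials -/

section Equivariance

variable {A : AddBox μ ν x₀} {g : Specht (n + 1) ν →ₗ[K] Specht n μ}
  {Φ : V (n + 1) ν →ₗ[K] V n μ} (hg : A.Restricts g) (C : Connects g Φ)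
include hg C

theorem connects_map_T (i : Fin (n - 1)) (x : V (n + 1) ν) :
    Φ (Daha.T (upIdx i) • x) = Daha.T i • Φ x := by
  induction x using V.induction_on with
  | base v => rw [V.T_tmul, C.map_tmul_one, hg.map_T, C.map_tmul_one, V.T_tmul]
  | X j x hx => exact C.setsLastZero.map_T_X hx j
  | add x y hx hy => rw [smul_add, map_add, hx, hy, map_add, smul_add]
  | smul a x hx => rw [smul_comm, Φ.map_smul, hx, Φ.map_smul, smul_comm]

theorem connects_map_heckeInv_T (i : Fin (n - 1)) (x : V (n + 1) ν) :
    Φ (heckeInv (Daha.T (upIdx i)) • x) = heckeInv (Daha.T i) • Φ x := by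
  exact SetsLastZero.map_heckeInv_T (connects_map_T hg C i x)

theorem connects_map_invProd {k : ℕ} (hk : k < n) (x : V (n + 1) ν) :
    Φ (invProd (Daha.natT (n + 1)) k • x) = invProd (Daha.natT n) k • Φ x := by
  induction k generalizing x with
  | zero => rw [invProd, invProd, one_smul, one_smul]
  | succ k ih =>
    have h := connects_map_heckeInv_T hg C ⟨k, by omega⟩ x
    rw [← Daha.natT_val, ← Daha.natT_val] at h
    rw [invProd, invProd, mul_smul, mul_smul, ih (by omega)]
    exact congrArg _ h

theorem connects_map_pi_T_base (hn : 0 < n) (v : Specht (n + 1) ν) :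
    Φ (Daha.pi (Nat.succ_pos n) • Daha.T (topIdx hn) • V.tmul 1 v) =
      t • Daha.pi hn • Φ (V.tmul 1 v) := by
  rw [Daha.pi_smul_T_top hn, Daha.t_smul_pi, Φ.map_smul, C.map_tmul_one,
    V.theta_invProd_tmul, V.theta_invProd_tmul, connects_map_invProd hg C (by omega),
    C.map_tmul_one]

/-- The comparison of π_{n+1} with π_n: on 1 ⊗ v both sides are the same word in the T_i⁻¹ because
θ_1 acts trivially, and induction on the factors X_j does the rest. -/
theorem connects_map_pi_T (hn : 0 < n) (x : V (n + 1) ν) :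
    Φ (Daha.pi (Nat.succ_pos n) • Daha.T (topIdx hn) • x) = t • Daha.pi hn • Φ x := by
  induction x using V.induction_on with
  | base v => exact connects_map_pi_T_base hg C hn v
  | X j x hx => exact C.setsLastZero.map_pi_T_X hn hx j
  | add x y hx hy =>
    rw [smul_add, smul_add, map_add, hx, hy, map_add, smul_add, smul_add]
  | smul a x hx =>
    rw [smul_comm (Daha.T _) a, smul_comm (Daha.pi _) a, Φ.map_smul, hx, Φ.map_smul,
      smul_comm (Daha.pi _) a, smul_comm t a]

/-- Induction along covers of τ. An upward swap lifts to the extension; a step Ψ lifts to Ψ followed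
by the swap of n and n+1. -/
theorem connects_macdonald {F : PSYT n μ → V n μ} {F' : PSYT (n + 1) ν → V (n + 1) ν}
    (hF : IsMacdonald F) (hF' : IsMacdonald F') (τ : PSYT n μ) :
    Φ (F' (A.extend τ)) = F τ := by
  induction τ using PSYT.induction_cover with
  | std S =>
    rw [← A.extendStd_toPSYT, hF'.std, hF.std, C.map_tmul_one, hg.extend]
  | swap i τ σ h ih =>
    have e := hF'.swap _ _ _ (A.swapUp_extend h)
    rw [lo_upIdx, hi_upIdx, A.weight_extend, A.weight_extend] at e
    rw [← e, ← hF.swap _ _ _ h, ← ih]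
    exact SetsLastZero.map_intertwiner (connects_map_T hg C i _) _
  | psi τ σ hn h ih =>
    obtain ⟨u, hu, hσ⟩ := hF.psi hn τ σ h
    obtain ⟨u', hu', hρ⟩ := hF'.psi (Nat.succ_pos n) _ _ (A.extend τ).isPsi_psi
    have hq : (A.extend τ).w ⟨0, Nat.succ_pos n⟩ = τ.w ⟨0, hn⟩ :=
      congrArg Prod.fst (A.key_extLabel τ.label τ.wt ⟨0, hn⟩)
    have hlast : (⟨n + 1 - 1, Nat.sub_lt (Nat.succ_pos n) Nat.one_pos⟩ : Fin (n + 1)) =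
      Fin.last n := rfl
    rw [hq, hlast] at hρ
    -- With u' = π_{n+1}⁻¹ F_{τ⁺} and z = t T_n⁻¹ u', the vector π_{n+1} T_n z equals t F_{τ⁺}.
    -- Applying Φ and cancelling t and π_n gives Φ(z) = π_n⁻¹ F_τ.
    set z := (t • heckeInv (Daha.T (topIdx hn))) • u' with hz
    have hTz : Daha.T (topIdx hn) • z = t • u' := by
      rw [hz, ← mul_smul, mul_smul_comm, Daha.T_mul_inv, smul_assoc, one_smul]
    have hpi := connects_map_pi_T hg C hn z
    rw [hTz, smul_comm (Daha.pi _) t, Φ.map_smul, hu', ih, ← hu] at hpi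
    have huz : u = Φ z := pi_injective hn (smul_right_injective _ t_ne_zero hpi)
    rw [← hF'.swap _ _ _ (A.swapUp_psi_extend hn h), hρ, smul_comm _ (q ^ _), Φ.map_smul, hσ, huz,
      C.setsLastZero.map_intertwiner_X_last hn]

end Equivariance

/-! ### Padding -/

variable {lam : YoungDiagram}

theorem addBox_pad (hn : nMin lam ≤ n) : AddBox (pad lam n hn)
    (pad lam (n + 1) (Nat.le_succ_of_le hn)) (0, n - lam.card) where
  mem_iff := by
    rintro ⟨r, c⟩
    have : lam.card ≤ n := (Nat.le_add_right _ _).trans hn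
    rw [mem_pad, mem_pad, Prod.mk.injEq]
    constructor
    · rintro (⟨rfl, h⟩ | h)
      · omega
      · exact Or.inl (Or.inr h)
    · rintro ((⟨rfl, h⟩ | h) | ⟨rfl, rfl⟩)
      · exact Or.inl ⟨rfl, by omega⟩
      · exact Or.inr h
      · exact Or.inl ⟨rfl, by omega⟩
  notMem := by
    rw [mem_pad]
    rintro (⟨-, h⟩ | ⟨k, h, -⟩) <;> omega

/-- A box in a lower row has content below λ₁, and n ≥ |λ| + λ₁ makes the content n - |λ| of the
added box at least λ₁. -/
theorem content_le_corner (hn : nMin lam ≤ n)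
    (y : Box (pad lam (n + 1) (Nat.le_succ_of_le hn))) :
    content y ≤ content (addBox_pad hn).corner := by
  obtain ⟨⟨r, c⟩, hy⟩ := y
  have hn' := hn
  unfold nMin at hn'
  have hc : content (addBox_pad hn).corner = ((n - lam.card : ℕ) : ℤ) - 0 := rfl
  rw [hc]
  simp only [content]
  rcases mem_pad.1 hy with ⟨rfl, h⟩ | ⟨k, rfl, h⟩
  · omega
  · have h1 := YoungDiagram.mem_iff_lt_rowLen.1 h
    have h2 := lam.rowLen_anti 0 k (Nat.zero_le k)
    omega

theorem isRestriction_iff (hn : nMin lam ≤ n)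
    (g : Specht (n + 1) (pad lam (n + 1) (Nat.le_succ_of_le hn)) →ₗ[K] Specht n (pad lam n hn)) :
    IsRestriction lam n hn g ↔ (addBox_pad hn).Restricts g := by
  set A := addBox_pad hn
  constructor
  · rintro ⟨h1, h2⟩
    refine ⟨fun S => h1 _ S ?_ ?_, fun S' h => h2 S' ⟨_, A.corner.2, A.notMem, h⟩⟩
    · intro x h' hx
      rcases A.eq_corner_or ⟨x, h'⟩ with h | ⟨y, h⟩
      · rw [h]; exact A.extLabel_corner _
      · have h1 : x = y.1 := congrArg Subtype.val h
        exact absurd (h1 ▸ y.2) hx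
    · intro x h h'
      exact A.extLabel_incl S.label ⟨x, h⟩
  · intro h
    refine ⟨fun S' S h1 h2 => ?_, fun S' => ?_⟩
    · have : S' = A.extendStd S := by
        refine SYT.ext' (Equiv.ext fun y => ?_)
        change _ = A.extLabel S.label y
        rcases A.eq_corner_or y with rfl | ⟨x, rfl⟩
        · rw [A.extLabel_corner]; exact h1 _ _ A.notMem
        · rw [A.extLabel_incl]; exact h2 _ x.2 _
      rw [this, h.extend]
    · rintro ⟨x, h', hx, hl⟩
      refine h.other S' ?_
      rcases A.eq_corner_or ⟨x, h'⟩ with hc | ⟨y, hc⟩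
      · rwa [hc] at hl
      · have h1 : x = y.1 := congrArg Subtype.val hc
        exact absurd (h1 ▸ y.2) hx

theorem isConnecting_iff (hn : nMin lam ≤ n)
    (Φ : V (n + 1) (pad lam (n + 1) (Nat.le_succ_of_le hn)) →ₗ[K] V n (pad lam n hn)) :
    IsConnecting lam n hn Φ ↔ ∃ g, (addBox_pad hn).Restricts g ∧ Connects g Φ := by
  simp only [IsConnecting, isRestriction_iff]
  rfl

theorem existsUnique_isConnecting (hn : nMin lam ≤ n) :
    ∃! Φ : V (n + 1) (pad lam (n + 1) (Nat.le_succ_of_le hn)) →ₗ[K] V n (pad lam n hn),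
      IsConnecting lam n hn Φ := by
  obtain ⟨g, hg⟩ := (addBox_pad hn).exists_restricts (n := n)
  obtain ⟨Φ, hΦ⟩ := exists_connects g
  refine ⟨Φ, (isConnecting_iff hn Φ).2 ⟨g, hg, hΦ⟩, fun Φ' h => ?_⟩
  obtain ⟨g', hg', hΦ'⟩ := (isConnecting_iff hn Φ').1 h
  rw [hg'.unique hg] at hΦ'
  exact hΦ'.unique hΦ

end VVMac
end

theorem mainTheorem6 (lam : YoungDiagram) (n : ℕ) (hn : VVMac.nMin lam ≤ n)
    (T : VVMac.RYT (VVMac.pad lam n hn))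
    (T' : VVMac.RYT (VVMac.pad lam (n + 1) (Nat.le_succ_of_le hn)))
    (hres : ∀ (x : ℕ × ℕ) (h : x ∈ VVMac.pad lam n hn)
      (h' : x ∈ VVMac.pad lam (n + 1) (Nat.le_succ_of_le hn)), T.val ⟨x, h⟩ = T'.val ⟨x, h'⟩)
    (hzero : ∀ (x : ℕ × ℕ) (h' : x ∈ VVMac.pad lam (n + 1) (Nat.le_succ_of_le hn)),
      x ∉ VVMac.pad lam n hn → T'.val ⟨x, h'⟩ = 0) :
    -- `Top(T)`, `Top(T')`, the two families `F` and the connecting map are well defined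
    (∃! τ : VVMac.PSYT n (VVMac.pad lam n hn), VVMac.IsTop T τ) ∧
    (∃! τ' : VVMac.PSYT (n + 1) (VVMac.pad lam (n + 1) (Nat.le_succ_of_le hn)),
      VVMac.IsTop T' τ') ∧
    (∃! F : VVMac.PSYT n (VVMac.pad lam n hn) → VVMac.V n (VVMac.pad lam n hn),
      VVMac.IsMacdonald F) ∧
    (∃! F' : VVMac.PSYT (n + 1) (VVMac.pad lam (n + 1) (Nat.le_succ_of_le hn)) →
        VVMac.V (n + 1) (VVMac.pad lam (n + 1) (Nat.le_succ_of_le hn)),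
      VVMac.IsMacdonald F') ∧
    (∃! Φ : VVMac.V (n + 1) (VVMac.pad lam (n + 1) (Nat.le_succ_of_le hn)) →ₗ[VVMac.K]
        VVMac.V n (VVMac.pad lam n hn),
      VVMac.IsConnecting lam n hn Φ) ∧
    -- and `Φ(F_{Top(T')}) = F_{Top(T)}`
    ∀ (τ : VVMac.PSYT n (VVMac.pad lam n hn))
      (τ' : VVMac.PSYT (n + 1) (VVMac.pad lam (n + 1) (Nat.le_succ_of_le hn)))
      (F : VVMac.PSYT n (VVMac.pad lam n hn) → VVMac.V n (VVMac.pad lam n hn))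
      (F' : VVMac.PSYT (n + 1) (VVMac.pad lam (n + 1) (Nat.le_succ_of_le hn)) →
        VVMac.V (n + 1) (VVMac.pad lam (n + 1) (Nat.le_succ_of_le hn)))
      (Φ : VVMac.V (n + 1) (VVMac.pad lam (n + 1) (Nat.le_succ_of_le hn)) →ₗ[VVMac.K]
        VVMac.V n (VVMac.pad lam n hn)),
      VVMac.IsTop T τ → VVMac.IsTop T' τ' → VVMac.IsMacdonald F → VVMac.IsMacdonald F' →
      VVMac.IsConnecting lam n hn Φ → Φ (F' τ') = F τ := by
  refine ⟨VVMac.existsUnique_isTop (VVMac.card_pad hn) T,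
    VVMac.existsUnique_isTop (VVMac.card_pad _) T', VVMac.existsUnique_isMacdonald,
    VVMac.existsUnique_isMacdonald, VVMac.existsUnique_isConnecting hn, ?_⟩
  intro τ τ' F F' Φ hτ hτ' hF hF' hΦ
  obtain ⟨σ, hsat, hover⟩ := VVMac.exists_saturated_over (VVMac.card_pad hn) T
  obtain rfl : τ = σ := hsat.eq_of_isTop hover hτ
  let A := VVMac.addBox_pad hn
  have hover' : (A.extend τ).Over T' := by
    intro y
    change A.extWt τ.wt y = _
    rcases A.eq_corner_or y with rfl | ⟨x, rfl⟩
    · rw [A.extWt_corner]; exact (hzero _ _ A.notMem).symm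
    · rw [A.extWt_incl, hover x]; exact hres _ _ _
  -- The extension of Top(T) is saturated and has the exponents of T', so it is the greatest tableau
  -- over T'.
  have hext : τ' = A.extend τ :=
    (A.saturated_extend hsat (VVMac.content_le_corner hn)).eq_of_isTop hover' hτ'
  obtain ⟨g, hg, hC⟩ := (VVMac.isConnecting_iff hn Φ).1 hΦ
  rw [hext]
  exact VVMac.connects_macdonald hg hC hF hF' τ
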